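/- **Setting.** Let $F$ be a field of characteristic $0$ and $\mathbb N=\{0,1,2,\dots\}$. Let $J_1,J_2\in\{\{0\},\mathbb N\}$, $J=J_1\times J_2$, and let $\Gamma$ be an additive subgroup of $F^2$ such that $\pi_p(\Gamma)\neq\{0\}$ whenever $J_p=\{0\}$ ($p=1,2$), where $\pi_p$ is the $p$-th coordinate projection. Put $\sigma_1=(0,1)$, $\sigma_2=(0,2)$, $1_{[1]}=(1,0)$, $1_{[2]}=(0,1)$. Let $\mathcal A_2$ be the commutative algebra with basis $x^{\alpha,\mathbf i}$, $(\alpha,\mathbf i)\in\Gamma\times J$, and product $x^{\alpha,\mathbf i}x^{\beta,\mathbf j}=x^{\alpha+\beta,\mathbf i+\mathbf j}$; symbols $x^{\alpha,\mathbf i}$ with $(\alpha,\mathbf i)\notin\Gamma\times J$ are read as $0$. Let $\partial_p(x^{\alpha,\mathbf i})=\alpha_p x^{\alpha,\mathbf i}+i_p x^{\alpha,\mathbf i-1_{[p]}}$ for $p=1,2$. Then $$[u,v]=\partial_1(u)\partial_2(v)-\partial_1(v)\partial_2(u)+u\,\partial_1(v)-v\,\partial_1(u)$$ is a Lie bracket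 on $\mathcal A_2$ for which $x^{\sigma_1,0}$ is central. Let $\mathcal B_2=\mathcal A_2/Fx^{\sigma_1,0}$, and let $\mathcal B=[\mathcal B_2,\mathcal B_2]$ if $J=\{0\}$ and $\sigma_2\in\Gamma$, and $\mathcal B=\mathcal B_2$ otherwise. The images of the $x^{\alpha,\mathbf i}$ in $\mathcal B$ are denoted by the same symbols (so $x^{\sigma_1,0}=0$, and symbols not in $\mathcal B$ are read as $0$), $1=x^{0,0}$, and $\mathcal B_\alpha=\mathrm{span}\{x^{\alpha,\mathbf i}\mid \mathbf i\in J\}$. Let $\mathrm{Der}\,\mathcal B$ be the space of derivations of the Lie algebra $\mathcal B$ and, for $\alpha\in\Gamma$, $$(\mathrm{Der}\,\mathcal B)_\alpha=\{d\in\mathrm{Der}\,\mathcal B\mid d(\mathcal B_\beta)\subset\mathcal B_{\alpha+\beta}\text{ for all }\beta\in\Gamma\}.$$ Define the following derivations of $\mathcal B$: $\mathrm{ad}_u(v)=[u,v]$; for $\mu\in\mathrm{Hom}_{\mathbb Z}(\Gamma,F)$, $d_\mu(x^{\beta,\mathbf j})=\mu(\beta)x^{\beta,\mathbf j}$; $\partial_{t_2}(x^{\beta,\mathbf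 j})=j_2x^{\beta,\mathbf j-1_{[2]}}$ (zero if $J_2=\{0\}$); and - $d_1(x^{\beta,\mathbf j})=-\beta_1x^{\sigma_1+\beta,\mathbf j}-j_1x^{\sigma_1+\beta,\mathbf j-1_{[1]}}$ if $\sigma_1\in\Gamma$ and $J_2=\{0\}$, and $d_1=0$ otherwise; - $\bar d_1(x^{\beta,\mathbf j})=(\beta_2-1)x^{\sigma_1+\beta,\mathbf j}+j_2x^{\sigma_1+\beta,\mathbf j-1_{[2]}}$ if $\sigma_1\in\Gamma$ and $J_1=\{0\}$, and $\bar d_1=0$ otherwise; - $d_2(x^{\beta,0})=-\beta_1x^{\sigma_2+\beta,0}$ if $\sigma_2\in\Gamma$ and $J=\{0\}$, and $d_2=0$ otherwise. If $\pi_1(\Gamma)\neq\{0\}$ and $J_1=\{0\}$, let $\mathrm{Hom}^*$ be any complement of $F\pi_1|_\Gamma$ in the $F$-vector space $\mathrm{Hom}_{\mathbb Z}(\Gamma,F)$ (in this case $\mathrm{ad}_1=d_{\pi_1}$); otherwise let $\mathrm{Hom}^*=\mathrm{Hom}_{\mathbb Z}(\Gamma,F)$. **Theorem 2.6.** (1)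 $\mathrm{Der}\,\mathcal B=\bigoplus_{\alpha\in\Gamma}(\mathrm{Der}\,\mathcal B)_\alpha$, and for every $\alpha\in\Gamma$ the space $(\mathrm{Der}\,\mathcal B)_\alpha$ is the set of all $$\mathrm{ad}_u+d_\mu+f_1d_1+f_2\bar d_1+f_3d_2+f_4\partial_{t_2}$$ with $u\in\mathcal B_\alpha$, $\mu\in\mathrm{Hom}^*$, $f_1,\dots,f_4\in F$, where $\mu=0$ and $f_4=0$ if $\alpha\neq0$, $f_1=f_2=0$ if $\alpha\neq\sigma_1$, and $f_3=0$ if $\alpha\neq\sigma_2$. (2) Call $d\in\mathrm{Der}\,\mathcal B$ locally finite if every $v\in\mathcal B$ lies in a finite-dimensional $d$-invariant subspace. If $\pi_1(\Gamma)\neq\{0\}$, the set of locally finite elements of $\mathrm{Der}\,\mathcal B$ is $$F\,\mathrm{ad}_1+\{d_\mu\mid\mu\in\mathrm{Hom}^*\}+F\,\partial_{t_2};$$ if $\pi_1(\Gamma)=\{0\}$, it is $$\mathrm{span}_F\{\mathrm{ad}_{x^{\alpha,\mathbf i}}\mid(\alpha,\mathbf i)\in\Gamma\times J,\ i_1=0\text{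 or }(\alpha,\mathbf i)=(0,1_{[1]})\}+\{d_\mu\mid\mu\in\mathrm{Hom}_{\mathbb Z}(\Gamma,F)\}+F\,d_1+F\,\partial_{t_2}.$$ -/

import Mathlib

/-! Lie algebras of Block type attached to an additive subgroup `Γ` of `F × F` and to
exponent monoids `J₁, J₂ ∈ {{0}, ℕ}`. -/

namespace BlockLie

noncomputable section

/-- The two admissible exponent monoids `{0}` (as `⊥`) and `ℕ` (as `⊤`). -/
abbrev ExpMonoid : Type := {S : AddSubmonoid ℕ // S = ⊥ ∨ S = ⊤}

theorem pred_mem (J : ExpMonoid) {i : ℕ} (hi : i ∈ J.1) : i - 1 ∈ J.1 := by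
  rcases J with ⟨S, rfl | rfl⟩
  · simp_all
  · simp

/-- `i ↦ i - 1` on `J`, truncated at `0`; below it always occurs with the coefficient `i`. -/
def predE (J : ExpMonoid) (i : J.1) : J.1 := ⟨i - 1, pred_mem J i.2⟩

variable {F : Type*} [Field F] (Γ : AddSubgroup (F × F)) (J₁ J₂ : ExpMonoid)

/-- The commutative semigroup algebra with basis `x^{α,i}`, `(α, i) ∈ Γ × J₁ × J₂`. -/
abbrev SemigroupAlg : Type _ := AddMonoidAlgebra F (Γ × J₁.1 × J₂.1)

/-- The projection `π₁ : Γ → F`. -/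
def proj₁ : Γ →+ F := (AddMonoidHom.fst F F).comp Γ.subtype

/-- The projection `π₂ : Γ → F`. -/
def proj₂ : Γ →+ F := (AddMonoidHom.snd F F).comp Γ.subtype

variable {Γ J₁ J₂} in
/-- The linear map with prescribed values on the basis `x^{α,i}`. -/
def linOfBasis (D : Γ × J₁.1 × J₂.1 → SemigroupAlg Γ J₁ J₂) :
    SemigroupAlg Γ J₁ J₂ →ₗ[F] SemigroupAlg Γ J₁ J₂ :=
  (Finsupp.linearCombination F D).comp (AddMonoidAlgebra.coeffLinearEquiv F).toLinearMap

variable {Γ J₁ J₂} in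
theorem linOfBasis_single (D : Γ × J₁.1 × J₂.1 → SemigroupAlg Γ J₁ J₂) (m : Γ × J₁.1 × J₂.1)
    (c : F) : linOfBasis D (AddMonoidAlgebra.single m c) = c • D m := by
  simp [linOfBasis, AddMonoidAlgebra.coeffLinearEquiv]

variable {Γ J₁ J₂} in
/-- The derivation with prescribed values on the basis, for values satisfying the Leibniz rule. -/
def derivOfBasis (D : Γ × J₁.1 × J₂.1 → SemigroupAlg Γ J₁ J₂)
    (hD : ∀ m n, D (m + n) =
      AddMonoidAlgebra.single m 1 * D n + AddMonoidAlgebra.single n 1 * D m) :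
    Derivation F (SemigroupAlg Γ J₁ J₂) (SemigroupAlg Γ J₁ J₂) :=
  Derivation.mk' (linOfBasis D) (by
    intro a b
    induction a using AddMonoidAlgebra.induction_linear with
    | zero => simp
    | add f g hf hg => rw [add_mul, map_add, hf, hg, map_add]; simp only [smul_eq_mul]; ring
    | single m c =>
      induction b using AddMonoidAlgebra.induction_linear with
      | zero => simp
      | add f g hf hg => rw [mul_add, map_add, hf, hg, map_add]; simp only [smul_eq_mul]; ring
      | single n e =>
        rw [AddMonoidAlgebra.single_mul_single, linOfBasis_single, linOfBasis_single,
          linOfBasis_single, hD,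
          show AddMonoidAlgebra.single m c = c • AddMonoidAlgebra.single m (1 : F) by simp,
          show AddMonoidAlgebra.single n e = e • AddMonoidAlgebra.single n (1 : F) by simp]
        simp only [smul_eq_mul, smul_mul_assoc, mul_smul_comm, smul_add, smul_smul]
        rw [mul_comm e c])

variable {Γ} in
/-- The derivation `x^{β,j} ↦ μ(β) x^{β,j}` of the semigroup algebra. -/
def homDeriv (μ : Γ →+ F) : Derivation F (SemigroupAlg Γ J₁ J₂) (SemigroupAlg Γ J₁ J₂) :=
  derivOfBasis (fun m => μ m.1 • AddMonoidAlgebra.single m 1) (by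
    intro m n
    simp only [Prod.fst_add, map_add, mul_smul_comm, AddMonoidAlgebra.single_mul_single, mul_one,
      add_comm n m, ← add_smul]
    rw [add_comm])

theorem add_predE (J : ExpMonoid) (i j : J.1) (hj : (j : ℕ) ≠ 0) :
    i + predE J j = predE J (i + j) := by
  apply Subtype.ext
  simp only [predE, AddSubmonoid.coe_add]
  omega

/-- The derivation `x^{β,j} ↦ j₁ x^{β,j-1_[1]}` of the semigroup algebra. -/
def tDeriv₁ : Derivation F (SemigroupAlg Γ J₁ J₂) (SemigroupAlg Γ J₁ J₂) :=
  derivOfBasis (fun m => ((m.2.1 : ℕ) : F) •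
      AddMonoidAlgebra.single (m.1, predE J₁ m.2.1, m.2.2) 1) (by
    rintro ⟨α, i, k⟩ ⟨β, j, l⟩
    simp only [Prod.mk_add_mk, mul_smul_comm, AddMonoidAlgebra.single_mul_single, mul_one,
      AddSubmonoid.coe_add, Nat.cast_add, add_smul]
    rw [add_comm β α, add_comm l k, add_comm (((i : ℕ) : F) • _)]
    congr 1
    · by_cases hj : (j : ℕ) = 0
      · simp [hj]
      · rw [add_predE J₁ i j hj]
    · by_cases hi : (i : ℕ) = 0
      · simp [hi]
      · rw [add_predE J₁ j i hi, add_comm j i])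

/-- The derivation `x^{β,j} ↦ j₂ x^{β,j-1_[2]}` of the semigroup algebra. -/
def tDeriv₂ : Derivation F (SemigroupAlg Γ J₁ J₂) (SemigroupAlg Γ J₁ J₂) :=
  derivOfBasis (fun m => ((m.2.2 : ℕ) : F) •
      AddMonoidAlgebra.single (m.1, m.2.1, predE J₂ m.2.2) 1) (by
    rintro ⟨α, k, i⟩ ⟨β, l, j⟩
    simp only [Prod.mk_add_mk, mul_smul_comm, AddMonoidAlgebra.single_mul_single, mul_one,
      AddSubmonoid.coe_add, Nat.cast_add, add_smul]
    rw [add_comm β α, add_comm l k, add_comm (((i : ℕ) : F) • _)]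
    congr 1
    · by_cases hj : (j : ℕ) = 0
      · simp [hj]
      · rw [add_predE J₂ i j hj]
    · by_cases hi : (i : ℕ) = 0
      · simp [hi]
      · rw [add_predE J₂ j i hi, add_comm j i])

/-- `∂₁ : x^{α,i} ↦ α₁ x^{α,i} + i₁ x^{α,i-1_[1]}`. -/
def pd₁ : Derivation F (SemigroupAlg Γ J₁ J₂) (SemigroupAlg Γ J₁ J₂) :=
  homDeriv J₁ J₂ (proj₁ Γ) + tDeriv₁ Γ J₁ J₂

/-- `∂₂ : x^{α,i} ↦ α₂ x^{α,i} + i₂ x^{α,i-1_[2]}`. -/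
def pd₂ : Derivation F (SemigroupAlg Γ J₁ J₂) (SemigroupAlg Γ J₁ J₂) :=
  homDeriv J₁ J₂ (proj₂ Γ) + tDeriv₂ Γ J₁ J₂

section formulas

variable {Γ J₁ J₂}

open AddMonoidAlgebra (single)

theorem homDeriv_single (μ : Γ →+ F) (m : Γ × J₁.1 × J₂.1) (c : F) :
    homDeriv J₁ J₂ μ (single m c) = single m (μ m.1 * c) := by
  refine (linOfBasis_single _ m c).trans ?_
  simp [mul_comm]

theorem tDeriv₁_single (m : Γ × J₁.1 × J₂.1) (c : F) :
    tDeriv₁ Γ J₁ J₂ (single m c) =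
      single (m.1, predE J₁ m.2.1, m.2.2) (((m.2.1 : ℕ) : F) * c) := by
  refine (linOfBasis_single _ m c).trans ?_
  simp [mul_comm]

theorem tDeriv₂_single (m : Γ × J₁.1 × J₂.1) (c : F) :
    tDeriv₂ Γ J₁ J₂ (single m c) =
      single (m.1, m.2.1, predE J₂ m.2.2) (((m.2.2 : ℕ) : F) * c) := by
  refine (linOfBasis_single _ m c).trans ?_
  simp [mul_comm]

theorem deriv_comm_of_single
    {D E : Derivation F (SemigroupAlg Γ J₁ J₂) (SemigroupAlg Γ J₁ J₂)}
    (h : ∀ m c, D (E (single m c)) = E (D (single m c))) (v : SemigroupAlg Γ J₁ J₂) :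
    D (E v) = E (D v) := by
  induction v using AddMonoidAlgebra.induction_linear with
  | zero => simp
  | add f g hf hg => simp [hf, hg]
  | single m c => exact h m c

theorem homDeriv_homDeriv (μ ν : Γ →+ F) (v : SemigroupAlg Γ J₁ J₂) :
    homDeriv J₁ J₂ μ (homDeriv J₁ J₂ ν v) = homDeriv J₁ J₂ ν (homDeriv J₁ J₂ μ v) :=
  deriv_comm_of_single (fun m c => by
    simp only [homDeriv_single]; congr 1; ring) v

theorem homDeriv_tDeriv₁ (μ : Γ →+ F) (v : SemigroupAlg Γ J₁ J₂) :
    homDeriv J₁ J₂ μ (tDeriv₁ Γ J₁ J₂ v) = tDeriv₁ Γ J₁ J₂ (homDeriv J₁ J₂ μ v) :=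
  deriv_comm_of_single (fun m c => by
    simp only [homDeriv_single, tDeriv₁_single]; congr 1; ring) v

theorem homDeriv_tDeriv₂ (μ : Γ →+ F) (v : SemigroupAlg Γ J₁ J₂) :
    homDeriv J₁ J₂ μ (tDeriv₂ Γ J₁ J₂ v) = tDeriv₂ Γ J₁ J₂ (homDeriv J₁ J₂ μ v) :=
  deriv_comm_of_single (fun m c => by
    simp only [homDeriv_single, tDeriv₂_single]; congr 1; ring) v

theorem tDeriv₁_tDeriv₂ (v : SemigroupAlg Γ J₁ J₂) :
    tDeriv₁ Γ J₁ J₂ (tDeriv₂ Γ J₁ J₂ v) = tDeriv₂ Γ J₁ J₂ (tDeriv₁ Γ J₁ J₂ v) :=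
  deriv_comm_of_single (fun m c => by
    simp only [tDeriv₁_single, tDeriv₂_single]; congr 1; ring) v

theorem pd₁_single (m : Γ × J₁.1 × J₂.1) (c : F) :
    pd₁ Γ J₁ J₂ (single m c) = single m ((m.1 : F × F).1 * c) +
      single (m.1, predE J₁ m.2.1, m.2.2) (((m.2.1 : ℕ) : F) * c) := by
  simp only [pd₁, Derivation.add_apply, homDeriv_single, tDeriv₁_single]
  rfl

theorem pd₂_single (m : Γ × J₁.1 × J₂.1) (c : F) :
    pd₂ Γ J₁ J₂ (single m c) = single m ((m.1 : F × F).2 * c) +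
      single (m.1, m.2.1, predE J₂ m.2.2) (((m.2.2 : ℕ) : F) * c) := by
  simp only [pd₂, Derivation.add_apply, homDeriv_single, tDeriv₂_single]
  rfl

theorem pd₁_pd₂ (v : SemigroupAlg Γ J₁ J₂) :
    pd₁ Γ J₁ J₂ (pd₂ Γ J₁ J₂ v) = pd₂ Γ J₁ J₂ (pd₁ Γ J₁ J₂ v) := by
  simp only [pd₁, pd₂, Derivation.add_apply, map_add, homDeriv_homDeriv (proj₁ Γ) (proj₂ Γ),
    homDeriv_tDeriv₂, homDeriv_tDeriv₁, tDeriv₁_tDeriv₂]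
  abel

end formulas

/-! ### The Lie algebras `A₂(Γ, J)` and `B₂(Γ, J)` -/

section bracket

variable {Γ J₁ J₂}

/-- The bracket `[u, v] = ∂₁(u) ∂₂(v) - ∂₁(v) ∂₂(u) + u ∂₁(v) - v ∂₁(u)`. -/
def br (u v : SemigroupAlg Γ J₁ J₂) : SemigroupAlg Γ J₁ J₂ :=
  pd₁ Γ J₁ J₂ u * pd₂ Γ J₁ J₂ v - pd₁ Γ J₁ J₂ v * pd₂ Γ J₁ J₂ u
    + u * pd₁ Γ J₁ J₂ v - v * pd₁ Γ J₁ J₂ u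

theorem br_add_left (u v w : SemigroupAlg Γ J₁ J₂) : br (u + v) w = br u w + br v w := by
  simp only [br, map_add]; ring

theorem br_add_right (u v w : SemigroupAlg Γ J₁ J₂) : br u (v + w) = br u v + br u w := by
  simp only [br, map_add]; ring

theorem br_self (u : SemigroupAlg Γ J₁ J₂) : br u u = 0 := by
  simp only [br]; ring

theorem br_smul (c : F) (u v : SemigroupAlg Γ J₁ J₂) : br u (c • v) = c • br u v := by
  simp only [br, Derivation.map_smul, mul_smul_comm, smul_mul_assoc, smul_sub, smul_add]

theorem br_jacobi (u v w : SemigroupAlg Γ J₁ J₂) :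
    br u (br v w) = br (br u v) w + br v (br u w) := by
  simp only [br, map_add, map_sub, Derivation.leibniz, smul_eq_mul, pd₁_pd₂]; ring

end bracket

/-- The space `A₂(Γ, J)`: the vector space of the semigroup algebra, with the bracket `br`. -/
def A₂ : Type _ := SemigroupAlg Γ J₁ J₂

instance : AddCommGroup (A₂ Γ J₁ J₂) := inferInstanceAs (AddCommGroup (SemigroupAlg Γ J₁ J₂))

instance : Module F (A₂ Γ J₁ J₂) := inferInstanceAs (Module F (SemigroupAlg Γ J₁ J₂))

instance : LieRing (A₂ Γ J₁ J₂) where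
  bracket := br (Γ := Γ) (J₁ := J₁) (J₂ := J₂)
  add_lie := br_add_left
  lie_add := br_add_right
  lie_self := br_self
  leibniz_lie := br_jacobi

instance : LieAlgebra F (A₂ Γ J₁ J₂) where
  lie_smul := br_smul

/-- The identity map, from the semigroup algebra to the Lie algebra `A₂`. -/
def toA₂ : SemigroupAlg Γ J₁ J₂ ≃ₗ[F] A₂ Γ J₁ J₂ := LinearEquiv.refl F (SemigroupAlg Γ J₁ J₂)

theorem lie_toA₂ (u v : SemigroupAlg Γ J₁ J₂) :
    ⁅toA₂ Γ J₁ J₂ u, toA₂ Γ J₁ J₂ v⁆ = toA₂ Γ J₁ J₂ (br u v) := rfl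

/-- `σ₁ = (0, 1)`. -/
def σ₁ : F × F := (0, 1)

/-- `σ₂ = (0, 2)`. -/
def σ₂ : F × F := (0, 2)

open scoped Classical in
/-- The element `x^{α,i}` of the semigroup algebra, read as `0` unless `(α, i) ∈ Γ × J`. -/
def xA (α : F × F) (i : ℕ × ℕ) : SemigroupAlg Γ J₁ J₂ :=
  if h : α ∈ Γ ∧ i.1 ∈ J₁.1 ∧ i.2 ∈ J₂.1 then
    AddMonoidAlgebra.single (⟨α, h.1⟩, ⟨i.1, h.2.1⟩, ⟨i.2, h.2.2⟩) 1
  else 0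

theorem pd₁_xσ₁ : pd₁ Γ J₁ J₂ (xA Γ J₁ J₂ σ₁ 0) = 0 := by
  unfold xA
  split_ifs with h
  · simp [pd₁_single, σ₁]
  · simp

theorem pd₂_xσ₁ : pd₂ Γ J₁ J₂ (xA Γ J₁ J₂ σ₁ 0) = xA Γ J₁ J₂ σ₁ 0 := by
  unfold xA
  split_ifs with h
  · simp [pd₂_single, σ₁]
  · simp

theorem br_xσ₁ (c : F) (u : SemigroupAlg Γ J₁ J₂) : br u (c • xA Γ J₁ J₂ σ₁ 0) = 0 := by
  rw [br_smul, br, pd₁_xσ₁, pd₂_xσ₁]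
  simp [mul_comm]

/-- The central ideal `F x^{σ₁,0}` of `A₂`. -/
def Z : LieIdeal F (A₂ Γ J₁ J₂) where
  toSubmodule := Submodule.span F {toA₂ Γ J₁ J₂ (xA Γ J₁ J₂ σ₁ 0)}
  lie_mem := by
    intro u m hm
    obtain ⟨c, rfl⟩ := Submodule.mem_span_singleton.1 hm
    obtain ⟨u, rfl⟩ := (toA₂ Γ J₁ J₂).surjective u
    rw [← map_smul, lie_toA₂, br_xσ₁, map_zero]
    exact Submodule.zero_mem _

/-- `B₂(Γ, J) = A₂(Γ, J) / F x^{σ₁,0}`. -/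
abbrev B₂ : Type _ := A₂ Γ J₁ J₂ ⧸ Z Γ J₁ J₂

/-- The image of `x^{α,i}` in `B₂`. -/
def xB₂ (α : F × F) (i : ℕ × ℕ) : B₂ Γ J₁ J₂ :=
  LieSubmodule.Quotient.mk (N := Z Γ J₁ J₂) (toA₂ Γ J₁ J₂ (xA Γ J₁ J₂ α i))

/-! ### The Lie algebra `B(Γ, J)` -/

open scoped Classical in
/-- `B(Γ, J)` inside `B₂(Γ, J)`: the derived algebra `[B₂, B₂]` if `J = {0}` and `σ₂ ∈ Γ`, and
all of `B₂` otherwise. -/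
def BSub : LieSubalgebra F (B₂ Γ J₁ J₂) :=
  if J₁.1 = ⊥ ∧ J₂.1 = ⊥ ∧ σ₂ ∈ Γ then
    (LieAlgebra.derivedSeries F (B₂ Γ J₁ J₂) 1).toLieSubalgebra
  else ⊤

/-- The Lie algebra `B = B(Γ, J)`. -/
abbrev B : Type _ := BSub Γ J₁ J₂

open scoped Classical in
/-- The element `x^{α,i}` of `B`, read as `0` if `(α, i) ∉ Γ × J` or `x^{α,i}` is not in `B`. -/
def xB (α : F × F) (i : ℕ × ℕ) : B Γ J₁ J₂ :=
  if h : xB₂ Γ J₁ J₂ α i ∈ BSub Γ J₁ J₂ then ⟨xB₂ Γ J₁ J₂ α i, h⟩ else 0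

/-- The homogeneous component `B_α = span {x^{α,i} | i ∈ J}`. -/
def gr (α : F × F) : Submodule F (B Γ J₁ J₂) :=
  Submodule.span F {v | ∃ i : ℕ × ℕ, i.1 ∈ J₁.1 ∧ i.2 ∈ J₂.1 ∧ v = xB Γ J₁ J₂ α i}

/-! ### Derivations -/

/-- `Der B`, the space of derivations of `B`. -/
abbrev Der : Type _ := LieDerivation F (B Γ J₁ J₂) (B Γ J₁ J₂)

/-- `(Der B)_α`: the derivations which map `B_β` into `B_{α+β}` for all `β ∈ Γ`. -/
def derGr (α : Γ) : Submodule F (Der Γ J₁ J₂) where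
  carrier := {d | ∀ β : Γ, ∀ v ∈ gr Γ J₁ J₂ β, d v ∈ gr Γ J₁ J₂ ((α : F × F) + β)}
  zero_mem' := fun _ _ _ => by simp
  add_mem' := fun hd he β v hv => by
    rw [LieDerivation.add_apply]; exact Submodule.add_mem _ (hd β v hv) (he β v hv)
  smul_mem' := fun c d hd β v hv => by
    rw [LieDerivation.smul_apply]; exact Submodule.smul_mem _ c (hd β v hv)

variable {Γ J₁ J₂} in
/-- `d` is locally finite: every vector lies in a finite-dimensional `d`-invariant subspace. -/
def IsLocallyFinite (d : Der Γ J₁ J₂) : Prop :=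
  ∀ v : B Γ J₁ J₂, ∃ W : Submodule F (B Γ J₁ J₂),
    FiniteDimensional F W ∧ v ∈ W ∧ ∀ w ∈ W, d w ∈ W

variable {Γ J₁ J₂} in
/-- The inner derivation `ad_u : v ↦ [u, v]` of `B`. -/
abbrev adB (u : B Γ J₁ J₂) : Der Γ J₁ J₂ :=
  LieDerivation.ad F (B Γ J₁ J₂) u

variable {Γ J₁ J₂} in
/-- The derivation of `B₂` induced by a linear endomorphism of `A₂` which satisfies the Leibniz
rule for the bracket and preserves `F x^{σ₁,0}`. -/
def derB₂ (T : SemigroupAlg Γ J₁ J₂ →ₗ[F] SemigroupAlg Γ J₁ J₂)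
    (hT : ∀ u v, T (br u v) = br u (T v) - br v (T u))
    (h0 : ∃ c : F, T (xA Γ J₁ J₂ σ₁ 0) = c • xA Γ J₁ J₂ σ₁ 0) :
    LieDerivation F (B₂ Γ J₁ J₂) (B₂ Γ J₁ J₂) where
  toLinearMap := Submodule.mapQ (Z Γ J₁ J₂).toSubmodule (Z Γ J₁ J₂).toSubmodule
    ((toA₂ Γ J₁ J₂).toLinearMap ∘ₗ T ∘ₗ (toA₂ Γ J₁ J₂).symm.toLinearMap) (by
      refine (Submodule.span_le).2 ?_
      rintro _ rfl
      obtain ⟨c, hc⟩ := h0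
      exact Submodule.mem_span_singleton.2 ⟨c, by simp [hc]⟩)
  leibniz' := by
    intro a b
    induction a using Submodule.Quotient.induction_on with | _ a
    induction b using Submodule.Quotient.induction_on with | _ b
    exact congrArg (fun v => LieSubmodule.Quotient.mk (N := Z Γ J₁ J₂) (toA₂ Γ J₁ J₂ v))
      (hT ((toA₂ Γ J₁ J₂).symm a) ((toA₂ Γ J₁ J₂).symm b))

theorem derB₂_mem_BSub (T : LieDerivation F (B₂ Γ J₁ J₂) (B₂ Γ J₁ J₂)) {v : B₂ Γ J₁ J₂}
    (hv : v ∈ BSub Γ J₁ J₂) : T v ∈ BSub Γ J₁ J₂ := by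
  unfold BSub at hv ⊢
  split_ifs with h
  · rw [if_pos h] at hv
    rw [← LieSubalgebra.mem_toSubmodule, LieAlgebra.coe_derivedSeries_one_eq] at hv ⊢
    induction hv using Submodule.span_induction with
    | mem v hv =>
      obtain ⟨a, b, rfl⟩ := hv
      rw [LieDerivation.apply_lie_eq_sub]
      exact Submodule.sub_mem _ (Submodule.subset_span ⟨_, _, rfl⟩)
        (Submodule.subset_span ⟨_, _, rfl⟩)
    | zero => rw [map_zero]; exact Submodule.zero_mem _
    | add v w _ _ h1 h2 => rw [map_add]; exact Submodule.add_mem _ h1 h2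
    | smul c v _ h1 => rw [map_smul]; exact Submodule.smul_mem _ c h1
  · trivial

variable {Γ J₁ J₂} in
/-- The restriction to `B` of a derivation of `B₂`. -/
def restrictDer (T : LieDerivation F (B₂ Γ J₁ J₂) (B₂ Γ J₁ J₂)) : Der Γ J₁ J₂ where
  toLinearMap := T.toLinearMap.restrict (fun _ hv => derB₂_mem_BSub Γ J₁ J₂ T hv)
  leibniz' := fun a b => Subtype.ext (T.leibniz' a b)

variable {Γ J₁ J₂} in
theorem leibniz_br_of_comm {D : Derivation F (SemigroupAlg Γ J₁ J₂) (SemigroupAlg Γ J₁ J₂)}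
    (h₁ : ∀ v, D (pd₁ Γ J₁ J₂ v) = pd₁ Γ J₁ J₂ (D v))
    (h₂ : ∀ v, D (pd₂ Γ J₁ J₂ v) = pd₂ Γ J₁ J₂ (D v)) (u v : SemigroupAlg Γ J₁ J₂) :
    D (br u v) = br u (D v) - br v (D u) := by
  simp only [br, map_add, map_sub, Derivation.leibniz, smul_eq_mul, h₁, h₂]; ring

/-- The derivation `d_μ : x^{β,j} ↦ μ(β) x^{β,j}` of `B`. -/
def dHom (μ : Γ →+ F) : Der Γ J₁ J₂ :=
  restrictDer (derB₂ (homDeriv J₁ J₂ μ).toLinearMap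
    (leibniz_br_of_comm
      (fun v => by
        simp only [pd₁, Derivation.add_apply, map_add, homDeriv_homDeriv μ, homDeriv_tDeriv₁])
      (fun v => by
        simp only [pd₂, Derivation.add_apply, map_add, homDeriv_homDeriv μ, homDeriv_tDeriv₂]))
    (by
      unfold xA
      split_ifs with h
      · exact ⟨μ ⟨σ₁, h.1⟩, by
          rw [Derivation.coeFn_coe, homDeriv_single, AddMonoidAlgebra.smul_single, smul_eq_mul]⟩
      · exact ⟨0, by simp⟩))

/-- The derivation `∂_{t₂} : x^{β,j} ↦ j₂ x^{β,j-1_[2]}` of `B`; it is `0` if `J₂ = {0}`. -/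
def dt₂ : Der Γ J₁ J₂ :=
  restrictDer (derB₂ (tDeriv₂ Γ J₁ J₂).toLinearMap
    (leibniz_br_of_comm
      (fun v => by
        simp only [pd₁, Derivation.add_apply, map_add, homDeriv_tDeriv₂, tDeriv₁_tDeriv₂])
      (fun v => by
        simp only [pd₂, Derivation.add_apply, map_add, homDeriv_tDeriv₂]))
    (by
      unfold xA
      split_ifs with h
      · exact ⟨0, by rw [Derivation.coeFn_coe, tDeriv₂_single]; simp⟩
      · exact ⟨0, by simp⟩))

/-- The endomorphism `v ↦ -x^{σ₁,0} ∂₁(v)` of the semigroup algebra (it is `ad` of the element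
`x^{σ₁,1_[2]}` of `A₂(Γ, ℕ²)`, restricted to `A₂(Γ, J)`). -/
def shift₁ : SemigroupAlg Γ J₁ J₂ →ₗ[F] SemigroupAlg Γ J₁ J₂ :=
  -(LinearMap.mulLeft F (xA Γ J₁ J₂ σ₁ 0) ∘ₗ (pd₁ Γ J₁ J₂).toLinearMap)

/-- The endomorphism `v ↦ x^{σ₁,0} (∂₂(v) - v)` of the semigroup algebra (it is `ad` of the
element `x^{σ₁,1_[1]}` of `A₂(Γ, ℕ²)`, restricted to `A₂(Γ, J)`). -/
def shift₁' : SemigroupAlg Γ J₁ J₂ →ₗ[F] SemigroupAlg Γ J₁ J₂ :=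
  LinearMap.mulLeft F (xA Γ J₁ J₂ σ₁ 0) ∘ₗ ((pd₂ Γ J₁ J₂).toLinearMap - LinearMap.id)

theorem shift₁_apply (v : SemigroupAlg Γ J₁ J₂) :
    shift₁ Γ J₁ J₂ v = -(xA Γ J₁ J₂ σ₁ 0 * pd₁ Γ J₁ J₂ v) := by
  simp [shift₁]

theorem shift₁'_apply (v : SemigroupAlg Γ J₁ J₂) :
    shift₁' Γ J₁ J₂ v = xA Γ J₁ J₂ σ₁ 0 * (pd₂ Γ J₁ J₂ v - v) := by
  simp [shift₁']

open scoped Classical in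
/-- The derivation
`d₁ : x^{β,j} ↦ -β₁ x^{σ₁+β,j} - j₁ x^{σ₁+β,j-1_[1]}` of `B` if `σ₁ ∈ Γ` and `J₂ = {0}`, and
`d₁ = 0` otherwise (`x^{σ₁,0}` is read as `0` if `σ₁ ∉ Γ`). -/
def d₁ : Der Γ J₁ J₂ :=
  if J₂.1 = ⊥ then
    restrictDer (derB₂ (shift₁ Γ J₁ J₂)
      (fun u v => by
        simp only [shift₁_apply, br, map_add, map_sub, map_neg, Derivation.leibniz, smul_eq_mul,
          pd₁_pd₂, pd₁_xσ₁, pd₂_xσ₁]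
        ring)
      ⟨0, by simp [shift₁_apply, pd₁_xσ₁]⟩)
  else 0

open scoped Classical in
/-- The derivation
`d̄₁ : x^{β,j} ↦ (β₂ - 1) x^{σ₁+β,j} + j₂ x^{σ₁+β,j-1_[2]}` of `B` if `σ₁ ∈ Γ` and `J₁ = {0}`,
and `d̄₁ = 0` otherwise (`x^{σ₁,0}` is read as `0` if `σ₁ ∉ Γ`). -/
def dBar₁ : Der Γ J₁ J₂ :=
  if J₁.1 = ⊥ then
    restrictDer (derB₂ (shift₁' Γ J₁ J₂)
      (fun u v => by
        simp only [shift₁'_apply, br, map_add, map_sub, Derivation.leibniz, smul_eq_mul,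
          pd₁_pd₂, pd₁_xσ₁, pd₂_xσ₁]
        ring)
      ⟨0, by simp [shift₁'_apply, pd₂_xσ₁]⟩)
  else 0

open scoped Classical in
/-- The derivation `d₂ = ad_{x^{σ₂,0}}|_B : x^{β,0} ↦ -β₁ x^{σ₂+β,0}` of `B` if `σ₂ ∈ Γ` and
`J = {0}`, and `d₂ = 0` otherwise (`x^{σ₂,0}` is read as `0` if `σ₂ ∉ Γ`). -/
def d₂ : Der Γ J₁ J₂ :=
  if J₁.1 = ⊥ ∧ J₂.1 = ⊥ then
    restrictDer (LieDerivation.ad F (B₂ Γ J₁ J₂) (xB₂ Γ J₁ J₂ σ₂ 0))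
  else 0

section formulas

/-! The formulas on the basis elements which were announced above. -/

variable {Γ J₁ J₂}

theorem xA_of_mem (m : Γ × J₁.1 × J₂.1) :
    xA Γ J₁ J₂ m.1 (m.2.1, m.2.2) = AddMonoidAlgebra.single m 1 :=
  dif_pos ⟨m.1.2, m.2.1.2, m.2.2.2⟩

theorem xσ₁_mul (hσ : σ₁ ∈ Γ) (m : Γ × J₁.1 × J₂.1) (c : F) :
    xA Γ J₁ J₂ σ₁ 0 * AddMonoidAlgebra.single m c =
      c • xA Γ J₁ J₂ (σ₁ + (m.1 : F × F)) (m.2.1, m.2.2) := by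
  have e : xA Γ J₁ J₂ (σ₁ + (m.1 : F × F)) (m.2.1, m.2.2) =
      AddMonoidAlgebra.single ((⟨σ₁, hσ⟩, 0, 0) + m) 1 := by
    rw [← xA_of_mem]; simp
  rw [e, show xA Γ J₁ J₂ σ₁ 0 = AddMonoidAlgebra.single (⟨σ₁, hσ⟩, 0, 0) 1 from
    xA_of_mem (⟨σ₁, hσ⟩, 0, 0), AddMonoidAlgebra.single_mul_single, one_mul,
    AddMonoidAlgebra.smul_single, smul_eq_mul, mul_one]

/-- The formula for `d₁`. -/
theorem shift₁_single (hσ : σ₁ ∈ Γ) (m : Γ × J₁.1 × J₂.1) :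
    shift₁ Γ J₁ J₂ (AddMonoidAlgebra.single m 1) =
      -((m.1 : F × F).1 • xA Γ J₁ J₂ (σ₁ + (m.1 : F × F)) (m.2.1, m.2.2)) -
        ((m.2.1 : ℕ) : F) • xA Γ J₁ J₂ (σ₁ + (m.1 : F × F)) (m.2.1 - 1, m.2.2) := by
  rw [shift₁_apply, pd₁_single, mul_one, mul_one, mul_add, xσ₁_mul hσ, xσ₁_mul hσ, neg_add,
    sub_eq_add_neg]
  rfl

/-- The formula for `d̄₁`. -/
theorem shift₁'_single (hσ : σ₁ ∈ Γ) (m : Γ × J₁.1 × J₂.1) :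
    shift₁' Γ J₁ J₂ (AddMonoidAlgebra.single m 1) =
      ((m.1 : F × F).2 - 1) • xA Γ J₁ J₂ (σ₁ + (m.1 : F × F)) (m.2.1, m.2.2) +
        ((m.2.2 : ℕ) : F) • xA Γ J₁ J₂ (σ₁ + (m.1 : F × F)) (m.2.1, m.2.2 - 1) := by
  rw [shift₁'_apply, pd₂_single, mul_one, mul_one, mul_sub, mul_add, xσ₁_mul hσ, xσ₁_mul hσ,
    xσ₁_mul hσ, sub_smul, one_smul, add_sub_right_comm]
  rfl

end formulas

/-! ### The derivations in the theorem -/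

variable {Γ} in
/-- `H` is an admissible choice of `Hom*(Γ, F)`: a complement of `F π₁` in `Hom(Γ, F)` if
`π₁(Γ) ≠ {0}` and `J₁ = {0}` (in which case `d_{π₁} = ad_1`), and all of `Hom(Γ, F)` otherwise. -/
def IsHomStar (H : Submodule F (Γ →+ F)) : Prop :=
  ((proj₁ Γ ≠ 0 ∧ J₁.1 = ⊥) → IsCompl (F ∙ proj₁ Γ) H) ∧
    (¬ (proj₁ Γ ≠ 0 ∧ J₁.1 = ⊥) → H = ⊤)

variable {Γ J₁ J₂} in
/-- The derivation `ad_u + d_μ + f₁ d₁ + f₂ d̄₁ + f₃ d₂ + f₄ ∂_{t₂}`. -/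
def stdDer (u : B Γ J₁ J₂) (μ : Γ →+ F) (f₁ f₂ f₃ f₄ : F) : Der Γ J₁ J₂ :=
  adB u + dHom Γ J₁ J₂ μ + f₁ • d₁ Γ J₁ J₂ + f₂ • dBar₁ Γ J₁ J₂ + f₃ • d₂ Γ J₁ J₂
    + f₄ • dt₂ Γ J₁ J₂

end

end BlockLie

namespace BlockLie

noncomputable section

open AddMonoidAlgebra (single)

variable {F : Type*} [Field F] {Γ : AddSubgroup (F × F)} {J₁ J₂ : ExpMonoid}

local notation "∂₁" => pd₁ _ _ _
local notation "∂₂" => pd₂ _ _ _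

/-! ### The semigroup algebra -/

/-! Write `D = ∂₂ - 1`. Then `[u, v] = ∂₁(u) D(v) - ∂₁(v) D(u)`, where `∂₁ = ad 1` and `D` commute.
On degree `β` they are triangular, with single generalized eigenvalues `β₁` and `β₂ - 1`. Everything
is computed in the semigroup algebra and pushed to `B` by `pB`, whose kernel on the relevant
subspace `dom` is only `F x^{σ₁,0}`; this kernel is the source of the exceptions in degree `σ₁`.

Homogeneous derivations `d` of degree `α`. If `α₁ ≠ 0`, then `∂₁` is onto in degree `α`, so an inner
derivation can be subtracted to make `d(1) = 0`. Then `d` commutes with `ad 1` but shifts its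
generalized eigenvalue by `α₁`, hence `d = 0` (`exists_eq_adB_of_fst_ne_zero`).

If `α₁ = 0` and `J₁ = ℕ`, then `d` is normalized on `1`, `t₁`, `t₁ ^ 2`
(`exists_normalized_of_top`). The operator `∂₁ D` is a polynomial in `ad`s of elements killed by
`d`, so `d` commutes with `D`. For `α₂ ≠ 0` the eigenvalue argument with `D` gives `d = 0`
(`eq_zero_of_normalized`). For `α = 0`, after subtracting a multiple of `∂_{t₂}`, `d` is a scalar on
each component and the scalars are additive (`IsDiagonal.exists_eq_dHom`).

If `α₁ = 0` and `J₁ = {0}`, one studies the ratios `d(x^β) / x^β` for `β₁ ≠ 0`. Their defect of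
additivity satisfies a linear identity (`ratio_identity`) which forces it to be a multiple of
`x^{σ₁}` (`exists_defect_eq`); this multiple is accounted for by `dBar₁`. Once the defect vanishes,
the ratio is `γ₁ w + μ(γ)` (`exists_ratio_eq`), so that `d = w ∂₁ + d_μ + f ∂_{t₂}` on these
degrees, which determine `d`.

Direct sum. Outside the degrees `0, σ₁, σ₂` a homogeneous derivation is inner and determined by its
values at `1` and one further element (`exists_eq_zero_of_apply_eq_zero`), so only finitely many
components of a given derivation are nonzero.

Locally finite derivations. By the classification each derivation is induced by `P D - Q ∂₁ + μ + f
∂_{t₂}` with `D P = ∂₁ Q`. If the relevant coefficients are not scalars, a monomial order produces a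
leading monomial of positive weight by which a suitable orbit of monomials is shifted forever, with
nonvanishing factors computed from `D P = ∂₁ Q` (`not_isLocallyFinite_of_leads`). Conversely, the
remaining operators are triangular on monomials (`isLocallyFinite_of_isInduced`). -/

theorem ExpMonoid.eq_top_of_ne_bot {J : ExpMonoid} (h : J.1 ≠ ⊥) : J.1 = ⊤ :=
  J.2.resolve_left h

theorem ExpMonoid.eq_zero_of_eq_bot {J : ExpMonoid} (h : J.1 = ⊥) (i : J.1) : i = 0 := by
  exact Subtype.ext ((AddSubmonoid.mem_bot (M := ℕ)).1 (h.le i.2))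

/-- The unit `x^{γ,0}`. -/
def ex (γ : Γ) : SemigroupAlg Γ J₁ J₂ := single (γ, 0, 0) 1

/-- The variable `t₁ = x^{0,1_[1]}`, which is `0` if `J₁ = {0}`. -/
def t₁ : SemigroupAlg Γ J₁ J₂ := xA Γ J₁ J₂ 0 (1, 0)

/-- The variable `t₂ = x^{0,1_[2]}`, which is `0` if `J₂ = {0}`. -/
def t₂ : SemigroupAlg Γ J₁ J₂ := xA Γ J₁ J₂ 0 (0, 1)

theorem ex_zero : (ex 0 : SemigroupAlg Γ J₁ J₂) = 1 := rfl

theorem ex_add (β γ : Γ) : (ex (β + γ) : SemigroupAlg Γ J₁ J₂) = ex β * ex γ := by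
  simp [ex, AddMonoidAlgebra.single_mul_single]

theorem ex_mul_ex_neg (β : Γ) : (ex β : SemigroupAlg Γ J₁ J₂) * ex (-β) = 1 := by
  rw [← ex_add, add_neg_cancel, ex_zero]

theorem ex_ne_zero (β : Γ) : (ex β : SemigroupAlg Γ J₁ J₂) ≠ 0 := by
  simp [ex]

theorem ex_mul_eq_zero {β : Γ} {v : SemigroupAlg Γ J₁ J₂} (h : ex β * v = 0) : v = 0 := by
  have : ex (-β) * (ex β * v) = 0 := by rw [h, mul_zero]
  rwa [← mul_assoc, mul_comm (ex (-β)), ex_mul_ex_neg, one_mul] at this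

theorem t₁_eq (h : J₁.1 = ⊤) :
    (t₁ : SemigroupAlg Γ J₁ J₂) = single (0, ⟨1, by simp [h]⟩, 0) 1 :=
  xA_of_mem (Γ := Γ) (J₁ := J₁) (J₂ := J₂) (0, ⟨1, by simp [h]⟩, 0)

theorem t₂_eq (h : J₂.1 = ⊤) :
    (t₂ : SemigroupAlg Γ J₁ J₂) = single (0, 0, ⟨1, by simp [h]⟩) 1 :=
  xA_of_mem (Γ := Γ) (J₁ := J₁) (J₂ := J₂) (0, 0, ⟨1, by simp [h]⟩)

theorem t₁_pow (h : J₁.1 = ⊤) (n : ℕ) :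
    (t₁ : SemigroupAlg Γ J₁ J₂) ^ n = single (0, ⟨n, by simp [h]⟩, 0) 1 := by
  rw [t₁_eq h, AddMonoidAlgebra.single_pow]
  congr 1
  · ext <;> simp
  · simp

theorem t₂_pow (h : J₂.1 = ⊤) (n : ℕ) :
    (t₂ : SemigroupAlg Γ J₁ J₂) ^ n = single (0, 0, ⟨n, by simp [h]⟩) 1 := by
  rw [t₂_eq h, AddMonoidAlgebra.single_pow]
  congr 1
  · ext <;> simp
  · simp

theorem t₁_pow_coe (i : J₁.1) : (t₁ : SemigroupAlg Γ J₁ J₂) ^ (i : ℕ) = single (0, i, 0) 1 := by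
  by_cases h : J₁.1 = ⊥
  · rw [ExpMonoid.eq_zero_of_eq_bot h i]; rfl
  · exact t₁_pow (ExpMonoid.eq_top_of_ne_bot h) i

theorem t₂_pow_coe (i : J₂.1) : (t₂ : SemigroupAlg Γ J₁ J₂) ^ (i : ℕ) = single (0, 0, i) 1 := by
  by_cases h : J₂.1 = ⊥
  · rw [ExpMonoid.eq_zero_of_eq_bot h i]; rfl
  · exact t₂_pow (ExpMonoid.eq_top_of_ne_bot h) i

theorem single_eq (m : Γ × J₁.1 × J₂.1) (c : F) :
    (single m c : SemigroupAlg Γ J₁ J₂) = c • (ex m.1 * t₁ ^ (m.2.1 : ℕ) * t₂ ^ (m.2.2 : ℕ)) := by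
  rw [t₁_pow_coe, t₂_pow_coe, ex, AddMonoidAlgebra.single_mul_single,
    AddMonoidAlgebra.single_mul_single, AddMonoidAlgebra.smul_single]
  simp

theorem ex_t_eq_single (β : Γ) (i : J₁.1) (j : J₂.1) :
    (ex β * t₁ ^ (i : ℕ) * t₂ ^ (j : ℕ) : SemigroupAlg Γ J₁ J₂) = single (β, i, j) 1 := by
  rw [single_eq, one_smul]

theorem ex_t_eq_single' (h : J₁.1 = ⊤) (β : Γ) (n : ℕ) :
    (ex β * t₁ ^ n : SemigroupAlg Γ J₁ J₂) = single (β, ⟨n, by simp [h]⟩, 0) 1 := by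
  rw [single_eq, one_smul]; simp

theorem xA_zero_zero : xA Γ J₁ J₂ 0 0 = 1 :=
  xA_of_mem (Γ := Γ) (J₁ := J₁) (J₂ := J₂) (0, 0, 0)

theorem span_mono (W : Submodule F (SemigroupAlg Γ J₁ J₂))
    (h : ∀ β i j, i ∈ J₁.1 → j ∈ J₂.1 → ex β * t₁ ^ i * t₂ ^ j ∈ W) (v : SemigroupAlg Γ J₁ J₂) :
    v ∈ W := by
  induction v using AddMonoidAlgebra.induction_linear with
  | zero => exact W.zero_mem
  | add f g hf hg => exact W.add_mem hf hg
  | single m c =>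
    rw [single_eq]
    exact W.smul_mem _ (h _ _ _ m.2.1.2 m.2.2.2)

theorem pd₁_ex (γ : Γ) : ∂₁ (ex γ : SemigroupAlg Γ J₁ J₂) = (γ : F × F).1 • ex γ := by
  simp [ex, pd₁_single]

theorem pd₂_ex (γ : Γ) : ∂₂ (ex γ : SemigroupAlg Γ J₁ J₂) = (γ : F × F).2 • ex γ := by
  simp [ex, pd₂_single]

theorem homDeriv_ex (μ : Γ →+ F) (γ : Γ) :
    homDeriv J₁ J₂ μ (ex γ : SemigroupAlg Γ J₁ J₂) = μ γ • ex γ := by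
  simp [ex, homDeriv_single]

theorem tDeriv₁_ex (γ : Γ) : tDeriv₁ _ _ _ (ex γ : SemigroupAlg Γ J₁ J₂) = 0 := by
  simp [ex, tDeriv₁_single]

theorem tDeriv₂_ex (γ : Γ) : tDeriv₂ _ _ _ (ex γ : SemigroupAlg Γ J₁ J₂) = 0 := by
  simp [ex, tDeriv₂_single]

theorem t₁_eq_zero (h : J₁.1 = ⊥) : (t₁ : SemigroupAlg Γ J₁ J₂) = 0 :=
  dif_neg (by simp [h])

theorem t₂_eq_zero (h : J₂.1 = ⊥) : (t₂ : SemigroupAlg Γ J₁ J₂) = 0 :=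
  dif_neg (by simp [h])

theorem homDeriv_t₁ (μ : Γ →+ F) : homDeriv J₁ J₂ μ (t₁ : SemigroupAlg Γ J₁ J₂) = 0 := by
  by_cases h : J₁.1 = ⊥
  · simp [t₁_eq_zero h]
  · simp [t₁_eq (ExpMonoid.eq_top_of_ne_bot h), homDeriv_single]

theorem homDeriv_t₂ (μ : Γ →+ F) : homDeriv J₁ J₂ μ (t₂ : SemigroupAlg Γ J₁ J₂) = 0 := by
  by_cases h : J₂.1 = ⊥
  · simp [t₂_eq_zero h]
  · simp [t₂_eq (ExpMonoid.eq_top_of_ne_bot h), homDeriv_single]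

theorem tDeriv₁_t₂ : tDeriv₁ _ _ _ (t₂ : SemigroupAlg Γ J₁ J₂) = 0 := by
  by_cases h : J₂.1 = ⊥
  · simp [t₂_eq_zero h]
  · simp [t₂_eq (ExpMonoid.eq_top_of_ne_bot h), tDeriv₁_single]

theorem tDeriv₂_t₁ : tDeriv₂ _ _ _ (t₁ : SemigroupAlg Γ J₁ J₂) = 0 := by
  by_cases h : J₁.1 = ⊥
  · simp [t₁_eq_zero h]
  · simp [t₁_eq (ExpMonoid.eq_top_of_ne_bot h), tDeriv₂_single]

theorem tDeriv₁_t₁ (h : J₁.1 = ⊤) : tDeriv₁ _ _ _ (t₁ : SemigroupAlg Γ J₁ J₂) = 1 := by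
  rw [t₁_eq h, tDeriv₁_single, AddMonoidAlgebra.one_def]
  congr 1
  simp

theorem tDeriv₂_t₂ (h : J₂.1 = ⊤) : tDeriv₂ _ _ _ (t₂ : SemigroupAlg Γ J₁ J₂) = 1 := by
  rw [t₂_eq h, tDeriv₂_single, AddMonoidAlgebra.one_def]
  congr 1
  simp

theorem pd₁_t₁ (h : J₁.1 = ⊤) : ∂₁ (t₁ : SemigroupAlg Γ J₁ J₂) = 1 := by
  simp [pd₁, homDeriv_t₁, tDeriv₁_t₁ h]

theorem pd₁_t₂ : ∂₁ (t₂ : SemigroupAlg Γ J₁ J₂) = 0 := by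
  simp [pd₁, homDeriv_t₂, tDeriv₁_t₂]

theorem pd₂_t₁ : ∂₂ (t₁ : SemigroupAlg Γ J₁ J₂) = 0 := by
  simp [pd₂, homDeriv_t₁, tDeriv₂_t₁]

theorem pd₂_t₂ (h : J₂.1 = ⊤) : ∂₂ (t₂ : SemigroupAlg Γ J₁ J₂) = 1 := by
  simp [pd₂, homDeriv_t₂, tDeriv₂_t₂ h]

theorem tDeriv₁_eq_zero (h : J₁.1 = ⊥) (v : SemigroupAlg Γ J₁ J₂) : tDeriv₁ _ _ _ v = 0 := by
  refine span_mono (LinearMap.ker (tDeriv₁ Γ J₁ J₂).toLinearMap) ?_ v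
  intro β i j hi hj
  have : i = 0 := by simpa [h] using hi
  subst this
  simp [Derivation.leibniz, tDeriv₁_ex, Derivation.leibniz_pow, tDeriv₁_t₂]

theorem tDeriv₂_eq_zero (h : J₂.1 = ⊥) (v : SemigroupAlg Γ J₁ J₂) : tDeriv₂ _ _ _ v = 0 := by
  refine span_mono (LinearMap.ker (tDeriv₂ Γ J₁ J₂).toLinearMap) ?_ v
  intro β i j hi hj
  have : j = 0 := by simpa [h] using hj
  subst this
  simp [Derivation.leibniz, tDeriv₂_ex, Derivation.leibniz_pow, tDeriv₂_t₁]

/-- The operator `∂₂ - 1`. -/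
def sd₂ (Γ : AddSubgroup (F × F)) (J₁ J₂ : ExpMonoid) :
    SemigroupAlg Γ J₁ J₂ →ₗ[F] SemigroupAlg Γ J₁ J₂ :=
  (pd₂ Γ J₁ J₂).toLinearMap - LinearMap.id

local notation "𝔇" => sd₂ _ _ _

theorem sd₂_apply (v : SemigroupAlg Γ J₁ J₂) : 𝔇 v = ∂₂ v - v := rfl

theorem sd₂_mul (u v : SemigroupAlg Γ J₁ J₂) : 𝔇 (u * v) = 𝔇 u * v + u * ∂₂ v := by
  simp only [sd₂_apply, Derivation.leibniz, smul_eq_mul]; ring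

theorem sd₂_mul' (u v : SemigroupAlg Γ J₁ J₂) : 𝔇 (u * v) = ∂₂ u * v + u * 𝔇 v := by
  simp only [sd₂_apply, Derivation.leibniz, smul_eq_mul]; ring

theorem sd₂_one : 𝔇 (1 : SemigroupAlg Γ J₁ J₂) = -1 := by
  simp [sd₂_apply]

theorem sd₂_t₁ : 𝔇 (t₁ : SemigroupAlg Γ J₁ J₂) = -t₁ := by
  simp [sd₂_apply, pd₂_t₁]

theorem sd₂_ex (γ : Γ) :
    𝔇 (ex γ : SemigroupAlg Γ J₁ J₂) = ((γ : F × F).2 - 1) • ex γ := by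
  rw [sd₂_apply, pd₂_ex, sub_smul, one_smul]

theorem pd₁_sd₂ (v : SemigroupAlg Γ J₁ J₂) : ∂₁ (𝔇 v) = 𝔇 (∂₁ v) := by
  simp only [sd₂_apply, map_sub, pd₁_pd₂]

/-- The terms `-u v'`-type corrections in the bracket are absorbed by `∂₂ - 1`; in this
antisymmetric form the bracket looks like a Jacobian, and `ad` of an element killed by `∂₁` is a
multiple of `∂₁`. -/
theorem br_eq (u v : SemigroupAlg Γ J₁ J₂) : br u v = ∂₁ u * 𝔇 v - ∂₁ v * 𝔇 u := by
  simp only [br, sd₂_apply]; ring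

theorem br_comm (u v : SemigroupAlg Γ J₁ J₂) : br u v = -br v u := by
  simp only [br]; ring

/-! ### The grading of the semigroup algebra -/

/-- The homogeneous component `A_α = span {x^{α,i} | i ∈ J}` of the semigroup algebra. -/
def hA (J₁ J₂ : ExpMonoid) (α : Γ) : Submodule F (SemigroupAlg Γ J₁ J₂) where
  carrier := {v | ∀ m : Γ × J₁.1 × J₂.1, m.1 ≠ α → v.coeff m = 0}
  zero_mem' := fun _ _ => rfl
  add_mem' := fun hu hv m hm => by
    rw [AddMonoidAlgebra.coeff_add, Finsupp.add_apply, hu m hm, hv m hm, add_zero]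
  smul_mem' := fun c v hv m hm => by
    rw [AddMonoidAlgebra.coeff_smul_apply, hv m hm, smul_zero]

theorem single_mem_hA (m : Γ × J₁.1 × J₂.1) (c : F) : single m c ∈ hA J₁ J₂ m.1 := by
  classical
  intro n hn
  rw [AddMonoidAlgebra.coeff_single, Finsupp.single_apply, if_neg]
  rintro rfl
  exact hn rfl

theorem ex_t_mem_hA (β : Γ) {i j : ℕ} (hi : i ∈ J₁.1) (hj : j ∈ J₂.1) :
    (ex β * t₁ ^ i * t₂ ^ j : SemigroupAlg Γ J₁ J₂) ∈ hA J₁ J₂ β := by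
  rw [ex_t_eq_single β ⟨i, hi⟩ ⟨j, hj⟩]
  exact single_mem_hA (β, ⟨i, hi⟩, ⟨j, hj⟩) 1

theorem ex_mem_hA (β : Γ) : (ex β : SemigroupAlg Γ J₁ J₂) ∈ hA J₁ J₂ β :=
  single_mem_hA (β, 0, 0) 1

theorem one_mem_hA : (1 : SemigroupAlg Γ J₁ J₂) ∈ hA J₁ J₂ 0 :=
  ex_mem_hA 0

/-- The homogeneous component of degree `α` is spanned by monomials. -/
theorem hA_induction {α : Γ} (W : Submodule F (SemigroupAlg Γ J₁ J₂))
    (h : ∀ i j, i ∈ J₁.1 → j ∈ J₂.1 → ex α * t₁ ^ i * t₂ ^ j ∈ W) {v : SemigroupAlg Γ J₁ J₂}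
    (hv : v ∈ hA J₁ J₂ α) : v ∈ W := by
  have : v = v.coeff.sum (fun m c => single m c) := by
    conv_lhs => rw [← AddMonoidAlgebra.ofCoeff_coeff v, ← Finsupp.sum_single v.coeff]
    rw [AddMonoidAlgebra.ofCoeff_finsuppSum]; rfl
  rw [this]
  refine W.sum_mem fun m hm => ?_
  have hm' : m.1 = α := by
    by_contra hne
    exact (Finsupp.mem_support_iff.1 hm) (hv m hne)
  dsimp only
  rw [single_eq, hm']
  exact W.smul_mem _ (h _ _ m.2.1.2 m.2.2.2)

theorem ex_t_mul_ex_t (α β : Γ) (i j k l : ℕ) :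
    (ex α * t₁ ^ i * t₂ ^ j * (ex β * t₁ ^ k * t₂ ^ l) : SemigroupAlg Γ J₁ J₂) =
      ex (α + β) * t₁ ^ (i + k) * t₂ ^ (j + l) := by
  rw [ex_add, pow_add, pow_add]
  ring

theorem ex_t_mul_mem_hA {α β : Γ} {i j : ℕ} (hi : i ∈ J₁.1) (hj : j ∈ J₂.1)
    {w : SemigroupAlg Γ J₁ J₂} (hw : w ∈ hA J₁ J₂ β) :
    ex α * t₁ ^ i * t₂ ^ j * w ∈ hA J₁ J₂ (α + β) := by
  refine hA_induction ((hA J₁ J₂ (α + β)).comap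
    (LinearMap.mulLeft F (ex α * t₁ ^ i * t₂ ^ j))) (fun k l hk hl => ?_) hw
  rw [Submodule.mem_comap, LinearMap.mulLeft_apply, ex_t_mul_ex_t]
  exact ex_t_mem_hA _ (J₁.1.add_mem hi hk) (J₂.1.add_mem hj hl)

theorem mul_mem_hA {α β : Γ} {u v : SemigroupAlg Γ J₁ J₂} (hu : u ∈ hA J₁ J₂ α)
    (hv : v ∈ hA J₁ J₂ β) : u * v ∈ hA J₁ J₂ (α + β) := by
  have h := hA_induction ((hA J₁ J₂ (α + β)).comap (LinearMap.mulRight F v))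
    (fun i j hi hj => by
      rw [Submodule.mem_comap, LinearMap.mulRight_apply]
      exact ex_t_mul_mem_hA hi hj hv) hu
  rwa [Submodule.mem_comap, LinearMap.mulRight_apply] at h

theorem homDeriv_of_mem {α : Γ} {v : SemigroupAlg Γ J₁ J₂} (μ : Γ →+ F) (hv : v ∈ hA J₁ J₂ α) :
    homDeriv J₁ J₂ μ v = μ α • v := by
  have := hA_induction (W := LinearMap.ker
    ((homDeriv J₁ J₂ μ).toLinearMap - μ α • LinearMap.id)) ?_ hv
  · simpa [sub_eq_zero] using this
  · intro i j hi hj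
    simp [Derivation.leibniz, Derivation.leibniz_pow, homDeriv_ex, homDeriv_t₁, homDeriv_t₂,
      mul_comm]

theorem tDeriv₁_mem {α : Γ} {v : SemigroupAlg Γ J₁ J₂} (hv : v ∈ hA J₁ J₂ α) :
    tDeriv₁ _ _ _ v ∈ hA J₁ J₂ α := by
  refine hA_induction (W := (hA J₁ J₂ α).comap (tDeriv₁ Γ J₁ J₂).toLinearMap) ?_ hv
  intro i j hi hj
  rw [ex_t_eq_single α ⟨i, hi⟩ ⟨j, hj⟩]
  simp only [Submodule.mem_comap, Derivation.coeFn_coe, tDeriv₁_single]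
  exact single_mem_hA (α, _, _) _

theorem tDeriv₂_mem {α : Γ} {v : SemigroupAlg Γ J₁ J₂} (hv : v ∈ hA J₁ J₂ α) :
    tDeriv₂ _ _ _ v ∈ hA J₁ J₂ α := by
  refine hA_induction (W := (hA J₁ J₂ α).comap (tDeriv₂ Γ J₁ J₂).toLinearMap) ?_ hv
  intro i j hi hj
  rw [ex_t_eq_single α ⟨i, hi⟩ ⟨j, hj⟩]
  simp only [Submodule.mem_comap, Derivation.coeFn_coe, tDeriv₂_single]
  exact single_mem_hA (α, _, _) _

theorem pd₁_of_mem {α : Γ} {v : SemigroupAlg Γ J₁ J₂} (hv : v ∈ hA J₁ J₂ α) :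
    ∂₁ v = (α : F × F).1 • v + tDeriv₁ _ _ _ v := by
  rw [pd₁, Derivation.add_apply, homDeriv_of_mem _ hv]; rfl

theorem pd₂_of_mem {α : Γ} {v : SemigroupAlg Γ J₁ J₂} (hv : v ∈ hA J₁ J₂ α) :
    ∂₂ v = (α : F × F).2 • v + tDeriv₂ _ _ _ v := by
  rw [pd₂, Derivation.add_apply, homDeriv_of_mem _ hv]; rfl

theorem sd₂_of_mem {α : Γ} {v : SemigroupAlg Γ J₁ J₂} (hv : v ∈ hA J₁ J₂ α) :
    𝔇 v = ((α : F × F).2 - 1) • v + tDeriv₂ _ _ _ v := by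
  rw [sd₂_apply, pd₂_of_mem hv, sub_smul, one_smul]; abel

theorem pd₁_mem {α : Γ} {v : SemigroupAlg Γ J₁ J₂} (hv : v ∈ hA J₁ J₂ α) :
    ∂₁ v ∈ hA J₁ J₂ α := by
  rw [pd₁_of_mem hv]
  exact Submodule.add_mem _ (Submodule.smul_mem _ _ hv) (tDeriv₁_mem hv)

theorem pd₂_mem {α : Γ} {v : SemigroupAlg Γ J₁ J₂} (hv : v ∈ hA J₁ J₂ α) :
    ∂₂ v ∈ hA J₁ J₂ α := by
  rw [pd₂_of_mem hv]
  exact Submodule.add_mem _ (Submodule.smul_mem _ _ hv) (tDeriv₂_mem hv)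

theorem sd₂_mem {α : Γ} {v : SemigroupAlg Γ J₁ J₂} (hv : v ∈ hA J₁ J₂ α) :
    𝔇 v ∈ hA J₁ J₂ α :=
  Submodule.sub_mem _ (pd₂_mem hv) hv

theorem br_mem {α β : Γ} {u v : SemigroupAlg Γ J₁ J₂} (hu : u ∈ hA J₁ J₂ α)
    (hv : v ∈ hA J₁ J₂ β) : br u v ∈ hA J₁ J₂ (α + β) := by
  rw [br_eq]
  refine Submodule.sub_mem _ (mul_mem_hA (pd₁_mem hu) (sd₂_mem hv)) ?_
  rw [add_comm]
  exact mul_mem_hA (pd₁_mem hv) (sd₂_mem hu)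

open scoped Classical in
/-- The projection of the semigroup algebra to the homogeneous component of degree `α`. -/
def compA (J₁ J₂ : ExpMonoid) (α : Γ) : SemigroupAlg Γ J₁ J₂ →ₗ[F] SemigroupAlg Γ J₁ J₂ :=
  linOfBasis fun m => if m.1 = α then single m 1 else 0

theorem compA_single (α : Γ) (m : Γ × J₁.1 × J₂.1) (c : F) [Decidable (m.1 = α)] :
    compA J₁ J₂ α (single m c) = if m.1 = α then single m c else 0 := by
  rw [compA, linOfBasis_single]
  split_ifs <;> simp

theorem compA_mem (α : Γ) (v : SemigroupAlg Γ J₁ J₂) : compA J₁ J₂ α v ∈ hA J₁ J₂ α := by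
  classical
  induction v using AddMonoidAlgebra.induction_linear with
  | zero => simp
  | add f g hf hg => rw [map_add]; exact Submodule.add_mem _ hf hg
  | single m c =>
    rw [compA_single]
    split_ifs with h
    · rw [← h]; exact single_mem_hA m c
    · exact Submodule.zero_mem _

theorem compA_of_mem {α : Γ} {v : SemigroupAlg Γ J₁ J₂} (hv : v ∈ hA J₁ J₂ α) :
    compA J₁ J₂ α v = v := by
  classical
  have := hA_induction (W := LinearMap.ker (compA J₁ J₂ α - LinearMap.id)) ?_ hv
  · simpa [sub_eq_zero] using this
  · intro i j hi hj
    rw [ex_t_eq_single α ⟨i, hi⟩ ⟨j, hj⟩]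
    simp [compA_single]

theorem compA_of_mem_ne {α β : Γ} (h : β ≠ α) {v : SemigroupAlg Γ J₁ J₂} (hv : v ∈ hA J₁ J₂ β) :
    compA J₁ J₂ α v = 0 := by
  classical
  have := hA_induction (W := LinearMap.ker (compA J₁ J₂ α)) ?_ hv
  · simpa using this
  · intro i j hi hj
    rw [ex_t_eq_single β ⟨i, hi⟩ ⟨j, hj⟩]
    simp [compA_single, h]

theorem eq_zero_of_mem_hA {α β : Γ} (h : β ≠ α) {v : SemigroupAlg Γ J₁ J₂} (hv : v ∈ hA J₁ J₂ β)
    (hv' : v ∈ hA J₁ J₂ α) : v = 0 := by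
  rw [← compA_of_mem hv', compA_of_mem_ne h hv]

theorem coeff_compA (α : Γ) (v : SemigroupAlg Γ J₁ J₂) (m : Γ × J₁.1 × J₂.1) (h : m.1 = α) :
    (compA J₁ J₂ α v).coeff m = v.coeff m := by
  classical
  induction v using AddMonoidAlgebra.induction_linear with
  | zero => simp
  | add f g hf hg => simp [hf, hg]
  | single n c =>
    rw [compA_single]
    split_ifs with hn
    · rfl
    · rw [AddMonoidAlgebra.coeff_single, Finsupp.single_apply, if_neg (by rintro rfl; exact hn h)]
      rfl

theorem span_hA (W : Submodule F (SemigroupAlg Γ J₁ J₂)) (h : ∀ α, hA J₁ J₂ α ≤ W)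
    (v : SemigroupAlg Γ J₁ J₂) : v ∈ W :=
  span_mono W (fun β _ _ hi hj => h β (ex_t_mem_hA β hi hj)) v

theorem eq_sum_compA (v : SemigroupAlg Γ J₁ J₂) :
    ∃ s : Finset Γ, (∀ α ∉ s, compA J₁ J₂ α v = 0) ∧ v = ∑ α ∈ s, compA J₁ J₂ α v := by
  classical
  refine ⟨v.coeff.support.image Prod.fst, ?_, ?_⟩
  · intro α hα
    refine AddMonoidAlgebra.coeff_injective (Finsupp.ext fun m => ?_)
    by_cases hm : m.1 = α
    · rw [coeff_compA α v m hm]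
      by_contra hne
      exact hα (Finset.mem_image.2 ⟨m, Finsupp.mem_support_iff.2 hne, hm⟩)
    · exact compA_mem α v m hm
  · refine AddMonoidAlgebra.coeff_injective (Finsupp.ext fun m => ?_)
    rw [AddMonoidAlgebra.coeff_sum, Finsupp.finsetSum_apply]
    rw [Finset.sum_eq_single m.1]
    · rw [coeff_compA _ v m rfl]
    · intro α _ hα
      exact compA_mem α v m (Ne.symm hα)
    · intro hm
      rw [coeff_compA _ v m rfl]
      by_contra hne
      exact hm (Finset.mem_image.2 ⟨m, Finsupp.mem_support_iff.2 hne, rfl⟩)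

end

end BlockLie

namespace BlockLie

noncomputable section

open AddMonoidAlgebra (single)

variable {F : Type*} [Field F] {Γ : AddSubgroup (F × F)} {J₁ J₂ : ExpMonoid}

local notation "∂₁" => pd₁ _ _ _
local notation "∂₂" => pd₂ _ _ _
local notation "𝔇" => sd₂ _ _ _

/-! ### Generalized eigenspaces, kernels and images of `∂₁` and `∂₂` -/

theorem mem_maxGenEigenspace_of_sub {V : Type*} [AddCommGroup V] [Module F V]
    {f : Module.End F V} {c : F} {x y : V} (hy : y ∈ f.maxGenEigenspace c)
    (h : f x = c • x + y) : x ∈ f.maxGenEigenspace c := by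
  rw [Module.End.mem_maxGenEigenspace] at hy ⊢
  obtain ⟨k, hk⟩ := hy
  refine ⟨k + 1, ?_⟩
  rw [pow_succ, Module.End.mul_apply]
  have : (f - c • (1 : Module.End F V)) x = y := by simp [h]
  rw [this, hk]

theorem eq_zero_of_mem_maxGenEigenspace {V : Type*} [AddCommGroup V] [Module F V]
    {f : Module.End F V} {c e : F} (hce : c ≠ e) {x : V} (hx : x ∈ f.maxGenEigenspace c)
    (hx' : x ∈ f.maxGenEigenspace e) : x = 0 :=
  Submodule.disjoint_def.1 (f.disjoint_genEigenspace hce ⊤ ⊤) x hx hx'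

theorem mem_maxGenEigenspace_of_eq {V : Type*} [AddCommGroup V] [Module F V]
    {f : Module.End F V} {c : F} {x : V} (h : f x = c • x) : x ∈ f.maxGenEigenspace c :=
  mem_maxGenEigenspace_of_sub (Submodule.zero_mem _) (by rw [h, add_zero])

theorem tDeriv₁_ex_t (h : J₁.1 = ⊤) (β : Γ) (i j : ℕ) :
    tDeriv₁ _ _ _ (ex β * t₁ ^ i * t₂ ^ j : SemigroupAlg Γ J₁ J₂) =
      (i : F) • (ex β * t₁ ^ (i - 1) * t₂ ^ j) := by
  simp only [Derivation.leibniz, Derivation.leibniz_pow, tDeriv₁_ex, tDeriv₁_t₁ h, tDeriv₁_t₂,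
    smul_eq_mul, smul_zero, mul_zero, add_zero, zero_add, mul_one, Nat.cast_smul_eq_nsmul,
    nsmul_eq_mul]
  ring

theorem tDeriv₂_ex_t (h : J₂.1 = ⊤) (β : Γ) (i j : ℕ) :
    tDeriv₂ _ _ _ (ex β * t₁ ^ i * t₂ ^ j : SemigroupAlg Γ J₁ J₂) =
      (j : F) • (ex β * t₁ ^ i * t₂ ^ (j - 1)) := by
  simp only [Derivation.leibniz, Derivation.leibniz_pow, tDeriv₂_ex, tDeriv₂_t₂ h, tDeriv₂_t₁,
    smul_eq_mul, smul_zero, mul_zero, add_zero, mul_one, Nat.cast_smul_eq_nsmul,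
    nsmul_eq_mul]
  ring

/-- On `x^β t₁^i t₂^j` the operator `∂₁` is `β₁` plus a term of smaller exponent in `t₁`, so
induction on `i` applies. If `J₁ = {0}`, the monomials are true eigenvectors. -/
theorem hA_le_maxGenEigenspace_pd₁ {β : Γ} {v : SemigroupAlg Γ J₁ J₂} (hv : v ∈ hA J₁ J₂ β) :
    v ∈ Module.End.maxGenEigenspace (pd₁ Γ J₁ J₂).toLinearMap (β : F × F).1 := by
  refine hA_induction _ (fun i j hi hj => ?_) hv
  by_cases h : J₁.1 = ⊥
  · refine mem_maxGenEigenspace_of_eq ?_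
    rw [Derivation.coeFn_coe, pd₁_of_mem (ex_t_mem_hA β hi hj), tDeriv₁_eq_zero h, add_zero]
  · have h' := ExpMonoid.eq_top_of_ne_bot h
    clear hi
    induction i with
    | zero =>
      refine mem_maxGenEigenspace_of_eq ?_
      rw [Derivation.coeFn_coe, pd₁_of_mem (ex_t_mem_hA β (by simp) hj), tDeriv₁_ex_t h']
      simp
    | succ n ih =>
      refine mem_maxGenEigenspace_of_sub
        (y := ((n + 1 : ℕ) : F) • (ex β * t₁ ^ n * t₂ ^ j)) (Submodule.smul_mem _ _ ih) ?_
      rw [Derivation.coeFn_coe, pd₁_of_mem (ex_t_mem_hA β (by simp [h']) hj), tDeriv₁_ex_t h']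
      simp

theorem hA_le_maxGenEigenspace_pd₂ {β : Γ} {v : SemigroupAlg Γ J₁ J₂} (hv : v ∈ hA J₁ J₂ β) :
    v ∈ Module.End.maxGenEigenspace (pd₂ Γ J₁ J₂).toLinearMap (β : F × F).2 := by
  refine hA_induction _ (fun i j hi hj => ?_) hv
  by_cases h : J₂.1 = ⊥
  · refine mem_maxGenEigenspace_of_eq ?_
    rw [Derivation.coeFn_coe, pd₂_of_mem (ex_t_mem_hA β hi hj), tDeriv₂_eq_zero h, add_zero]
  · have h' := ExpMonoid.eq_top_of_ne_bot h
    clear hj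
    induction j with
    | zero =>
      refine mem_maxGenEigenspace_of_eq ?_
      rw [Derivation.coeFn_coe, pd₂_of_mem (ex_t_mem_hA β hi (by simp)), tDeriv₂_ex_t h']
      simp
    | succ n ih =>
      refine mem_maxGenEigenspace_of_sub
        (y := ((n + 1 : ℕ) : F) • (ex β * t₁ ^ i * t₂ ^ n)) (Submodule.smul_mem _ _ ih) ?_
      rw [Derivation.coeFn_coe, pd₂_of_mem (ex_t_mem_hA β hi (by simp [h'])), tDeriv₂_ex_t h']
      simp

theorem eq_zero_of_pd₁_eq {β : Γ} {v : SemigroupAlg Γ J₁ J₂} (hv : v ∈ hA J₁ J₂ β) {c : F}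
    (hc : c ≠ (β : F × F).1) (h : ∂₁ v = c • v) : v = 0 :=
  eq_zero_of_mem_maxGenEigenspace hc (mem_maxGenEigenspace_of_eq (f := (pd₁ Γ J₁ J₂).toLinearMap) h)
    (hA_le_maxGenEigenspace_pd₁ hv)

theorem eq_zero_of_pd₂_eq {β : Γ} {v : SemigroupAlg Γ J₁ J₂} (hv : v ∈ hA J₁ J₂ β) {c : F}
    (hc : c ≠ (β : F × F).2) (h : ∂₂ v = c • v) : v = 0 :=
  eq_zero_of_mem_maxGenEigenspace hc (mem_maxGenEigenspace_of_eq (f := (pd₂ Γ J₁ J₂).toLinearMap) h)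
    (hA_le_maxGenEigenspace_pd₂ hv)

theorem coeff_tDeriv₁ (h : J₁.1 = ⊤) (v : SemigroupAlg Γ J₁ J₂) (β : Γ) (i : J₁.1) (j : J₂.1) :
    (tDeriv₁ _ _ _ v).coeff (β, i, j) =
      ((i : ℕ) + 1 : F) * v.coeff (β, i + ⟨1, by simp [h]⟩, j) := by
  classical
  induction v using AddMonoidAlgebra.induction_linear with
  | zero => simp
  | add f g hf hg => simp [hf, hg, mul_add]
  | single n c =>
    obtain ⟨γ, k, l⟩ := n
    rw [tDeriv₁_single, AddMonoidAlgebra.coeff_single, AddMonoidAlgebra.coeff_single,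
      Finsupp.single_apply, Finsupp.single_apply]
    simp only [Prod.mk.injEq, Subtype.ext_iff, predE, AddSubmonoid.coe_add]
    rcases Nat.eq_zero_or_pos (k : ℕ) with hk | hk
    · simp [hk]
    · have : ((k : ℕ) - 1 = i) ↔ (k : ℕ) = i + 1 := by omega
      simp only [this]
      split_ifs with h1
      · rw [h1.2.1]; push_cast; ring
      · ring

theorem coeff_tDeriv₂ (h : J₂.1 = ⊤) (v : SemigroupAlg Γ J₁ J₂) (β : Γ) (i : J₁.1) (j : J₂.1) :
    (tDeriv₂ _ _ _ v).coeff (β, i, j) =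
      ((j : ℕ) + 1 : F) * v.coeff (β, i, j + ⟨1, by simp [h]⟩) := by
  classical
  induction v using AddMonoidAlgebra.induction_linear with
  | zero => simp
  | add f g hf hg => simp [hf, hg, mul_add]
  | single n c =>
    obtain ⟨γ, k, l⟩ := n
    rw [tDeriv₂_single, AddMonoidAlgebra.coeff_single, AddMonoidAlgebra.coeff_single,
      Finsupp.single_apply, Finsupp.single_apply]
    simp only [Prod.mk.injEq, Subtype.ext_iff, predE, AddSubmonoid.coe_add]
    rcases Nat.eq_zero_or_pos (l : ℕ) with hk | hk
    · simp [hk]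
    · have : ((l : ℕ) - 1 = j) ↔ (l : ℕ) = j + 1 := by omega
      simp only [this]
      split_ifs with h1
      · rw [h1.2.2]; push_cast; ring
      · ring

variable [CharZero F]

theorem coeff_eq_zero_of_tDeriv₁ {v : SemigroupAlg Γ J₁ J₂} (h : tDeriv₁ _ _ _ v = 0)
    {m : Γ × J₁.1 × J₂.1} (hm : (m.2.1 : ℕ) ≠ 0) : v.coeff m = 0 := by
  by_cases hJ : J₁.1 = ⊥
  · exact absurd (congrArg Subtype.val (ExpMonoid.eq_zero_of_eq_bot hJ m.2.1)) hm
  have hJ' := ExpMonoid.eq_top_of_ne_bot hJ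
  have := coeff_tDeriv₁ hJ' v m.1 ⟨m.2.1 - 1, by simp [hJ']⟩ m.2.2
  rw [h] at this
  have e : (⟨(m.2.1 : ℕ) - 1, by simp [hJ']⟩ + ⟨1, by simp [hJ']⟩ : J₁.1) = m.2.1 :=
    Subtype.ext (by rw [AddSubmonoid.coe_add]; dsimp only; omega)
  rw [e] at this
  have hne : (((m.2.1 : ℕ) - 1 : ℕ) : F) + 1 ≠ 0 := Nat.cast_add_one_ne_zero _
  simpa [hne] using this

theorem coeff_eq_zero_of_tDeriv₂ {v : SemigroupAlg Γ J₁ J₂} (h : tDeriv₂ _ _ _ v = 0)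
    {m : Γ × J₁.1 × J₂.1} (hm : (m.2.2 : ℕ) ≠ 0) : v.coeff m = 0 := by
  by_cases hJ : J₂.1 = ⊥
  · exact absurd (congrArg Subtype.val (ExpMonoid.eq_zero_of_eq_bot hJ m.2.2)) hm
  have hJ' := ExpMonoid.eq_top_of_ne_bot hJ
  have := coeff_tDeriv₂ hJ' v m.1 m.2.1 ⟨m.2.2 - 1, by simp [hJ']⟩
  rw [h] at this
  have e : (⟨(m.2.2 : ℕ) - 1, by simp [hJ']⟩ + ⟨1, by simp [hJ']⟩ : J₂.1) = m.2.2 :=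
    Subtype.ext (by rw [AddSubmonoid.coe_add]; dsimp only; omega)
  rw [e] at this
  have hne : (((m.2.2 : ℕ) - 1 : ℕ) : F) + 1 ≠ 0 := Nat.cast_add_one_ne_zero _
  simpa [hne] using this

/-- Homogeneous elements which do not involve `t₁` are combinations of the `x^α t₂^j`. -/
theorem hA_induction_of_tDeriv₁ {α : Γ} (W : Submodule F (SemigroupAlg Γ J₁ J₂))
    (h : ∀ j, j ∈ J₂.1 → ex α * t₂ ^ j ∈ W) {v : SemigroupAlg Γ J₁ J₂}
    (hv : v ∈ hA J₁ J₂ α) (hv' : tDeriv₁ _ _ _ v = 0) : v ∈ W := by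
  have : v = v.coeff.sum (fun m c => single m c) := by
    conv_lhs => rw [← AddMonoidAlgebra.ofCoeff_coeff v, ← Finsupp.sum_single v.coeff]
    rw [AddMonoidAlgebra.ofCoeff_finsuppSum]; rfl
  rw [this]
  refine W.sum_mem fun m hm => ?_
  have hm' : m.1 = α := by
    by_contra hne
    exact (Finsupp.mem_support_iff.1 hm) (hv m hne)
  have hm1 : (m.2.1 : ℕ) = 0 := by
    by_contra hne
    exact (Finsupp.mem_support_iff.1 hm) (coeff_eq_zero_of_tDeriv₁ hv' hne)
  dsimp only
  rw [single_eq, hm', hm1, pow_zero, mul_one]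
  exact W.smul_mem _ (h _ m.2.2.2)

theorem exists_eq_smul_ex {α : Γ} {v : SemigroupAlg Γ J₁ J₂}
    (hv : v ∈ hA J₁ J₂ α) (h₁ : tDeriv₁ _ _ _ v = 0) (h₂ : tDeriv₂ _ _ _ v = 0) :
    ∃ c : F, v = c • ex α := by
  classical
  refine ⟨v.coeff (α, 0, 0), AddMonoidAlgebra.coeff_injective (Finsupp.ext fun m => ?_)⟩
  rw [AddMonoidAlgebra.coeff_smul_apply, ex, AddMonoidAlgebra.coeff_single, Finsupp.single_apply]
  split_ifs with h
  · rw [← h]; simp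
  · rw [smul_zero]
    by_contra hne
    refine h ?_
    have a : m.1 = α := by by_contra h'; exact hne (hv m h')
    have b : (m.2.1 : ℕ) = 0 := by by_contra h'; exact hne (coeff_eq_zero_of_tDeriv₁ h₁ h')
    have c : (m.2.2 : ℕ) = 0 := by by_contra h'; exact hne (coeff_eq_zero_of_tDeriv₂ h₂ h')
    ext <;> simp [a, b, c]

/-- For `β₁ = 0` this is integration in `t₁`, possible in characteristic `0`. For `β₁ ≠ 0` the
operator is triangular with nonzero diagonal and is inverted by recursion on the exponent of `t₁`.
-/
theorem exists_pd₁_eq {β : Γ} (h : (β : F × F).1 ≠ 0 ∨ J₁.1 = ⊤) {w : SemigroupAlg Γ J₁ J₂}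
    (hw : w ∈ hA J₁ J₂ β) : ∃ u ∈ hA J₁ J₂ β, ∂₁ u = w := by
  have := hA_induction ((hA J₁ J₂ β).map (pd₁ Γ J₁ J₂).toLinearMap) ?_ hw
  · simpa using this
  intro i j hi hj
  by_cases hβ : (β : F × F).1 = 0
  · have hJ := h.resolve_left (not_not.2 hβ)
    have hi' : i + 1 ∈ J₁.1 := by simp [hJ]
    refine ⟨((i + 1 : ℕ) : F)⁻¹ • (ex β * t₁ ^ (i + 1) * t₂ ^ j),
      Submodule.smul_mem _ _ (ex_t_mem_hA β hi' hj), ?_⟩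
    rw [map_smul, Derivation.coeFn_coe, pd₁_of_mem (ex_t_mem_hA β hi' hj), hβ, zero_smul, zero_add,
      tDeriv₁_ex_t hJ, smul_smul, inv_mul_cancel₀ (Nat.cast_ne_zero.2 (Nat.succ_ne_zero i)),
      one_smul, Nat.add_sub_cancel]
  · by_cases hJ : J₁.1 = ⊥
    · refine ⟨(β : F × F).1⁻¹ • (ex β * t₁ ^ i * t₂ ^ j),
        Submodule.smul_mem _ _ (ex_t_mem_hA β hi hj), ?_⟩
      rw [map_smul, Derivation.coeFn_coe, pd₁_of_mem (ex_t_mem_hA β hi hj), tDeriv₁_eq_zero hJ,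
        add_zero, smul_smul, inv_mul_cancel₀ hβ, one_smul]
    · have hJ' := ExpMonoid.eq_top_of_ne_bot hJ
      induction i with
      | zero =>
        refine ⟨(β : F × F).1⁻¹ • (ex β * t₁ ^ 0 * t₂ ^ j),
          Submodule.smul_mem _ _ (ex_t_mem_hA β hi hj), ?_⟩
        rw [map_smul, Derivation.coeFn_coe, pd₁_of_mem (ex_t_mem_hA β hi hj), tDeriv₁_ex_t hJ',
          Nat.cast_zero, zero_smul, add_zero, smul_smul, inv_mul_cancel₀ hβ, one_smul]
      | succ n ih =>
        obtain ⟨u, hu, hu'⟩ := ih (by simp [hJ'])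
        refine ⟨(β : F × F).1⁻¹ • (ex β * t₁ ^ (n + 1) * t₂ ^ j - ((n + 1 : ℕ) : F) • u),
          Submodule.smul_mem _ _ (Submodule.sub_mem _ (ex_t_mem_hA β hi hj)
            (Submodule.smul_mem _ _ hu)), ?_⟩
        rw [map_smul, map_sub, map_smul, hu', Derivation.coeFn_coe,
          pd₁_of_mem (ex_t_mem_hA β hi hj), tDeriv₁_ex_t hJ', Nat.add_sub_cancel,
          add_sub_cancel_right, smul_smul, inv_mul_cancel₀ hβ, one_smul]

/-- The diagonal entry of `∂₂ - 1` is now `α₂ - 1`; when it vanishes, integration in `t₂` replaces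
division. The preimage is kept free of `t₁`, so that in degrees with `α₁ = 0` it is killed by `∂₁`.
-/
theorem exists_sd₂_eq {α : Γ} (h : (α : F × F).2 ≠ 1 ∨ J₂.1 = ⊤) {w : SemigroupAlg Γ J₁ J₂}
    (hw : w ∈ hA J₁ J₂ α) (hw' : tDeriv₁ _ _ _ w = 0) :
    ∃ u ∈ hA J₁ J₂ α, tDeriv₁ _ _ _ u = 0 ∧ 𝔇 u = w := by
  have key := hA_induction_of_tDeriv₁
    ((hA J₁ J₂ α ⊓ LinearMap.ker (tDeriv₁ Γ J₁ J₂).toLinearMap).map (sd₂ Γ J₁ J₂)) ?_ hw hw'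
  · obtain ⟨u, ⟨hu, hu'⟩, e⟩ := key
    exact ⟨u, hu, hu', e⟩
  have mem : ∀ j ∈ J₂.1, (ex α * t₂ ^ j : SemigroupAlg Γ J₁ J₂) ∈ hA J₁ J₂ α := fun j hj => by
    simpa using ex_t_mem_hA (J₁ := J₁) α (zero_mem _) hj
  have ker : ∀ j : ℕ, tDeriv₁ _ _ _ (ex α * t₂ ^ j : SemigroupAlg Γ J₁ J₂) = 0 := fun j => by
    simp [Derivation.leibniz, Derivation.leibniz_pow, tDeriv₁_ex, tDeriv₁_t₂]
  have td : J₂.1 = ⊤ → ∀ j : ℕ, tDeriv₂ _ _ _ (ex α * t₂ ^ j : SemigroupAlg Γ J₁ J₂) =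
      (j : F) • (ex α * t₂ ^ (j - 1)) := fun hJ j => by
    simpa using tDeriv₂_ex_t (J₁ := J₁) hJ α 0 j
  intro j hj
  by_cases hα : (α : F × F).2 - 1 = 0
  · have hJ := h.resolve_left (not_not.2 (sub_eq_zero.1 hα))
    have hj' : j + 1 ∈ J₂.1 := by simp [hJ]
    refine ⟨((j + 1 : ℕ) : F)⁻¹ • (ex α * t₂ ^ (j + 1)),
      ⟨Submodule.smul_mem _ _ (mem _ hj'), by simp [ker]⟩, ?_⟩
    rw [map_smul, sd₂_of_mem (mem _ hj'), hα, zero_smul, zero_add, td hJ, smul_smul,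
      inv_mul_cancel₀ (Nat.cast_ne_zero.2 (Nat.succ_ne_zero j)), one_smul, Nat.add_sub_cancel]
  · by_cases hJ : J₂.1 = ⊥
    · refine ⟨((α : F × F).2 - 1)⁻¹ • (ex α * t₂ ^ j),
        ⟨Submodule.smul_mem _ _ (mem _ hj), by simp [ker]⟩, ?_⟩
      rw [map_smul, sd₂_of_mem (mem _ hj), tDeriv₂_eq_zero hJ,
        add_zero, smul_smul, inv_mul_cancel₀ hα, one_smul]
    · have hJ' := ExpMonoid.eq_top_of_ne_bot hJ
      induction j with
      | zero =>
        refine ⟨((α : F × F).2 - 1)⁻¹ • (ex α * t₂ ^ 0),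
          ⟨Submodule.smul_mem _ _ (mem _ hj), by simp [tDeriv₁_ex]⟩, ?_⟩
        rw [map_smul, sd₂_of_mem (mem _ hj), td hJ', Nat.cast_zero, zero_smul,
          add_zero, smul_smul, inv_mul_cancel₀ hα, one_smul]
      | succ n ih =>
        obtain ⟨u, ⟨hu, hu'⟩, e⟩ := ih (by simp [hJ'])
        have hu'' : tDeriv₁ _ _ _ u = 0 := hu'
        refine ⟨((α : F × F).2 - 1)⁻¹ • (ex α * t₂ ^ (n + 1) - ((n + 1 : ℕ) : F) • u),
          ⟨Submodule.smul_mem _ _ (Submodule.sub_mem _ (mem _ hj)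
            (Submodule.smul_mem _ _ hu)), by simp [ker, hu'']⟩, ?_⟩
        rw [map_smul, map_sub, map_smul, e, sd₂_of_mem (mem _ hj), td hJ', Nat.add_sub_cancel,
          add_sub_cancel_right, smul_smul, inv_mul_cancel₀ hα, one_smul]

end

end BlockLie

namespace BlockLie

noncomputable section

set_option linter.unusedSectionVars false

open AddMonoidAlgebra (single)

variable {F : Type*} [Field F] {Γ : AddSubgroup (F × F)} {J₁ J₂ : ExpMonoid}

local notation "∂₁" => pd₁ _ _ _
local notation "∂₂" => pd₂ _ _ _
local notation "𝔇" => sd₂ _ _ _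

/-! ### Presenting `B` by the semigroup algebra -/

/-- The standing nondegeneracy assumption on `Γ`. -/
class Nondegenerate (Γ : AddSubgroup (F × F)) (J₁ J₂ : ExpMonoid) : Prop where
  proj₁_ne_zero : J₁.1 = ⊥ → proj₁ Γ ≠ 0

theorem exists_fst_ne_zero (h : proj₁ Γ ≠ 0) : ∃ β : Γ, (β : F × F).1 ≠ 0 := by
  by_contra! hc
  exact h (AddMonoidHom.ext hc)

/-- The case in which `B` is the derived algebra of `B₂`. -/
def Special (Γ : AddSubgroup (F × F)) (J₁ J₂ : ExpMonoid) : Prop :=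
  J₁.1 = ⊥ ∧ J₂.1 = ⊥ ∧ σ₂ ∈ Γ

/-- The quotient map `A → B₂`. -/
def qB (Γ : AddSubgroup (F × F)) (J₁ J₂ : ExpMonoid) :
    SemigroupAlg Γ J₁ J₂ →ₗ[F] B₂ Γ J₁ J₂ :=
  (Z Γ J₁ J₂).toSubmodule.mkQ ∘ₗ (toA₂ Γ J₁ J₂).toLinearMap

theorem qB_surjective : Function.Surjective (qB Γ J₁ J₂) :=
  (Submodule.mkQ_surjective _).comp (toA₂ Γ J₁ J₂).surjective

theorem qB_eq_zero {v : SemigroupAlg Γ J₁ J₂} :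
    qB Γ J₁ J₂ v = 0 ↔ ∃ c : F, v = c • xA Γ J₁ J₂ σ₁ 0 := by
  have : qB Γ J₁ J₂ v = 0 ↔ toA₂ Γ J₁ J₂ v ∈ (Z Γ J₁ J₂).toSubmodule :=
    Submodule.Quotient.mk_eq_zero _
  rw [this]
  change _ ∈ Submodule.span F _ ↔ _
  rw [Submodule.mem_span_singleton]
  simp only [← map_smul, (toA₂ Γ J₁ J₂).injective.eq_iff, eq_comm]

theorem qB_br (u v : SemigroupAlg Γ J₁ J₂) :
    qB Γ J₁ J₂ (br u v) = ⁅qB Γ J₁ J₂ u, qB Γ J₁ J₂ v⁆ := rfl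

/-- The elements of the semigroup algebra whose image in `B₂` lies in `B`. -/
def dom (Γ : AddSubgroup (F × F)) (J₁ J₂ : ExpMonoid) : Submodule F (SemigroupAlg Γ J₁ J₂) :=
  (BSub Γ J₁ J₂).toSubmodule.comap (qB Γ J₁ J₂)

theorem mem_dom_iff {v : SemigroupAlg Γ J₁ J₂} :
    v ∈ dom Γ J₁ J₂ ↔ qB Γ J₁ J₂ v ∈ BSub Γ J₁ J₂ := Iff.rfl

theorem dom_eq_top (h : ¬ Special Γ J₁ J₂) : dom Γ J₁ J₂ = ⊤ := by
  refine eq_top_iff.2 fun v _ => ?_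
  rw [mem_dom_iff, BSub, if_neg (show ¬ (J₁.1 = ⊥ ∧ J₂.1 = ⊥ ∧ σ₂ ∈ Γ) from h)]
  trivial

theorem BSub_toSubmodule (h : Special Γ J₁ J₂) : (BSub Γ J₁ J₂).toSubmodule =
    Submodule.span F {m | ∃ x y : B₂ Γ J₁ J₂, ⁅x, y⁆ = m} := by
  rw [BSub, if_pos (show J₁.1 = ⊥ ∧ J₂.1 = ⊥ ∧ σ₂ ∈ Γ from h)]
  exact LieAlgebra.coe_derivedSeries_one_eq ..

theorem br_mem_dom (u v : SemigroupAlg Γ J₁ J₂) : br u v ∈ dom Γ J₁ J₂ := by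
  by_cases h : Special Γ J₁ J₂
  · rw [mem_dom_iff, ← LieSubalgebra.mem_toSubmodule, BSub_toSubmodule h, qB_br]
    exact Submodule.subset_span ⟨_, _, rfl⟩
  · rw [dom_eq_top h]; trivial

theorem br_ex_ex (β γ : Γ) : br (ex β : SemigroupAlg Γ J₁ J₂) (ex γ) =
    ((β : F × F).1 * ((γ : F × F).2 - 1) - (γ : F × F).1 * ((β : F × F).2 - 1)) •
      ex (β + γ) := by
  rw [br_eq, pd₁_ex, sd₂_ex, pd₁_ex, sd₂_ex, ex_add]
  simp only [Algebra.smul_def, map_sub, map_mul, map_one]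
  ring

/-- In the special case `x^γ` is obtained as a bracket: if `γ₁ ≠ 0`, `[1, x^γ] = γ₁ x^γ`; if `γ₁ =
0`, `[x^α, x^{γ-α}] = α₁ (γ₂ - 2) x^γ` for any `α` with `α₁ ≠ 0`. Only `γ = σ₂` escapes. -/
theorem ex_mem_dom_of_ne [Nondegenerate Γ J₁ J₂] {γ : Γ} (h : (γ : F × F) ≠ σ₂) :
    (ex γ : SemigroupAlg Γ J₁ J₂) ∈ dom Γ J₁ J₂ := by
  by_cases hs : Special Γ J₁ J₂
  · by_cases h1 : (γ : F × F).1 = 0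
    · obtain ⟨α, hα⟩ := exists_fst_ne_zero
        (Nondegenerate.proj₁_ne_zero (Γ := Γ) (J₁ := J₁) (J₂ := J₂) hs.1)
      have h2 : (γ : F × F).2 - 2 ≠ 0 := fun h2 => h (Prod.ext h1 (sub_eq_zero.1 h2))
      have := br_mem_dom (ex α : SemigroupAlg Γ J₁ J₂) (ex (γ - α))
      rw [br_ex_ex, add_sub_cancel] at this
      refine ((dom Γ J₁ J₂).smul_mem_iff (mul_ne_zero hα h2)).1 ?_
      convert this using 2
      simp [h1]; ring
    · have := br_mem_dom (ex 0 : SemigroupAlg Γ J₁ J₂) (ex γ)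
      rw [br_ex_ex, zero_add] at this
      refine ((dom Γ J₁ J₂).smul_mem_iff h1).1 ?_
      convert this using 2
      simp
  · rw [dom_eq_top hs]; trivial

/-- The linear form which reads off a coefficient. -/
def coeffL (m : Γ × J₁.1 × J₂.1) : SemigroupAlg Γ J₁ J₂ →ₗ[F] F :=
  Finsupp.lapply m ∘ₗ (AddMonoidAlgebra.coeffLinearEquiv F).toLinearMap

theorem coeffL_apply (m : Γ × J₁.1 × J₂.1) (v : SemigroupAlg Γ J₁ J₂) :
    coeffL m v = v.coeff m := rfl

theorem coeff_ex (β : Γ) (m : Γ × J₁.1 × J₂.1) [Decidable ((β, 0, 0) = m)] :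
    (ex β : SemigroupAlg Γ J₁ J₂).coeff m = if (β, 0, 0) = m then 1 else 0 := by
  classical
  rw [ex, AddMonoidAlgebra.coeff_single, Finsupp.single_apply]

theorem σ₁_ne_σ₂ [CharZero F] : (σ₁ : F × F) ≠ σ₂ := fun h => by
  have := congrArg Prod.snd h
  norm_num [σ₁, σ₂] at this

theorem xA_σ₁ (h : σ₁ ∈ Γ) : xA Γ J₁ J₂ σ₁ 0 = ex ⟨σ₁, h⟩ :=
  xA_of_mem (Γ := Γ) (J₁ := J₁) (J₂ := J₂) (⟨σ₁, h⟩, 0, 0)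

theorem xA_σ₁_eq_zero (h : σ₁ ∉ Γ) : xA Γ J₁ J₂ σ₁ 0 = 0 :=
  dif_neg fun h' => h h'.1

theorem coeff_xA_σ₁ {m : Γ × J₁.1 × J₂.1} (hm : ¬ ((m.1 : F × F) = σ₁ ∧ m.2 = 0)) :
    (xA Γ J₁ J₂ σ₁ 0).coeff m = 0 := by
  classical
  by_cases h : σ₁ ∈ Γ
  · rw [xA_σ₁ h, coeff_ex, if_neg]
    rintro rfl
    exact hm ⟨rfl, rfl⟩
  · rw [xA_σ₁_eq_zero h]; rfl

theorem eq_ex_of_bot (h₁ : J₁.1 = ⊥) (h₂ : J₂.1 = ⊥) (W : Submodule F (SemigroupAlg Γ J₁ J₂))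
    (h : ∀ β, ex β ∈ W) (v : SemigroupAlg Γ J₁ J₂) : v ∈ W := by
  refine span_mono W (fun β i j hi hj => ?_) v
  have hi' : i = 0 := by simpa [h₁] using hi
  have hj' : j = 0 := by simpa [h₂] using hj
  simpa [hi', hj'] using h β

/-- If `β + γ = σ₂`, the structure constant `β₁(γ₂ - 1) - γ₁(β₂ - 1)` becomes `β₁(1 - β₂) + β₁(β₂ -
1) = 0`. Hence no bracket involves `x^{σ₂}`. -/
theorem coeff_br_σ₂ (h : Special Γ J₁ J₂) (u v : SemigroupAlg Γ J₁ J₂) :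
    (br u v).coeff (⟨σ₂, h.2.2⟩, 0, 0) = 0 := by
  classical
  let L (u : SemigroupAlg Γ J₁ J₂) : SemigroupAlg Γ J₁ J₂ →ₗ[F] F :=
    coeffL (⟨σ₂, h.2.2⟩, 0, 0) ∘ₗ
      ⟨⟨br u, br_add_right u⟩, fun c v => br_smul c u v⟩
  have key : ∀ β (v : SemigroupAlg Γ J₁ J₂), L (ex β) v = 0 := by
    intro β v
    refine eq_ex_of_bot h.1 h.2.1 (LinearMap.ker (L (ex β))) (fun γ => ?_) v
    change (br (ex β : SemigroupAlg Γ J₁ J₂) (ex γ)).coeff _ = 0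
    rw [br_ex_ex, AddMonoidAlgebra.coeff_smul_apply, coeff_ex]
    split_ifs with hβ
    · have e : ((β + γ : Γ) : F × F) = σ₂ := congrArg (fun m => (m.1 : F × F)) hβ
      have e1 := congrArg Prod.fst e
      have e2 := congrArg Prod.snd e
      simp only [AddSubgroup.coe_add, Prod.fst_add, Prod.snd_add, σ₂] at e1 e2
      rw [show (γ : F × F).1 = -(β : F × F).1 by linear_combination e1,
        show (γ : F × F).2 = 2 - (β : F × F).2 by linear_combination e2]
      rw [smul_eq_mul]; ring
    · simp
  have := eq_ex_of_bot h.1 h.2.1 (LinearMap.ker (L v)) (fun γ => ?_) u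
  · change (br v u).coeff _ = 0 at this
    rw [br_comm, AddMonoidAlgebra.coeff_neg, Finsupp.neg_apply, this, neg_zero]
  · change (br v (ex γ)).coeff _ = 0
    rw [br_comm, AddMonoidAlgebra.coeff_neg, Finsupp.neg_apply, neg_eq_zero]
    exact key γ v

variable [CharZero F]

/-- The coefficient at `σ₂` vanishes on the central line, because `σ₁ ≠ σ₂`, so it descends to a
linear form on `B₂`; it kills all brackets. The other monomials are themselves in the derived
algebra. -/
theorem mem_dom [Nondegenerate Γ J₁ J₂] {v : SemigroupAlg Γ J₁ J₂} :
    v ∈ dom Γ J₁ J₂ ↔ ∀ h : Special Γ J₁ J₂, v.coeff (⟨σ₂, h.2.2⟩, 0, 0) = 0 := by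
  constructor
  · intro hv h
    have hle : (Z Γ J₁ J₂).toSubmodule ≤ LinearMap.ker
        (coeffL (J₁ := J₁) (J₂ := J₂) (⟨σ₂, h.2.2⟩, 0, 0) ∘ₗ
          (toA₂ Γ J₁ J₂).symm.toLinearMap) := by
      refine (Submodule.span_le).2 ?_
      rintro _ rfl
      exact coeff_xA_σ₁ fun h' => σ₁_ne_σ₂ h'.1.symm
    let f : B₂ Γ J₁ J₂ →ₗ[F] F := (Z Γ J₁ J₂).toSubmodule.liftQ _ hle
    have hf : ∀ w, f (qB Γ J₁ J₂ w) = w.coeff (⟨σ₂, h.2.2⟩, 0, 0) := fun w => rfl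
    rw [mem_dom_iff, ← LieSubalgebra.mem_toSubmodule, BSub_toSubmodule h] at hv
    rw [← hf]
    have : Submodule.span F {m | ∃ x y : B₂ Γ J₁ J₂, ⁅x, y⁆ = m} ≤ LinearMap.ker f := by
      refine Submodule.span_le.2 ?_
      rintro _ ⟨x, y, rfl⟩
      obtain ⟨x, rfl⟩ := qB_surjective x
      obtain ⟨y, rfl⟩ := qB_surjective y
      change f _ = 0
      rw [← qB_br, hf, coeff_br_σ₂ h]
    exact this hv
  · intro hv
    by_cases h : Special Γ J₁ J₂
    · have e : v = v.coeff.sum (fun m c => single m c) := by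
        conv_lhs => rw [← AddMonoidAlgebra.ofCoeff_coeff v, ← Finsupp.sum_single v.coeff]
        rw [AddMonoidAlgebra.ofCoeff_finsuppSum]; rfl
      rw [e]
      refine Submodule.sum_mem _ fun m hm => ?_
      have e2 : m.2 = 0 := Prod.ext (ExpMonoid.eq_zero_of_eq_bot h.1 _)
        (ExpMonoid.eq_zero_of_eq_bot h.2.1 _)
      have e3 : (single m (v.coeff m) : SemigroupAlg Γ J₁ J₂) = v.coeff m • ex m.1 := by
        rw [ex, AddMonoidAlgebra.smul_single, smul_eq_mul, mul_one]
        congr 1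
        exact Prod.ext rfl e2
      dsimp only
      rw [e3]
      refine Submodule.smul_mem _ _ (ex_mem_dom_of_ne fun hσ => ?_)
      refine (Finsupp.mem_support_iff.1 hm) ?_
      rw [show m = (⟨σ₂, h.2.2⟩, 0, 0) from Prod.ext (Subtype.ext hσ) e2]
      exact hv h
    · rw [dom_eq_top h]; trivial

/-- The monomials which are read as `0` in `B`. -/
def Dead (m : Γ × J₁.1 × J₂.1) : Prop :=
  ((m.1 : F × F) = σ₁ ∧ m.2 = 0) ∨ (Special Γ J₁ J₂ ∧ (m.1 : F × F) = σ₂)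

open scoped Classical in
/-- The projection of the semigroup algebra which deletes the dead monomials. -/
def live (Γ : AddSubgroup (F × F)) (J₁ J₂ : ExpMonoid) :
    SemigroupAlg Γ J₁ J₂ →ₗ[F] SemigroupAlg Γ J₁ J₂ :=
  linOfBasis fun m => if Dead m then 0 else single m 1

theorem coeff_live_of_dead (v : SemigroupAlg Γ J₁ J₂) {m : Γ × J₁.1 × J₂.1} (h : Dead m) :
    (live Γ J₁ J₂ v).coeff m = 0 := by
  classical
  induction v using AddMonoidAlgebra.induction_linear with
  | zero => simp
  | add f g hf hg => simp [hf, hg]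
  | single n c =>
    rw [live, linOfBasis_single]
    split_ifs with hn
    · simp
    · rw [AddMonoidAlgebra.coeff_smul_apply, AddMonoidAlgebra.coeff_single, Finsupp.single_apply,
        if_neg (by rintro rfl; exact hn h), smul_zero]

theorem coeff_live (v : SemigroupAlg Γ J₁ J₂) {m : Γ × J₁.1 × J₂.1} (h : ¬ Dead m) :
    (live Γ J₁ J₂ v).coeff m = v.coeff m := by
  classical
  induction v using AddMonoidAlgebra.induction_linear with
  | zero => simp
  | add f g hf hg => simp [hf, hg]
  | single n c =>
    rw [live, linOfBasis_single]
    split_ifs with hn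
    · rw [AddMonoidAlgebra.coeff_single, Finsupp.single_apply, if_neg (by rintro rfl; exact h hn)]
      simp
    · simp

theorem live_mem_hA {α : Γ} {v : SemigroupAlg Γ J₁ J₂} (hv : v ∈ hA J₁ J₂ α) :
    live Γ J₁ J₂ v ∈ hA J₁ J₂ α := by
  intro m hm
  by_cases h : Dead m
  · exact coeff_live_of_dead v h
  · rw [coeff_live v h, hv m hm]

theorem live_live (v : SemigroupAlg Γ J₁ J₂) : live Γ J₁ J₂ (live Γ J₁ J₂ v) = live Γ J₁ J₂ v := by
  refine AddMonoidAlgebra.coeff_injective (Finsupp.ext fun m => ?_)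
  by_cases h : Dead m
  · rw [coeff_live_of_dead _ h, coeff_live_of_dead _ h]
  · rw [coeff_live _ h]

section
variable [Nondegenerate Γ J₁ J₂]

theorem live_mem_dom (v : SemigroupAlg Γ J₁ J₂) : live Γ J₁ J₂ v ∈ dom Γ J₁ J₂ :=
  mem_dom.2 fun h => coeff_live_of_dead v (Or.inr ⟨h, rfl⟩)

theorem coeff_eq_zero_of_dead {v : SemigroupAlg Γ J₁ J₂} (hv : v ∈ dom Γ J₁ J₂)
    {m : Γ × J₁.1 × J₂.1} (h : Dead m) (hm : ¬ ((m.1 : F × F) = σ₁ ∧ m.2 = 0)) :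
    v.coeff m = 0 := by
  obtain h | ⟨h, h'⟩ := h
  · exact absurd h hm
  · have e2 : m.2 = 0 := Prod.ext (ExpMonoid.eq_zero_of_eq_bot h.1 _)
      (ExpMonoid.eq_zero_of_eq_bot h.2.1 _)
    rw [show m = (⟨σ₂, h.2.2⟩, 0, 0) from Prod.ext (Subtype.ext h') e2]
    exact mem_dom.1 hv h

theorem eq_live_add {v : SemigroupAlg Γ J₁ J₂} (hv : v ∈ dom Γ J₁ J₂) :
    ∃ c : F, v = live Γ J₁ J₂ v + c • xA Γ J₁ J₂ σ₁ 0 := by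
  classical
  by_cases hσ : σ₁ ∈ Γ
  · refine ⟨v.coeff (⟨σ₁, hσ⟩, 0, 0), AddMonoidAlgebra.coeff_injective (Finsupp.ext fun m => ?_)⟩
    rw [AddMonoidAlgebra.coeff_add, Finsupp.add_apply, AddMonoidAlgebra.coeff_smul_apply]
    by_cases hm : (m.1 : F × F) = σ₁ ∧ m.2 = 0
    · have : m = (⟨σ₁, hσ⟩, 0, 0) := Prod.ext (Subtype.ext hm.1) hm.2
      rw [coeff_live_of_dead v (Or.inl hm), xA_σ₁ hσ, coeff_ex, if_pos this.symm, this]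
      simp
    · rw [coeff_xA_σ₁ hm, smul_zero, add_zero]
      by_cases hd : Dead m
      · rw [coeff_live_of_dead v hd, coeff_eq_zero_of_dead hv hd hm]
      · rw [coeff_live v hd]
  · refine ⟨0, AddMonoidAlgebra.coeff_injective (Finsupp.ext fun m => ?_)⟩
    have hm : ¬ ((m.1 : F × F) = σ₁ ∧ m.2 = 0) := fun h => hσ (h.1 ▸ m.1.2)
    rw [zero_smul, add_zero]
    by_cases hd : Dead m
    · rw [coeff_live_of_dead v hd, coeff_eq_zero_of_dead hv hd hm]
    · rw [coeff_live v hd]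

theorem qB_live {v : SemigroupAlg Γ J₁ J₂} (hv : v ∈ dom Γ J₁ J₂) :
    qB Γ J₁ J₂ (live Γ J₁ J₂ v) = qB Γ J₁ J₂ v := by
  obtain ⟨c, hc⟩ := eq_live_add hv
  conv_rhs => rw [hc, map_add, qB_eq_zero.2 ⟨c, rfl⟩, add_zero]

/-- The linear map `A → B`, `x^{α,i} ↦ x^{α,i}`. -/
def pB (Γ : AddSubgroup (F × F)) (J₁ J₂ : ExpMonoid) [Nondegenerate Γ J₁ J₂] :
    SemigroupAlg Γ J₁ J₂ →ₗ[F] B Γ J₁ J₂ where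
  toFun v := ⟨qB Γ J₁ J₂ (live Γ J₁ J₂ v), live_mem_dom v⟩
  map_add' u v := Subtype.ext (by simp)
  map_smul' c v := Subtype.ext (by simp)

theorem coe_pB {v : SemigroupAlg Γ J₁ J₂} (hv : v ∈ dom Γ J₁ J₂) :
    (pB Γ J₁ J₂ v : B₂ Γ J₁ J₂) = qB Γ J₁ J₂ v := qB_live hv

theorem exists_pB (b : B Γ J₁ J₂) : ∃ v ∈ dom Γ J₁ J₂, pB Γ J₁ J₂ v = b := by
  obtain ⟨v, hv⟩ := qB_surjective (b : B₂ Γ J₁ J₂)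
  have hv' : v ∈ dom Γ J₁ J₂ := by rw [mem_dom_iff, hv]; exact b.2
  exact ⟨v, hv', Subtype.ext ((coe_pB hv').trans hv)⟩

theorem pB_eq_zero {v : SemigroupAlg Γ J₁ J₂} : pB Γ J₁ J₂ v = 0 ↔ live Γ J₁ J₂ v = 0 := by
  constructor
  · intro h
    obtain ⟨c, hc⟩ := qB_eq_zero.1 (congrArg Subtype.val h)
    refine AddMonoidAlgebra.coeff_injective (Finsupp.ext fun m => ?_)
    by_cases hm : (m.1 : F × F) = σ₁ ∧ m.2 = 0
    · exact coeff_live_of_dead v (Or.inl hm)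
    · rw [hc, AddMonoidAlgebra.coeff_smul_apply, coeff_xA_σ₁ hm, smul_zero]; rfl
  · intro h
    refine Subtype.ext ?_
    change qB Γ J₁ J₂ (live Γ J₁ J₂ v) = 0
    rw [h, map_zero]

theorem pB_eq {u v : SemigroupAlg Γ J₁ J₂} :
    pB Γ J₁ J₂ u = pB Γ J₁ J₂ v ↔ live Γ J₁ J₂ u = live Γ J₁ J₂ v := by
  rw [← sub_eq_zero, ← map_sub, pB_eq_zero, map_sub, sub_eq_zero]

theorem pB_live (v : SemigroupAlg Γ J₁ J₂) : pB Γ J₁ J₂ (live Γ J₁ J₂ v) = pB Γ J₁ J₂ v :=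
  pB_eq.2 (live_live v)

theorem pB_eq_zero_iff {v : SemigroupAlg Γ J₁ J₂} (hv : v ∈ dom Γ J₁ J₂) :
    pB Γ J₁ J₂ v = 0 ↔ ∃ c : F, v = c • xA Γ J₁ J₂ σ₁ 0 := by
  rw [← qB_eq_zero, ← coe_pB hv, Subtype.ext_iff]; rfl

theorem pB_xA_σ₁ : pB Γ J₁ J₂ (xA Γ J₁ J₂ σ₁ 0) = 0 :=
  pB_eq_zero.2 (AddMonoidAlgebra.coeff_injective (Finsupp.ext fun m => by
    by_cases hm : Dead m
    · rw [coeff_live_of_dead _ hm]; rfl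
    · rw [coeff_live _ hm, coeff_xA_σ₁ fun h => hm (Or.inl h)]; rfl))

theorem pB_lie {u v : SemigroupAlg Γ J₁ J₂} (hu : u ∈ dom Γ J₁ J₂) (hv : v ∈ dom Γ J₁ J₂) :
    ⁅pB Γ J₁ J₂ u, pB Γ J₁ J₂ v⁆ = pB Γ J₁ J₂ (br u v) := by
  refine Subtype.ext ?_
  rw [coe_pB (br_mem_dom u v), LieSubalgebra.coe_bracket, coe_pB hu, coe_pB hv]
  rfl

/-- The linear section of `A → B` which avoids the dead monomials. -/
def ιB (Γ : AddSubgroup (F × F)) (J₁ J₂ : ExpMonoid) [Nondegenerate Γ J₁ J₂] :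
    B Γ J₁ J₂ →ₗ[F] SemigroupAlg Γ J₁ J₂ where
  toFun b := live Γ J₁ J₂ (exists_pB b).choose
  map_add' a b := by
    rw [← map_add, ← pB_eq, map_add, (exists_pB a).choose_spec.2, (exists_pB b).choose_spec.2,
      (exists_pB (a + b)).choose_spec.2]
  map_smul' c b := by
    rw [← map_smul, ← pB_eq, map_smul, RingHom.id_apply, (exists_pB b).choose_spec.2,
      (exists_pB (c • b)).choose_spec.2]

theorem ιB_pB (v : SemigroupAlg Γ J₁ J₂) : ιB Γ J₁ J₂ (pB Γ J₁ J₂ v) = live Γ J₁ J₂ v :=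
  pB_eq.1 (exists_pB (pB Γ J₁ J₂ v)).choose_spec.2

theorem pB_ιB (b : B Γ J₁ J₂) : pB Γ J₁ J₂ (ιB Γ J₁ J₂ b) = b := by
  obtain ⟨v, _, rfl⟩ := exists_pB b
  rw [ιB_pB, pB_live]

theorem ιB_mem_dom (b : B Γ J₁ J₂) : ιB Γ J₁ J₂ b ∈ dom Γ J₁ J₂ := by
  obtain ⟨v, _, rfl⟩ := exists_pB b
  rw [ιB_pB]
  exact live_mem_dom v

/-- A monomial in `Γ × J` can fail to lie in `B` only if it is `x^{σ₂}` in the special case. That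
monomial is dead, so both readings give `0`. -/
theorem pB_xA (α : F × F) (i : ℕ × ℕ) : pB Γ J₁ J₂ (xA Γ J₁ J₂ α i) = xB Γ J₁ J₂ α i := by
  have e : xB₂ Γ J₁ J₂ α i = qB Γ J₁ J₂ (xA Γ J₁ J₂ α i) := rfl
  unfold xB
  split_ifs with h
  · exact Subtype.ext (coe_pB h)
  · have hd : xA Γ J₁ J₂ α i ∉ dom Γ J₁ J₂ := h
    have hs : Special Γ J₁ J₂ := by
      by_contra hs
      rw [dom_eq_top hs] at hd
      exact hd trivial
    by_cases hm : α ∈ Γ ∧ i.1 ∈ J₁.1 ∧ i.2 ∈ J₂.1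
    · have e : xA Γ J₁ J₂ α i = single (⟨α, hm.1⟩, ⟨i.1, hm.2.1⟩, ⟨i.2, hm.2.2⟩) 1 := dif_pos hm
      have e2 : ((⟨i.1, hm.2.1⟩, ⟨i.2, hm.2.2⟩) : J₁.1 × J₂.1) = 0 := Prod.ext
        (ExpMonoid.eq_zero_of_eq_bot hs.1 _) (ExpMonoid.eq_zero_of_eq_bot hs.2.1 _)
      rw [e, e2] at hd ⊢
      have hα : α = σ₂ := by
        by_contra hα
        exact hd (ex_mem_dom_of_ne (γ := ⟨α, hm.1⟩) hα)
      refine pB_eq_zero.2 ?_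
      rw [live, linOfBasis_single, if_pos (show Dead _ from Or.inr ⟨hs, hα⟩), smul_zero]
    · rw [xA, dif_neg hm] at hd
      exact absurd (Submodule.zero_mem _) hd

theorem gr_eq_map (α : Γ) : gr Γ J₁ J₂ α = (hA J₁ J₂ α).map (pB Γ J₁ J₂) := by
  refine le_antisymm (Submodule.span_le.2 ?_) ?_
  · rintro _ ⟨i, hi, hj, rfl⟩
    refine ⟨xA Γ J₁ J₂ α i, ?_, pB_xA _ _⟩
    rw [show xA Γ J₁ J₂ α i = _ from xA_of_mem (α, ⟨i.1, hi⟩, ⟨i.2, hj⟩)]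
    exact single_mem_hA (α, _, _) 1
  · rintro _ ⟨v, hv, rfl⟩
    refine hA_induction ((gr Γ J₁ J₂ α).comap (pB Γ J₁ J₂)) (fun i j hi hj => ?_) hv
    refine Submodule.subset_span ⟨(i, j), hi, hj, ?_⟩
    rw [← pB_xA, show xA Γ J₁ J₂ α (i, j) = _ from xA_of_mem (α, ⟨i, hi⟩, ⟨j, hj⟩),
      ex_t_eq_single α ⟨i, hi⟩ ⟨j, hj⟩]

theorem pB_mem_gr {α : Γ} {v : SemigroupAlg Γ J₁ J₂} (hv : v ∈ hA J₁ J₂ α) :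
    pB Γ J₁ J₂ v ∈ gr Γ J₁ J₂ α := by
  rw [gr_eq_map]; exact Submodule.mem_map_of_mem hv

theorem ιB_mem_hA {α : Γ} {b : B Γ J₁ J₂} (hb : b ∈ gr Γ J₁ J₂ α) : ιB Γ J₁ J₂ b ∈ hA J₁ J₂ α := by
  rw [gr_eq_map] at hb
  obtain ⟨v, hv, rfl⟩ := hb
  rw [ιB_pB]
  exact live_mem_hA hv

theorem span_gr (W : Submodule F (B Γ J₁ J₂)) (h : ∀ α : Γ, gr Γ J₁ J₂ α ≤ W) (b : B Γ J₁ J₂) :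
    b ∈ W := by
  rw [← pB_ιB b]
  exact span_hA (W.comap (pB Γ J₁ J₂)) (fun α v hv => h α (pB_mem_gr hv)) _

theorem restrictDer_derB₂_pB (T : SemigroupAlg Γ J₁ J₂ →ₗ[F] SemigroupAlg Γ J₁ J₂) (hT h0)
    {v : SemigroupAlg Γ J₁ J₂} (hv : v ∈ dom Γ J₁ J₂) :
    restrictDer (derB₂ T hT h0) (pB Γ J₁ J₂ v) = pB Γ J₁ J₂ (T v) := by
  have e : derB₂ T hT h0 (qB Γ J₁ J₂ v) = qB Γ J₁ J₂ (T v) := rfl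
  have hTv : T v ∈ dom Γ J₁ J₂ := by
    rw [mem_dom_iff, ← e]
    exact derB₂_mem_BSub _ _ _ _ hv
  refine Subtype.ext ?_
  rw [coe_pB hTv, ← e, ← coe_pB hv]
  rfl

end

end

end BlockLie

namespace BlockLie

noncomputable section

set_option linter.unusedSectionVars false

open AddMonoidAlgebra (single)

variable {F : Type*} [Field F] [CharZero F] {Γ : AddSubgroup (F × F)} {J₁ J₂ : ExpMonoid}
  [Nondegenerate Γ J₁ J₂]

local notation "∂₁" => pd₁ _ _ _
local notation "∂₂" => pd₂ _ _ _
local notation "𝔇" => sd₂ _ _ _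

/-! ### The standard derivations on the images of elements of the semigroup algebra -/

theorem hA_le_dom {α : Γ} (h : (α : F × F) ≠ σ₂) : hA J₁ J₂ α ≤ dom Γ J₁ J₂ := fun _ hv =>
  mem_dom.2 fun _ => hv _ fun h' => h (congrArg Subtype.val h').symm

theorem hA_le_dom_of_fst {α : Γ} (h : (α : F × F).1 ≠ 0) : hA J₁ J₂ α ≤ dom Γ J₁ J₂ :=
  hA_le_dom fun h' => h (by rw [h']; rfl)

theorem zero_ne_σ₂ : ((0 : Γ) : F × F) ≠ σ₂ := fun h => by
  have := congrArg Prod.snd h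
  simp [σ₂] at this

theorem one_mem_dom : (1 : SemigroupAlg Γ J₁ J₂) ∈ dom Γ J₁ J₂ :=
  hA_le_dom zero_ne_σ₂ one_mem_hA

theorem adB_pB {u v : SemigroupAlg Γ J₁ J₂} (hu : u ∈ dom Γ J₁ J₂) (hv : v ∈ dom Γ J₁ J₂) :
    adB (pB Γ J₁ J₂ u) (pB Γ J₁ J₂ v) = pB Γ J₁ J₂ (br u v) := by
  rw [LieDerivation.ad_apply_apply, pB_lie hu hv]

theorem dHom_pB (μ : Γ →+ F) {v : SemigroupAlg Γ J₁ J₂} (hv : v ∈ dom Γ J₁ J₂) :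
    dHom Γ J₁ J₂ μ (pB Γ J₁ J₂ v) = pB Γ J₁ J₂ (homDeriv J₁ J₂ μ v) :=
  restrictDer_derB₂_pB _ _ _ hv

theorem dt₂_pB {v : SemigroupAlg Γ J₁ J₂} (hv : v ∈ dom Γ J₁ J₂) :
    dt₂ Γ J₁ J₂ (pB Γ J₁ J₂ v) = pB Γ J₁ J₂ (tDeriv₂ _ _ _ v) :=
  restrictDer_derB₂_pB _ _ _ hv

theorem d₁_pB (h : J₂.1 = ⊥) {v : SemigroupAlg Γ J₁ J₂} (hv : v ∈ dom Γ J₁ J₂) :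
    d₁ Γ J₁ J₂ (pB Γ J₁ J₂ v) = pB Γ J₁ J₂ (-(xA Γ J₁ J₂ σ₁ 0 * ∂₁ v)) := by
  rw [d₁, if_pos h, restrictDer_derB₂_pB _ _ _ hv, shift₁_apply]

theorem d₁_eq_zero (h : J₂.1 ≠ ⊥) : d₁ Γ J₁ J₂ = 0 := if_neg h

theorem dBar₁_pB (h : J₁.1 = ⊥) {v : SemigroupAlg Γ J₁ J₂} (hv : v ∈ dom Γ J₁ J₂) :
    dBar₁ Γ J₁ J₂ (pB Γ J₁ J₂ v) = pB Γ J₁ J₂ (xA Γ J₁ J₂ σ₁ 0 * 𝔇 v) := by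
  rw [dBar₁, if_pos h, restrictDer_derB₂_pB _ _ _ hv, shift₁'_apply, sd₂_apply]

theorem dBar₁_eq_zero (h : J₁.1 ≠ ⊥) : dBar₁ Γ J₁ J₂ = 0 := if_neg h

theorem coe_restrictDer (T : LieDerivation F (B₂ Γ J₁ J₂) (B₂ Γ J₁ J₂)) (b : B Γ J₁ J₂) :
    (restrictDer T b : B₂ Γ J₁ J₂) = T b := rfl

theorem d₂_pB (h : J₁.1 = ⊥ ∧ J₂.1 = ⊥) {v : SemigroupAlg Γ J₁ J₂} (hv : v ∈ dom Γ J₁ J₂) :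
    d₂ Γ J₁ J₂ (pB Γ J₁ J₂ v) = pB Γ J₁ J₂ (br (xA Γ J₁ J₂ σ₂ 0) v) := by
  rw [d₂, if_pos h]
  refine Subtype.ext ?_
  rw [coe_pB (br_mem_dom _ _), qB_br, ← coe_pB hv, coe_restrictDer,
    LieDerivation.ad_apply_apply]
  rfl

theorem d₂_eq_zero (h : ¬ (J₁.1 = ⊥ ∧ J₂.1 = ⊥)) : d₂ Γ J₁ J₂ = 0 := if_neg h

theorem LieDerivation_ext_pB {d e : Der Γ J₁ J₂}
    (h : ∀ v ∈ dom Γ J₁ J₂, d (pB Γ J₁ J₂ v) = e (pB Γ J₁ J₂ v)) : d = e :=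
  LieDerivation.ext fun b => by
    obtain ⟨v, hv, rfl⟩ := exists_pB b
    exact h v hv

/-- The operator `v ↦ P ∂₂'(v) - Q ∂₁(v) + μ(v) + f ∂_{t₂}(v)`, where `∂₂' = ∂₂ - 1`. -/
def opA (P Q : SemigroupAlg Γ J₁ J₂) (μ : Γ →+ F) (f : F) :
    SemigroupAlg Γ J₁ J₂ →ₗ[F] SemigroupAlg Γ J₁ J₂ :=
  LinearMap.mulLeft F P ∘ₗ sd₂ Γ J₁ J₂ - LinearMap.mulLeft F Q ∘ₗ (pd₁ Γ J₁ J₂).toLinearMap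
    + (homDeriv J₁ J₂ μ).toLinearMap + f • (tDeriv₂ Γ J₁ J₂).toLinearMap

theorem opA_apply (P Q : SemigroupAlg Γ J₁ J₂) (μ : Γ →+ F) (f : F) (v : SemigroupAlg Γ J₁ J₂) :
    opA P Q μ f v = P * 𝔇 v - Q * ∂₁ v + homDeriv J₁ J₂ μ v + f • tDeriv₂ _ _ _ v := rfl

/-- The derivation `d` is induced by `opA P Q μ f`. -/
structure IsInduced (d : Der Γ J₁ J₂) (P Q : SemigroupAlg Γ J₁ J₂) (μ : Γ →+ F) (f : F) :
    Prop where
  compat : 𝔇 P = ∂₁ Q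
  apply_pB : ∀ v ∈ dom Γ J₁ J₂, d (pB Γ J₁ J₂ v) = pB Γ J₁ J₂ (opA P Q μ f v)

theorem homDeriv_add (μ ν : Γ →+ F) (v : SemigroupAlg Γ J₁ J₂) :
    homDeriv J₁ J₂ (μ + ν) v = homDeriv J₁ J₂ μ v + homDeriv J₁ J₂ ν v := by
  refine span_hA (LinearMap.eqLocus (homDeriv J₁ J₂ (μ + ν)).toLinearMap
    ((homDeriv J₁ J₂ μ).toLinearMap + (homDeriv J₁ J₂ ν).toLinearMap)) (fun β v hv => ?_) v
  rw [LinearMap.mem_eqLocus, LinearMap.add_apply, Derivation.coeFn_coe, Derivation.coeFn_coe,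
    Derivation.coeFn_coe, homDeriv_of_mem _ hv, homDeriv_of_mem _ hv, homDeriv_of_mem _ hv,
    ← add_smul, AddMonoidHom.add_apply]

theorem homDeriv_smul (c : F) (μ : Γ →+ F) (v : SemigroupAlg Γ J₁ J₂) :
    homDeriv J₁ J₂ (c • μ) v = c • homDeriv J₁ J₂ μ v := by
  refine span_hA (LinearMap.eqLocus (homDeriv J₁ J₂ (c • μ)).toLinearMap
    (c • (homDeriv J₁ J₂ μ).toLinearMap)) (fun β v hv => ?_) v
  rw [LinearMap.mem_eqLocus, LinearMap.smul_apply, Derivation.coeFn_coe,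
    Derivation.coeFn_coe, homDeriv_of_mem _ hv, homDeriv_of_mem _ hv, smul_smul]
  rfl

theorem IsInduced.add {d e : Der Γ J₁ J₂} {P Q P' Q' : SemigroupAlg Γ J₁ J₂} {μ ν : Γ →+ F}
    {f g : F} (hd : IsInduced d P Q μ f) (he : IsInduced e P' Q' ν g) :
    IsInduced (d + e) (P + P') (Q + Q') (μ + ν) (f + g) where
  compat := by rw [map_add, map_add, hd.compat, he.compat]
  apply_pB v hv := by
    rw [LieDerivation.add_apply, hd.apply_pB v hv, he.apply_pB v hv, ← map_add]
    congr 1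
    rw [opA_apply, opA_apply, opA_apply, homDeriv_add, add_smul]
    ring

theorem IsInduced.smul {d : Der Γ J₁ J₂} {P Q : SemigroupAlg Γ J₁ J₂} {μ : Γ →+ F}
    {f : F} (c : F) (hd : IsInduced d P Q μ f) :
    IsInduced (c • d) (c • P) (c • Q) (c • μ) (c * f) where
  compat := by rw [map_smul, Derivation.map_smul, hd.compat]
  apply_pB v hv := by
    rw [LieDerivation.smul_apply, hd.apply_pB v hv, ← map_smul]
    congr 1
    rw [opA_apply, opA_apply, homDeriv_smul, smul_add, smul_add, smul_sub, smul_mul_assoc, smul_mul_assoc,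
      smul_smul]

theorem homDeriv_zero (v : SemigroupAlg Γ J₁ J₂) : homDeriv J₁ J₂ (0 : Γ →+ F) v = 0 := by
  have := span_mono (LinearMap.ker (homDeriv J₁ J₂ (0 : Γ →+ F)).toLinearMap)
    (fun β i j hi hj => by simp [homDeriv_of_mem _ (ex_t_mem_hA β hi hj)]) v
  simpa using this

theorem isInduced_zero : IsInduced (0 : Der Γ J₁ J₂) 0 0 0 0 where
  compat := by simp
  apply_pB v _ := by simp [opA_apply, homDeriv_zero]

theorem isInduced_adB {u : SemigroupAlg Γ J₁ J₂} (hu : u ∈ dom Γ J₁ J₂) :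
    IsInduced (adB (pB Γ J₁ J₂ u)) (∂₁ u) (𝔇 u) 0 0 where
  compat := (pd₁_sd₂ u).symm
  apply_pB v hv := by
    rw [adB_pB hu hv, opA_apply, homDeriv_zero, br_eq]
    congr 1
    simp [mul_comm]

theorem isInduced_dHom (μ : Γ →+ F) : IsInduced (dHom Γ J₁ J₂ μ) 0 0 μ 0 where
  compat := by simp
  apply_pB v hv := by rw [dHom_pB μ hv, opA_apply]; simp

theorem isInduced_dt₂ : IsInduced (dt₂ Γ J₁ J₂) 0 0 0 1 where
  compat := by simp
  apply_pB v hv := by rw [dt₂_pB hv, opA_apply, homDeriv_zero]; simp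

theorem isInduced_d₁ (h : J₂.1 = ⊥) : IsInduced (d₁ Γ J₁ J₂) 0 (xA Γ J₁ J₂ σ₁ 0) 0 0 where
  compat := by rw [pd₁_xσ₁, map_zero]
  apply_pB v hv := by rw [d₁_pB h hv, opA_apply, homDeriv_zero]; simp

theorem isInduced_dBar₁ (h : J₁.1 = ⊥) : IsInduced (dBar₁ Γ J₁ J₂) (xA Γ J₁ J₂ σ₁ 0) 0 0 0 where
  compat := by rw [sd₂_apply, pd₂_xσ₁, sub_self, map_zero]
  apply_pB v hv := by rw [dBar₁_pB h hv, opA_apply, homDeriv_zero]; simp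

theorem isInduced_d₂ (h : J₁.1 = ⊥ ∧ J₂.1 = ⊥) : IsInduced (d₂ Γ J₁ J₂)
    (∂₁ (xA Γ J₁ J₂ σ₂ 0)) (𝔇 (xA Γ J₁ J₂ σ₂ 0)) 0 0 where
  compat := (pd₁_sd₂ _).symm
  apply_pB v hv := by
    rw [d₂_pB h hv, opA_apply, homDeriv_zero, br_eq]
    congr 1
    simp [mul_comm]

/-- All the standard derivations share one shape: `ad_u` has `P = ∂₁ u` and `Q = D u`, compatible
because `∂₁` and `D` commute, while `d₁` and `dBar₁` contribute `x^{σ₁}` to `Q` and `P`, where it is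
killed by `∂₁` and `D` respectively. Local finiteness can then be read off `P` and `Q`. -/
theorem exists_isInduced_stdDer (u : B Γ J₁ J₂) (μ : Γ →+ F) (f₁ f₂ f₃ f₄ : F) :
    ∃ P Q, IsInduced (stdDer u μ f₁ f₂ f₃ f₄) P Q μ f₄ := by
  have h₁ : ∃ P Q, IsInduced (d₁ Γ J₁ J₂) P Q 0 0 := by
    by_cases h : J₂.1 = ⊥
    · exact ⟨_, _, isInduced_d₁ h⟩
    · rw [d₁_eq_zero h]; exact ⟨_, _, isInduced_zero⟩
  have h₂ : ∃ P Q, IsInduced (dBar₁ Γ J₁ J₂) P Q 0 0 := by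
    by_cases h : J₁.1 = ⊥
    · exact ⟨_, _, isInduced_dBar₁ h⟩
    · rw [dBar₁_eq_zero h]; exact ⟨_, _, isInduced_zero⟩
  have h₃ : ∃ P Q, IsInduced (d₂ Γ J₁ J₂) P Q 0 0 := by
    by_cases h : J₁.1 = ⊥ ∧ J₂.1 = ⊥
    · exact ⟨_, _, isInduced_d₂ h⟩
    · rw [d₂_eq_zero h]; exact ⟨_, _, isInduced_zero⟩
  obtain ⟨P₁, Q₁, h₁⟩ := h₁
  obtain ⟨P₂, Q₂, h₂⟩ := h₂
  obtain ⟨P₃, Q₃, h₃⟩ := h₃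
  obtain ⟨u, hu, rfl⟩ := exists_pB u
  have := (((((isInduced_adB hu).add (isInduced_dHom μ)).add (h₁.smul f₁)).add
    (h₂.smul f₂)).add (h₃.smul f₃)).add (isInduced_dt₂.smul f₄)
  rw [show 0 + μ + f₁ • (0 : Γ →+ F) + f₂ • (0 : Γ →+ F) + f₃ • (0 : Γ →+ F) +
    f₄ • (0 : Γ →+ F) = μ by simp, show 0 + 0 + f₁ * 0 + f₂ * 0 + f₃ * 0 + f₄ * 1 = f₄ by simp] at this
  exact ⟨_, _, this⟩

/-! ### Homogeneous derivations -/

theorem mem_derGr {α : Γ} {d : Der Γ J₁ J₂} :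
    d ∈ derGr Γ J₁ J₂ α ↔ ∀ β : Γ, ∀ b ∈ gr Γ J₁ J₂ β, d b ∈ gr Γ J₁ J₂ (α + β : Γ) := Iff.rfl

theorem mem_derGr_of_pB {α : Γ} {d : Der Γ J₁ J₂}
    {T : SemigroupAlg Γ J₁ J₂ → SemigroupAlg Γ J₁ J₂}
    (hd : ∀ v ∈ dom Γ J₁ J₂, d (pB Γ J₁ J₂ v) = pB Γ J₁ J₂ (T v))
    (hT : ∀ β, ∀ v ∈ hA J₁ J₂ β, T v ∈ hA J₁ J₂ (α + β)) : d ∈ derGr Γ J₁ J₂ α := by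
  refine mem_derGr.2 fun β b hb => ?_
  rw [← pB_ιB b, hd _ (ιB_mem_dom b)]
  exact pB_mem_gr (hT β _ (ιB_mem_hA hb))

theorem adB_mem_derGr {α : Γ} {u : B Γ J₁ J₂} (hu : u ∈ gr Γ J₁ J₂ α) :
    adB u ∈ derGr Γ J₁ J₂ α := by
  refine mem_derGr_of_pB (T := br (ιB Γ J₁ J₂ u)) (fun v hv => ?_) (fun β v hv => ?_)
  · rw [← adB_pB (ιB_mem_dom u) hv, pB_ιB]
  · exact br_mem (ιB_mem_hA hu) hv

theorem dHom_mem_derGr (μ : Γ →+ F) : dHom Γ J₁ J₂ μ ∈ derGr Γ J₁ J₂ 0 :=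
  mem_derGr_of_pB (fun _ hv => dHom_pB μ hv) fun β v hv => by
    rw [homDeriv_of_mem μ hv, zero_add]; exact Submodule.smul_mem _ _ hv

theorem dt₂_mem_derGr : dt₂ Γ J₁ J₂ ∈ derGr Γ J₁ J₂ 0 :=
  mem_derGr_of_pB (fun _ hv => dt₂_pB hv) fun β v hv => by
    rw [zero_add]; exact tDeriv₂_mem hv

theorem xA_mem_hA (α : Γ) (i : ℕ × ℕ) : xA Γ J₁ J₂ α i ∈ hA J₁ J₂ α := by
  unfold xA
  split_ifs with h
  · exact single_mem_hA (Γ := Γ) (J₁ := J₁) (J₂ := J₂) (⟨α, h.1⟩, _, _) 1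
  · exact Submodule.zero_mem _

theorem d₁_mem_derGr {α : Γ} (hα : (α : F × F) = σ₁) : d₁ Γ J₁ J₂ ∈ derGr Γ J₁ J₂ α := by
  by_cases h : J₂.1 = ⊥
  · refine mem_derGr_of_pB (fun _ hv => d₁_pB h hv) fun β v hv => ?_
    rw [← hα]
    exact Submodule.neg_mem _ (mul_mem_hA (xA_mem_hA α 0) (pd₁_mem hv))
  · rw [d₁_eq_zero h]; exact Submodule.zero_mem _

theorem dBar₁_mem_derGr {α : Γ} (hα : (α : F × F) = σ₁) : dBar₁ Γ J₁ J₂ ∈ derGr Γ J₁ J₂ α := by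
  by_cases h : J₁.1 = ⊥
  · refine mem_derGr_of_pB (fun _ hv => dBar₁_pB h hv) fun β v hv => ?_
    rw [← hα]
    exact mul_mem_hA (xA_mem_hA α 0) (sd₂_mem hv)
  · rw [dBar₁_eq_zero h]; exact Submodule.zero_mem _

theorem d₂_mem_derGr {α : Γ} (hα : (α : F × F) = σ₂) : d₂ Γ J₁ J₂ ∈ derGr Γ J₁ J₂ α := by
  by_cases h : J₁.1 = ⊥ ∧ J₂.1 = ⊥
  · refine mem_derGr_of_pB (fun _ hv => d₂_pB h hv) fun β v hv => ?_
    rw [← hα]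
    exact br_mem (xA_mem_hA α 0) hv
  · rw [d₂_eq_zero h]; exact Submodule.zero_mem _

theorem stdDer_mem_derGr {α : Γ} {u : B Γ J₁ J₂} (hu : u ∈ gr Γ J₁ J₂ α) {μ : Γ →+ F}
    {f₁ f₂ f₃ f₄ : F} (h0 : α ≠ 0 → μ = 0 ∧ f₄ = 0)
    (h1 : (α : F × F) ≠ σ₁ → f₁ = 0 ∧ f₂ = 0) (h2 : (α : F × F) ≠ σ₂ → f₃ = 0) :
    stdDer u μ f₁ f₂ f₃ f₄ ∈ derGr Γ J₁ J₂ α := by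
  have hμ : dHom Γ J₁ J₂ μ ∈ derGr Γ J₁ J₂ α := by
    by_cases h : α = 0
    · rw [h]; exact dHom_mem_derGr μ
    · rw [(h0 h).1]
      refine mem_derGr_of_pB (fun _ hv => dHom_pB 0 hv) fun β v hv => ?_
      rw [homDeriv_zero]; exact Submodule.zero_mem _
  have hf₄ : f₄ • dt₂ Γ J₁ J₂ ∈ derGr Γ J₁ J₂ α := by
    by_cases h : α = 0
    · rw [h]; exact Submodule.smul_mem _ _ dt₂_mem_derGr
    · rw [(h0 h).2, zero_smul]; exact Submodule.zero_mem _
  have hf₁ : f₁ • d₁ Γ J₁ J₂ ∈ derGr Γ J₁ J₂ α := by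
    by_cases h : (α : F × F) = σ₁
    · exact Submodule.smul_mem _ _ (d₁_mem_derGr h)
    · rw [(h1 h).1, zero_smul]; exact Submodule.zero_mem _
  have hf₂ : f₂ • dBar₁ Γ J₁ J₂ ∈ derGr Γ J₁ J₂ α := by
    by_cases h : (α : F × F) = σ₁
    · exact Submodule.smul_mem _ _ (dBar₁_mem_derGr h)
    · rw [(h1 h).2, zero_smul]; exact Submodule.zero_mem _
  have hf₃ : f₃ • d₂ Γ J₁ J₂ ∈ derGr Γ J₁ J₂ α := by
    by_cases h : (α : F × F) = σ₂
    · exact Submodule.smul_mem _ _ (d₂_mem_derGr h)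
    · rw [h2 h, zero_smul]; exact Submodule.zero_mem _
  exact Submodule.add_mem _ (Submodule.add_mem _ (Submodule.add_mem _ (Submodule.add_mem _
    (Submodule.add_mem _ (adB_mem_derGr hu) hμ) hf₁) hf₂) hf₃) hf₄

/-! ### Generalized eigenspaces on `B` -/

theorem pB_mem_maxGenEigenspace {f : Module.End F (B Γ J₁ J₂)}
    {O : Module.End F (SemigroupAlg Γ J₁ J₂)} (hO : ∀ v ∈ dom Γ J₁ J₂, O v ∈ dom Γ J₁ J₂)
    (h : ∀ v ∈ dom Γ J₁ J₂, f (pB Γ J₁ J₂ v) = pB Γ J₁ J₂ (O v)) {c : F}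
    {v : SemigroupAlg Γ J₁ J₂} (hv : v ∈ dom Γ J₁ J₂) (hv' : v ∈ O.maxGenEigenspace c) :
    pB Γ J₁ J₂ v ∈ f.maxGenEigenspace c := by
  rw [Module.End.mem_maxGenEigenspace] at hv' ⊢
  obtain ⟨k, hk⟩ := hv'
  refine ⟨k, ?_⟩
  have : ∀ n : ℕ, ((O - c • (1 : Module.End F (SemigroupAlg Γ J₁ J₂))) ^ n) v ∈ dom Γ J₁ J₂ ∧
      ((f - c • (1 : Module.End F (B Γ J₁ J₂))) ^ n) (pB Γ J₁ J₂ v) =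
        pB Γ J₁ J₂ (((O - c • (1 : Module.End F (SemigroupAlg Γ J₁ J₂))) ^ n) v) := by
    intro n
    induction n with
    | zero => simpa using hv
    | succ n ih =>
      rw [pow_succ', pow_succ', Module.End.mul_apply, Module.End.mul_apply, ih.2]
      refine ⟨Submodule.sub_mem _ (hO _ ih.1) (Submodule.smul_mem _ _ ih.1), ?_⟩
      simp [h _ ih.1]
  rw [(this k).2, hk, map_zero]

theorem br_one (v : SemigroupAlg Γ J₁ J₂) : br 1 v = ∂₁ v := by
  rw [br_eq, sd₂_one]; simp

theorem adB_one_pB {v : SemigroupAlg Γ J₁ J₂} (hv : v ∈ dom Γ J₁ J₂) :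
    adB (pB Γ J₁ J₂ 1) (pB Γ J₁ J₂ v) = pB Γ J₁ J₂ (∂₁ v) := by
  rw [adB_pB one_mem_dom hv, br_one]

theorem gr_le_maxGenEigenspace_adB_one {β : Γ} {b : B Γ J₁ J₂} (hb : b ∈ gr Γ J₁ J₂ β) :
    b ∈ Module.End.maxGenEigenspace (adB (pB Γ J₁ J₂ 1)).toLinearMap (β : F × F).1 := by
  rw [← pB_ιB b]
  refine pB_mem_maxGenEigenspace (O := (pd₁ Γ J₁ J₂).toLinearMap) ?_ ?_ (ιB_mem_dom b)
    (hA_le_maxGenEigenspace_pd₁ (ιB_mem_hA hb))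
  · intro v _
    rw [Derivation.coeFn_coe, ← br_one]
    exact br_mem_dom _ _
  · exact fun v hv => adB_one_pB hv

theorem commute_adB {d : Der Γ J₁ J₂} {x : B Γ J₁ J₂} (h : d x = 0) :
    Commute (adB x).toLinearMap d.toLinearMap := by
  refine LinearMap.ext fun y => ?_
  rw [Module.End.mul_apply, Module.End.mul_apply, LieDerivation.coeFn_coe, LieDerivation.coeFn_coe,
    LieDerivation.ad_apply_apply, LieDerivation.ad_apply_apply, d.apply_lie_eq_add, h, zero_lie, add_zero]

/-- A homogeneous derivation which commutes with an operator and changes its generalized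
eigenvalues is zero. -/
theorem eq_zero_of_commute {α : Γ} {d : Der Γ J₁ J₂} (hd : d ∈ derGr Γ J₁ J₂ α)
    {f : Module.End F (B Γ J₁ J₂)} (hf : Commute f d.toLinearMap) {c : Γ → F}
    (hc : ∀ β : Γ, ∀ b ∈ gr Γ J₁ J₂ β, b ∈ f.maxGenEigenspace (c β)) (hne : ∀ β, c β ≠ c (α + β)) :
    d = 0 := by
  refine LieDerivation.ext fun b => ?_
  refine span_gr (LinearMap.ker d.toLinearMap) (fun β b hb => ?_) b
  exact eq_zero_of_mem_maxGenEigenspace (hne β)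
    (Module.End.mapsTo_maxGenEigenspace_of_comm hf (c β) (hc β b hb)) (hc _ _ (hd β b hb))

/-- There is an inner derivation which agrees with `d` at `1` if `∂₁` is onto `A_α`. -/
theorem exists_adB_one_eq {α : Γ} (h : (α : F × F).1 ≠ 0 ∨ J₁.1 = ⊤) {d : Der Γ J₁ J₂}
    (hd : d ∈ derGr Γ J₁ J₂ α) : ∃ u ∈ gr Γ J₁ J₂ α, (d - adB u) (pB Γ J₁ J₂ 1) = 0 := by
  have h1 := hd 0 _ (pB_mem_gr one_mem_hA)
  rw [← AddSubgroup.coe_add, add_zero] at h1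
  obtain ⟨u, hu, hu'⟩ := exists_pd₁_eq h (ιB_mem_hA h1)
  have hdom : u ∈ dom Γ J₁ J₂ := by
    rcases h with h | h
    · exact hA_le_dom_of_fst h hu
    · rw [dom_eq_top fun hs => by
        have := h.symm.trans hs.1
        exact absurd this top_ne_bot]
      trivial
  refine ⟨pB Γ J₁ J₂ (-u), pB_mem_gr (Submodule.neg_mem _ hu), ?_⟩
  have e : br (-u) 1 = ∂₁ u := by rw [br_comm, br_one, map_neg, neg_neg]
  rw [LieDerivation.sub_apply, adB_pB (Submodule.neg_mem _ hdom) one_mem_dom, e, hu', pB_ιB,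
    sub_self]

/-- Once the value at `1` is killed, the difference commutes with `ad 1`, whose generalized
eigenvalue on degree `β` is `β₁`; a map of degree `α` would change it by `α₁ ≠ 0`. -/
theorem exists_eq_adB_of_fst_ne_zero {α : Γ} (h : (α : F × F).1 ≠ 0) {d : Der Γ J₁ J₂}
    (hd : d ∈ derGr Γ J₁ J₂ α) : ∃ u ∈ gr Γ J₁ J₂ α, d = adB u := by
  obtain ⟨u, hu, h1⟩ := exists_adB_one_eq (Or.inl h) hd
  refine ⟨u, hu, sub_eq_zero.1 ?_⟩
  refine eq_zero_of_commute (Submodule.sub_mem _ hd (adB_mem_derGr hu)) (commute_adB h1)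
    (fun β b hb => gr_le_maxGenEigenspace_adB_one hb) fun β h' => h ?_
  simpa using h'

/-! ### The homogeneous components of a derivation -/

/-- The projection of `B` to the homogeneous component of degree `α`. -/
def compB (J₁ J₂ : ExpMonoid) [Nondegenerate Γ J₁ J₂] (α : Γ) : B Γ J₁ J₂ →ₗ[F] B Γ J₁ J₂ :=
  pB Γ J₁ J₂ ∘ₗ compA J₁ J₂ α ∘ₗ ιB Γ J₁ J₂

theorem compB_apply (α : Γ) (b : B Γ J₁ J₂) :
    compB J₁ J₂ α b = pB Γ J₁ J₂ (compA J₁ J₂ α (ιB Γ J₁ J₂ b)) := rfl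

theorem compB_mem (α : Γ) (b : B Γ J₁ J₂) : compB J₁ J₂ α b ∈ gr Γ J₁ J₂ α :=
  pB_mem_gr (compA_mem _ _)

theorem compB_of_mem {α : Γ} {b : B Γ J₁ J₂} (hb : b ∈ gr Γ J₁ J₂ α) : compB J₁ J₂ α b = b := by
  rw [compB_apply, compA_of_mem (ιB_mem_hA hb), pB_ιB]

theorem compB_of_mem_ne {α β : Γ} (h : β ≠ α) {b : B Γ J₁ J₂} (hb : b ∈ gr Γ J₁ J₂ β) :
    compB J₁ J₂ α b = 0 := by
  rw [compB_apply, compA_of_mem_ne h (ιB_mem_hA hb), map_zero]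

theorem eq_sum_compB (b : B Γ J₁ J₂) :
    ∃ s : Finset Γ, (∀ α ∉ s, compB J₁ J₂ α b = 0) ∧ b = ∑ α ∈ s, compB J₁ J₂ α b := by
  obtain ⟨s, hs, e⟩ := eq_sum_compA (ιB Γ J₁ J₂ b)
  refine ⟨s, fun α hα => by rw [compB_apply, hs α hα, map_zero], ?_⟩
  conv_lhs => rw [← pB_ιB b, e, map_sum]
  rfl

theorem ext_compB {a b : B Γ J₁ J₂} (h : ∀ α, compB J₁ J₂ α a = compB J₁ J₂ α b) : a = b := by
  rw [← sub_eq_zero]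
  obtain ⟨s, -, e⟩ := eq_sum_compB (a - b)
  rw [e]
  exact Finset.sum_eq_zero fun α _ => by rw [map_sub, h, sub_self]

theorem lie_mem_gr {β γ : Γ} {u w : B Γ J₁ J₂} (hu : u ∈ gr Γ J₁ J₂ β) (hw : w ∈ gr Γ J₁ J₂ γ) :
    ⁅u, w⁆ ∈ gr Γ J₁ J₂ (β + γ : Γ) := by
  rw [← LieDerivation.ad_apply_apply F]
  exact mem_derGr.1 (adB_mem_derGr hu) γ w hw

theorem compB_lie {β : Γ} (γ : Γ) {u : B Γ J₁ J₂} (hu : u ∈ gr Γ J₁ J₂ β) (w : B Γ J₁ J₂) :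
    compB J₁ J₂ (β + γ) ⁅u, w⁆ = ⁅u, compB J₁ J₂ γ w⁆ := by
  have := span_gr (LinearMap.ker (compB J₁ J₂ (β + γ) ∘ₗ (adB u).toLinearMap -
    (adB u).toLinearMap ∘ₗ compB J₁ J₂ γ)) (fun δ w hw => ?_) w
  · simpa [sub_eq_zero] using this
  · suffices compB J₁ J₂ (β + γ) ⁅u, w⁆ = ⁅u, compB J₁ J₂ γ w⁆ by simpa [sub_eq_zero] using this
    by_cases h : δ = γ
    · subst h
      rw [compB_of_mem hw, compB_of_mem (lie_mem_gr hu hw)]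
    · rw [compB_of_mem_ne h hw, lie_zero, compB_of_mem_ne _ (lie_mem_gr hu hw)]
      simpa using h

/-- The homogeneous component of degree `α` of a linear endomorphism of `B`. -/
def compEnd (α : Γ) (d : B Γ J₁ J₂ →ₗ[F] B Γ J₁ J₂) : B Γ J₁ J₂ →ₗ[F] B Γ J₁ J₂ :=
  (Finsupp.linearCombination F fun m : Γ × J₁.1 × J₂.1 =>
    compB J₁ J₂ (α + m.1) (d (pB Γ J₁ J₂ (single m 1)))) ∘ₗ
      (AddMonoidAlgebra.coeffLinearEquiv F).toLinearMap ∘ₗ ιB Γ J₁ J₂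

theorem compEnd_of_mem (α : Γ) (d : B Γ J₁ J₂ →ₗ[F] B Γ J₁ J₂) {β : Γ} {b : B Γ J₁ J₂}
    (hb : b ∈ gr Γ J₁ J₂ β) : compEnd α d b = compB J₁ J₂ (α + β) (d b) := by
  have key := hA_induction (LinearMap.ker ((Finsupp.linearCombination F
    fun m : Γ × J₁.1 × J₂.1 => compB J₁ J₂ (α + m.1) (d (pB Γ J₁ J₂ (single m 1)))) ∘ₗ
      (AddMonoidAlgebra.coeffLinearEquiv F).toLinearMap -
        compB J₁ J₂ (α + β) ∘ₗ d ∘ₗ pB Γ J₁ J₂)) (fun i j hi hj => ?_) (ιB_mem_hA hb)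
  · rw [LinearMap.mem_ker, LinearMap.sub_apply, sub_eq_zero, LinearMap.comp_apply,
      LinearMap.comp_apply, LinearMap.comp_apply, pB_ιB] at key
    exact key
  · rw [ex_t_eq_single β ⟨i, hi⟩ ⟨j, hj⟩]
    simp [AddMonoidAlgebra.coeffLinearEquiv]

/-- The homogeneous component of degree `α` of a derivation. -/
def compDer (α : Γ) : Der Γ J₁ J₂ →ₗ[F] Der Γ J₁ J₂ where
  toFun d :=
    { toLinearMap := compEnd α d.toLinearMap
      leibniz' := fun a b => by
        have key : ∀ β γ : Γ, ∀ a ∈ gr Γ J₁ J₂ β, ∀ b ∈ gr Γ J₁ J₂ γ,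
            compEnd α d.toLinearMap ⁅a, b⁆ =
              ⁅a, compEnd α d.toLinearMap b⁆ - ⁅b, compEnd α d.toLinearMap a⁆ := by
          intro β γ a ha b hb
          rw [compEnd_of_mem α _ (lie_mem_gr ha hb), compEnd_of_mem α _ hb,
            compEnd_of_mem α _ ha, LieDerivation.coeFn_coe, d.apply_lie_eq_sub, map_sub,
            ← compB_lie _ ha, ← compB_lie _ hb, add_left_comm β α γ, add_left_comm γ α β,
            add_comm γ β]
        -- The Leibniz rule is known on pairs of homogeneous elements. It is extended linearly in
        -- one argument at a time, writing the rule as the vanishing of a linear map in that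
        -- argument.
        have h1 : ∀ γ : Γ, ∀ b ∈ gr Γ J₁ J₂ γ, ∀ a, compEnd α d.toLinearMap ⁅a, b⁆ =
              ⁅a, compEnd α d.toLinearMap b⁆ - ⁅b, compEnd α d.toLinearMap a⁆ := by
          intro γ b hb a
          have := span_gr (LinearMap.ker (compEnd α d.toLinearMap ∘ₗ (-(adB b).toLinearMap) +
            (adB (compEnd α d.toLinearMap b)).toLinearMap +
              (adB b).toLinearMap ∘ₗ compEnd α d.toLinearMap)) (fun β a ha => ?_) a
          · simp only [LinearMap.mem_ker, LinearMap.add_apply, LinearMap.comp_apply,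
              LinearMap.neg_apply, LieDerivation.coeFn_coe, LieDerivation.ad_apply_apply] at this
            rw [← lie_skew a b, ← lie_skew a (compEnd α d.toLinearMap b),
              ← sub_eq_zero, ← this]
            abel
          · simp only [LinearMap.mem_ker, LinearMap.add_apply, LinearMap.comp_apply,
              LinearMap.neg_apply, LieDerivation.coeFn_coe, LieDerivation.ad_apply_apply]
            rw [lie_skew a b, key β γ a ha b hb, ← lie_skew a (compEnd α d.toLinearMap b)]
            abel
        have := span_gr (LinearMap.ker (compEnd α d.toLinearMap ∘ₗ (adB a).toLinearMap -
            (adB a).toLinearMap ∘ₗ compEnd α d.toLinearMap -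
              (adB (compEnd α d.toLinearMap a)).toLinearMap)) (fun β b hb => ?_) b
        · simp only [LinearMap.mem_ker, LinearMap.sub_apply, LinearMap.comp_apply,
            LieDerivation.coeFn_coe, LieDerivation.ad_apply_apply] at this
          change compEnd α d.toLinearMap ⁅a, b⁆ = _
          rw [← lie_skew b (compEnd α d.toLinearMap a), ← sub_eq_zero, ← this]
          abel
        · simp only [LinearMap.mem_ker, LinearMap.sub_apply, LinearMap.comp_apply,
            LieDerivation.coeFn_coe, LieDerivation.ad_apply_apply]
          rw [h1 β b hb a, ← lie_skew b (compEnd α d.toLinearMap a)]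
          abel }
  map_add' d e := LieDerivation.ext fun b => by
    refine ext_compB fun δ => ?_
    have := span_gr (LinearMap.ker (compEnd α (d + e).toLinearMap - compEnd α d.toLinearMap -
      compEnd α e.toLinearMap)) (fun β b hb => ?_) b
    · change compB J₁ J₂ δ (compEnd α (d + e).toLinearMap b) =
        compB J₁ J₂ δ (compEnd α d.toLinearMap b + compEnd α e.toLinearMap b)
      rw [LinearMap.mem_ker, LinearMap.sub_apply, LinearMap.sub_apply, sub_sub, sub_eq_zero] at this
      rw [this]
    · rw [LinearMap.mem_ker, LinearMap.sub_apply, LinearMap.sub_apply, sub_sub, sub_eq_zero,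
        compEnd_of_mem α _ hb, compEnd_of_mem α _ hb, compEnd_of_mem α _ hb, ← map_add]
      rfl
  map_smul' c d := LieDerivation.ext fun b => by
    have := span_gr (LinearMap.ker (compEnd α (c • d).toLinearMap - c • compEnd α d.toLinearMap))
      (fun β b hb => ?_) b
    · rw [LinearMap.mem_ker, LinearMap.sub_apply, sub_eq_zero] at this
      exact this
    · rw [LinearMap.mem_ker, LinearMap.sub_apply, sub_eq_zero, LinearMap.smul_apply,
        compEnd_of_mem α _ hb, compEnd_of_mem α _ hb, ← map_smul]
      rfl

theorem compDer_apply_of_mem (α : Γ) (d : Der Γ J₁ J₂) {β : Γ} {b : B Γ J₁ J₂}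
    (hb : b ∈ gr Γ J₁ J₂ β) : compDer α d b = compB J₁ J₂ (α + β) (d b) :=
  compEnd_of_mem α d.toLinearMap hb

theorem compDer_mem (α : Γ) (d : Der Γ J₁ J₂) : compDer α d ∈ derGr Γ J₁ J₂ α :=
  mem_derGr.2 fun β b hb => by
    rw [compDer_apply_of_mem α d hb]; exact compB_mem _ _

theorem LieDerivation_ext_gr {d e : Der Γ J₁ J₂}
    (h : ∀ β : Γ, ∀ b ∈ gr Γ J₁ J₂ β, d b = e b) : d = e :=
  LieDerivation.ext fun b => by
    have := span_gr (LinearMap.ker (d.toLinearMap - e.toLinearMap)) (fun β b hb => by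
      simp [h β b hb]) b
    simpa [sub_eq_zero] using this

theorem compDer_of_mem {α : Γ} {d : Der Γ J₁ J₂} (hd : d ∈ derGr Γ J₁ J₂ α) : compDer α d = d :=
  LieDerivation_ext_gr fun β b hb => by
    rw [compDer_apply_of_mem α d hb, compB_of_mem (mem_derGr.1 hd β b hb)]

theorem compDer_of_mem_ne {α γ : Γ} (h : γ ≠ α) {d : Der Γ J₁ J₂} (hd : d ∈ derGr Γ J₁ J₂ γ) :
    compDer α d = 0 :=
  LieDerivation_ext_gr fun β b hb => by
    rw [compDer_apply_of_mem α d hb, compB_of_mem_ne _ (mem_derGr.1 hd β b hb)]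
    · rfl
    · simpa using h

theorem iSupIndep_derGr : iSupIndep (derGr Γ J₁ J₂) := by
  refine iSupIndep_def.2 fun α => Submodule.disjoint_def.2 fun d hd hd' => ?_
  have : (⨆ γ, ⨆ (_ : γ ≠ α), derGr Γ J₁ J₂ γ) ≤ LinearMap.ker (compDer α) :=
    iSup₂_le fun γ hγ e he => compDer_of_mem_ne hγ he
  rw [← compDer_of_mem hd]
  exact this hd'

/-- A derivation is the sum of its components if almost all of them vanish. -/
theorem eq_sum_compDer {d : Der Γ J₁ J₂} {s : Finset Γ} (hs : ∀ α ∉ s, compDer α d = 0) :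
    d = ∑ α ∈ s, compDer α d := by
  classical
  refine LieDerivation_ext_gr fun β b hb => ext_compB fun δ => ?_
  have e : (∑ α ∈ s, compDer α d) b = ∑ α ∈ s, compB J₁ J₂ (α + β) (d b) := by
    rw [← Finset.sum_congr rfl fun α _ => compDer_apply_of_mem α d hb]
    exact map_sum (⟨⟨fun d : Der Γ J₁ J₂ => d b, rfl⟩, fun _ _ => rfl⟩ : Der Γ J₁ J₂ →+ _) _ _
  rw [e, map_sum]
  by_cases h : δ - β ∈ s
  · rw [Finset.sum_eq_single_of_mem _ h, sub_add_cancel, compB_of_mem (compB_mem _ _)]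
    intro α _ hα
    exact compB_of_mem_ne (fun h' => hα (eq_sub_of_add_eq h')) (compB_mem _ _)
  · rw [Finset.sum_eq_zero]
    · have := compDer_apply_of_mem (δ - β) d hb
      rw [hs _ h, sub_add_cancel] at this
      exact this.symm
    · intro α hα
      exact compB_of_mem_ne (fun h' => h (eq_sub_of_add_eq h' ▸ hα)) (compB_mem _ _)

/-- `Der B` is the direct sum of its homogeneous components if, for almost all `α`, those of
degree `α` are determined by their values at two homogeneous elements. -/
theorem exists_compDer_eq_zero (s : Finset Γ) {β γ : Γ} {x y : B Γ J₁ J₂}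
    (hx : x ∈ gr Γ J₁ J₂ β) (hy : y ∈ gr Γ J₁ J₂ γ)
    (h : ∀ α ∉ s, ∀ d ∈ derGr Γ J₁ J₂ α, d x = 0 → d y = 0 → d = 0) (d : Der Γ J₁ J₂) :
    ∃ t : Finset Γ, ∀ α ∉ t, compDer α d = 0 := by
  classical
  obtain ⟨s₁, h₁, -⟩ := eq_sum_compB (d x)
  obtain ⟨s₂, h₂, -⟩ := eq_sum_compB (d y)
  -- The excluded degrees are those in `s` and those `α` for which `α + β` meets the finite support
  -- of `d x`, or `α + γ` that of `d y`. For every other `α` the component of degree `α` kills both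
  -- test elements.
  refine ⟨s ∪ s₁.image (· - β) ∪ s₂.image (· - γ), fun α hα => ?_⟩
  simp only [Finset.mem_union, Finset.mem_image, not_or, not_exists, not_and] at hα
  refine h α hα.1.1 _ (compDer_mem α d) ?_ ?_
  · rw [compDer_apply_of_mem α d hx]
    exact h₁ _ fun hm => hα.1.2 _ hm (add_sub_cancel_right α β)
  · rw [compDer_apply_of_mem α d hy]
    exact h₂ _ fun hm => hα.2 _ hm (add_sub_cancel_right α γ)

theorem isInternal_derGr [DecidableEq Γ]
    (h : ∀ d : Der Γ J₁ J₂, ∃ t : Finset Γ, ∀ α ∉ t, compDer α d = 0) :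
    DirectSum.IsInternal (derGr Γ J₁ J₂) := by
  rw [DirectSum.isInternal_submodule_iff_iSupIndep_and_iSup_eq_top]
  refine ⟨iSupIndep_derGr, eq_top_iff.2 fun d _ => ?_⟩
  obtain ⟨t, ht⟩ := h d
  rw [eq_sum_compDer ht]
  exact Submodule.sum_mem _ fun α _ => Submodule.mem_iSup_of_mem α (compDer_mem α d)

/-! ### Derivations of degree `(0, a)` in the case `J₁ = ℕ` -/

theorem mem_dom_of_top (hJ : J₁.1 = ⊤) (v : SemigroupAlg Γ J₁ J₂) : v ∈ dom Γ J₁ J₂ := by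
  rw [dom_eq_top fun hs => absurd (hJ.symm.trans hs.1) top_ne_bot]
  trivial

theorem lie_pB (hJ : J₁.1 = ⊤) (u v : SemigroupAlg Γ J₁ J₂) :
    ⁅pB Γ J₁ J₂ u, pB Γ J₁ J₂ v⁆ = pB Γ J₁ J₂ (br u v) :=
  pB_lie (mem_dom_of_top hJ u) (mem_dom_of_top hJ v)

theorem adB_add (u v : B Γ J₁ J₂) : adB (u + v) = adB u + adB v :=
  map_add (LieDerivation.ad F (B Γ J₁ J₂)) u v

theorem adB_sub (u v : B Γ J₁ J₂) : adB (u - v) = adB u - adB v :=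
  map_sub (LieDerivation.ad F (B Γ J₁ J₂)) u v

theorem adB_smul (c : F) (u : B Γ J₁ J₂) : adB (c • u) = c • adB u :=
  map_smul (LieDerivation.ad F (B Γ J₁ J₂)) c u

theorem adB_zero : adB (0 : B Γ J₁ J₂) = 0 :=
  map_zero (LieDerivation.ad F (B Γ J₁ J₂))

theorem apply_lie_of_eq_zero {d : Der Γ J₁ J₂} {x : B Γ J₁ J₂} (h : d x = 0) (y : B Γ J₁ J₂) :
    d ⁅x, y⁆ = ⁅x, d y⁆ := by
  rw [d.apply_lie_eq_add, h, zero_lie, add_zero]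

/-- The kernel of `pB` on `dom` is the line of `x^{σ₁}`, which is concentrated in degree `σ₁`. Thus
identities in `B` lift exactly in every other degree. -/
theorem eq_zero_of_pB_eq_zero {β : Γ} (hβ : (β : F × F) ≠ σ₁) {v : SemigroupAlg Γ J₁ J₂}
    (hd : v ∈ dom Γ J₁ J₂) (hv : v ∈ hA J₁ J₂ β) (h : pB Γ J₁ J₂ v = 0) : v = 0 := by
  obtain ⟨c, rfl⟩ := (pB_eq_zero_iff hd).1 h
  by_cases hσ : σ₁ ∈ Γ
  · refine eq_zero_of_mem_hA (α := ⟨σ₁, hσ⟩) (fun h => hβ (congrArg Subtype.val h)) hv ?_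
    exact Submodule.smul_mem _ _ (xA_mem_hA ⟨σ₁, hσ⟩ 0)
  · rw [xA_σ₁_eq_zero hσ, smul_zero]

theorem br_t₁ (hJ : J₁.1 = ⊤) (v : SemigroupAlg Γ J₁ J₂) : br t₁ v = 𝔇 v + t₁ * ∂₁ v := by
  rw [br_eq, pd₁_t₁ hJ, sd₂_t₁]; ring

theorem br_ex_of_fst {δ : Γ} (h : (δ : F × F).1 = 0) (v : SemigroupAlg Γ J₁ J₂) :
    br (ex δ) v = (1 - (δ : F × F).2) • (ex δ * ∂₁ v) := by
  rw [br_eq, pd₁_ex, sd₂_ex, h]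
  simp only [Algebra.smul_def, map_sub, map_zero, map_one]
  ring

theorem sd₂_xσ₁ : 𝔇 (xA Γ J₁ J₂ σ₁ 0) = 0 := by
  rw [sd₂_apply, pd₂_xσ₁, sub_self]

/-- The operator induced by `∂₂ - 1` on `B`. -/
def sdB (Γ : AddSubgroup (F × F)) (J₁ J₂ : ExpMonoid) [Nondegenerate Γ J₁ J₂] :
    Module.End F (B Γ J₁ J₂) :=
  pB Γ J₁ J₂ ∘ₗ sd₂ Γ J₁ J₂ ∘ₗ ιB Γ J₁ J₂

/-- `D` descends to `B` because it kills `x^{σ₁}`, and there is no special case when `J₁ = ℕ`. It is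
not a derivation of `B`; it only serves as an operator with computable generalized eigenvalues. -/
theorem sdB_pB (hJ : J₁.1 = ⊤) (v : SemigroupAlg Γ J₁ J₂) :
    sdB Γ J₁ J₂ (pB Γ J₁ J₂ v) = pB Γ J₁ J₂ (𝔇 v) := by
  obtain ⟨c, hc⟩ := eq_live_add (mem_dom_of_top hJ v)
  conv_rhs => rw [hc, map_add, map_smul, sd₂_xσ₁, smul_zero, add_zero]
  rw [sdB, LinearMap.comp_apply, LinearMap.comp_apply, ιB_pB]

theorem gr_le_maxGenEigenspace_sdB (hJ : J₁.1 = ⊤) {β : Γ} {b : B Γ J₁ J₂}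
    (hb : b ∈ gr Γ J₁ J₂ β) : b ∈ (sdB Γ J₁ J₂).maxGenEigenspace ((β : F × F).2 - 1) := by
  rw [← pB_ιB b]
  refine pB_mem_maxGenEigenspace (O := sd₂ Γ J₁ J₂) (fun v _ => mem_dom_of_top hJ _)
    (fun v _ => sdB_pB hJ v) (ιB_mem_dom b) ?_
  have := hA_le_maxGenEigenspace_pd₂ (ιB_mem_hA hb)
  rw [Module.End.mem_maxGenEigenspace] at this ⊢
  obtain ⟨k, hk⟩ := this
  refine ⟨k, ?_⟩
  have e : (sd₂ Γ J₁ J₂ - ((β : F × F).2 - 1) • (1 : Module.End F (SemigroupAlg Γ J₁ J₂))) =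
      (pd₂ Γ J₁ J₂).toLinearMap - (β : F × F).2 • (1 : Module.End F (SemigroupAlg Γ J₁ J₂)) := by
    refine LinearMap.ext fun v => ?_
    simp only [LinearMap.sub_apply, LinearMap.smul_apply, Module.End.one_apply, sd₂_apply,
      Derivation.coeFn_coe, sub_smul, one_smul]
    abel
  rw [e, hk]

/-- Since `d(1) = 0`, `d` commutes with `∂₁ = ad 1`. For `v = ∂₁ w` this gives `D d v = ∂₁ D d w = d
∂₁ D w = d D v`, and every `v` has this form because `∂₁` is onto when `J₁ = ℕ`. -/
theorem commute_sdB (hJ : J₁.1 = ⊤) {d : Der Γ J₁ J₂} (h1 : d (pB Γ J₁ J₂ 1) = 0)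
    (h : Commute ((adB (pB Γ J₁ J₂ 1)).toLinearMap * sdB Γ J₁ J₂) d.toLinearMap) :
    Commute (sdB Γ J₁ J₂) d.toLinearMap := by
  refine LinearMap.ext fun b => ?_
  obtain ⟨v, -, rfl⟩ := exists_pB b
  obtain ⟨w, rfl⟩ : ∃ w, ∂₁ w = v := by
    have := span_hA (LinearMap.range (pd₁ Γ J₁ J₂).toLinearMap) (fun α v hv => by
      obtain ⟨u, -, hu⟩ := exists_pd₁_eq (Or.inr hJ) hv
      exact ⟨u, hu⟩) v
    exact this
  have key := LinearMap.congr_fun h (pB Γ J₁ J₂ w)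
  simp only [Module.End.mul_apply, LieDerivation.coeFn_coe] at key ⊢
  have hd := mem_dom_of_top (Γ := Γ) (J₂ := J₂) hJ
  have h2 : ∀ b, adB (pB Γ J₁ J₂ 1) (sdB Γ J₁ J₂ b) = sdB Γ J₁ J₂ (adB (pB Γ J₁ J₂ 1) b) := by
    intro b
    obtain ⟨v, hv, rfl⟩ := exists_pB b
    rw [sdB_pB hJ, adB_one_pB (hd _), adB_one_pB (hd _), sdB_pB hJ, pd₁_sd₂]
  have h3 : ∀ b, d (adB (pB Γ J₁ J₂ 1) b) = adB (pB Γ J₁ J₂ 1) (d b) := fun b => by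
    rw [LieDerivation.ad_apply_apply, LieDerivation.ad_apply_apply, apply_lie_of_eq_zero h1]
  rw [← adB_one_pB (hd _), h3, ← h2, key, h2]

theorem t₁_mul_eq_zero (hJ : J₁.1 = ⊤) {v : SemigroupAlg Γ J₁ J₂} (h : t₁ * v = 0) : v = 0 := by
  refine AddMonoidAlgebra.coeff_injective (Finsupp.ext fun m => ?_)
  have := congrArg (fun z => z.coeff ((0, ⟨1, by simp [hJ]⟩, 0) + m)) h
  simp only [t₁_eq hJ] at this
  rw [AddMonoidAlgebra.coeff_single_mul_add, one_mul] at this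
  exact this

/-- Normalization of a derivation of degree `(0, a)` on `1`, `t₁` and `t₁ ^ 2`. -/
theorem exists_normalized_of_top (hJ : J₁.1 = ⊤) {α : Γ} (hα : (α : F × F).1 = 0)
    {d : Der Γ J₁ J₂} (hd : d ∈ derGr Γ J₁ J₂ α) :
    ∃ u ∈ gr Γ J₁ J₂ α, ∃ f : F, ((α : F × F) ≠ σ₁ → f = 0) ∧
      ∃ e ∈ derGr Γ J₁ J₂ α, d = adB u + f • d₁ Γ J₁ J₂ + e ∧ e (pB Γ J₁ J₂ 1) = 0 ∧
        e (pB Γ J₁ J₂ t₁) = 0 ∧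
          ∃ y ∈ hA J₁ J₂ α, e (pB Γ J₁ J₂ (t₁ ^ 2)) = pB Γ J₁ J₂ y ∧ ∂₁ y = 0 := by
  have hdom := mem_dom_of_top (Γ := Γ) (J₂ := J₂) hJ
  -- Applying `e` to `[1, t₁^n] = n t₁^{n-1}` shows that the value at `t₁^n` is determined up to the
  -- kernel of `∂₁` by the value at `t₁^{n-1}`.
  have hp : ∀ {e : Der Γ J₁ J₂}, e ∈ derGr Γ J₁ J₂ α → e (pB Γ J₁ J₂ 1) = 0 → ∀ (n : ℕ),
      ∃ y ∈ hA J₁ J₂ α, e (pB Γ J₁ J₂ (t₁ ^ n)) = pB Γ J₁ J₂ y ∧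
        pB Γ J₁ J₂ (∂₁ y) = (n : F) • e (pB Γ J₁ J₂ (t₁ ^ (n - 1))) := by
    intro e he h1 n
    have ht : (t₁ ^ n : SemigroupAlg Γ J₁ J₂) ∈ hA J₁ J₂ 0 := by
      simpa [ex_zero] using ex_t_mem_hA (J₂ := J₂) (0 : Γ) (i := n) (by simp [hJ]) (zero_mem _)
    have h2 := mem_derGr.1 he 0 _ (pB_mem_gr ht)
    rw [add_zero] at h2
    refine ⟨_, ιB_mem_hA h2, (pB_ιB _).symm, ?_⟩
    rw [← adB_one_pB (hdom _), pB_ιB, LieDerivation.ad_apply_apply, ← apply_lie_of_eq_zero h1,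
      lie_pB hJ, br_one, Derivation.leibniz_pow, pd₁_t₁ hJ, smul_eq_mul, mul_one, ← map_smul,
      ← map_smul, Nat.cast_smul_eq_nsmul]
  obtain ⟨u₀, hu₀, h₀⟩ := exists_adB_one_eq (Or.inr hJ) hd
  have he₀ := Submodule.sub_mem _ hd (adB_mem_derGr hu₀)
  -- make the value at `t₁` independent of `t₁`
  obtain ⟨u₁, hu₁, y₁, hy₁, h₁, e₁, e₁'⟩ : ∃ u ∈ gr Γ J₁ J₂ α, ∃ y ∈ hA J₁ J₂ α,
      (d - adB u) (pB Γ J₁ J₂ 1) = 0 ∧ (d - adB u) (pB Γ J₁ J₂ t₁) = pB Γ J₁ J₂ y ∧ ∂₁ y = 0 := by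
    obtain ⟨y, hy, e, e'⟩ := hp he₀ h₀ 1
    rw [pow_one] at e
    rw [Nat.sub_self, pow_zero, h₀, smul_zero] at e'
    -- In degree `σ₁` the equation `∂₁ y = 0` holds only up to `c x^{σ₁}`. The element `x^{σ₁} t₁`
    -- repairs this: its `ad` sends `1` to `-x^{σ₁}`, which is `0` in `B`, and `t₁` to `-x^{σ₁} t₁`.
    by_cases hσ : (α : F × F) = σ₁
    · obtain ⟨c, hc⟩ := (pB_eq_zero_iff (hdom _)).1 e'
      rw [xA_σ₁ (hσ ▸ α.2), show (⟨σ₁, hσ ▸ α.2⟩ : Γ) = α from Subtype.ext hσ.symm] at hc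
      have hz : (ex α * t₁ : SemigroupAlg Γ J₁ J₂) ∈ hA J₁ J₂ α := by
        simpa using ex_t_mem_hA (J₂ := J₂) α (i := 1) (by simp [hJ]) (zero_mem _)
      have hx : pB Γ J₁ J₂ (ex α) = 0 := by
        rw [← pB_xA_σ₁, xA_σ₁ (hσ ▸ α.2), show (⟨σ₁, hσ ▸ α.2⟩ : Γ) = α from Subtype.ext hσ.symm]
      have b1 : br (ex α * t₁ : SemigroupAlg Γ J₁ J₂) 1 = -ex α := by
        rw [br_comm, br_one, Derivation.leibniz, pd₁_ex, pd₁_t₁ hJ, hα]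
        simp
      have b2 : br (ex α * t₁ : SemigroupAlg Γ J₁ J₂) t₁ = -(ex α * t₁) := by
        rw [br_comm, br_t₁ hJ, sd₂_mul, sd₂_ex, pd₂_t₁, Derivation.leibniz, pd₁_ex, pd₁_t₁ hJ, hα,
          hσ]
        simp [σ₁, mul_comm]
      refine ⟨u₀ - c • pB Γ J₁ J₂ (ex α * t₁), Submodule.sub_mem _ hu₀
        (Submodule.smul_mem _ _ (pB_mem_gr hz)), y - c • (ex α * t₁),
        Submodule.sub_mem _ hy (Submodule.smul_mem _ _ hz), ?_, ?_, ?_⟩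
      · rw [adB_sub, adB_smul, ← sub_add, LieDerivation.add_apply, h₀, zero_add,
          LieDerivation.smul_apply, adB_pB (hdom _) (hdom _), b1, map_neg, hx, neg_zero, smul_zero]
      · rw [adB_sub, adB_smul, ← sub_add, LieDerivation.add_apply, e, LieDerivation.smul_apply,
          adB_pB (hdom _) (hdom _), b2, map_neg, map_sub, map_smul, smul_neg, sub_eq_add_neg]
      · rw [map_sub, hc, Derivation.map_smul, Derivation.leibniz, pd₁_ex, pd₁_t₁ hJ, hα]
        simp
    · exact ⟨u₀, hu₀, y, hy, h₀, e, eq_zero_of_pB_eq_zero hσ (hdom _) (pd₁_mem hy) e'⟩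
  -- make the value at `t₁` vanish
  obtain ⟨u₂, hu₂, h₂, e₂⟩ : ∃ u ∈ gr Γ J₁ J₂ α,
      (d - adB u) (pB Γ J₁ J₂ 1) = 0 ∧ (d - adB u) (pB Γ J₁ J₂ t₁) = 0 := by
    have hy₁' : tDeriv₁ _ _ _ y₁ = 0 := by
      rw [pd₁_of_mem hy₁, hα, zero_smul, zero_add] at e₁'; exact e₁'
    by_cases hs : (α : F × F).2 ≠ 1 ∨ J₂.1 = ⊤
    · obtain ⟨u, hu, hu', rfl⟩ := exists_sd₂_eq hs hy₁ hy₁'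
      have hu'' : ∂₁ u = 0 := by rw [pd₁_of_mem hu, hα, hu', zero_smul, zero_add]
      refine ⟨u₁ - pB Γ J₁ J₂ u, Submodule.sub_mem _ hu₁ (pB_mem_gr hu), ?_, ?_⟩
      · rw [adB_sub, ← sub_add, LieDerivation.add_apply, h₁, adB_pB (hdom _) (hdom _), br_comm,
          br_one, hu'']
        simp
      · rw [adB_sub, ← sub_add, LieDerivation.add_apply, e₁, adB_pB (hdom _) (hdom _), br_comm,
          br_t₁ hJ, hu'']
        simp
    -- Here `D` is not onto, but the value at `t₁` involves neither `t₁` nor `t₂`, so it is a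
    -- multiple of `x^{σ₁}` and already vanishes in `B`.
    · push Not at hs
      have hJ₂ : J₂.1 = ⊥ := J₂.2.resolve_right hs.2
      have hσ : (α : F × F) = σ₁ := Prod.ext hα hs.1
      refine ⟨u₁, hu₁, h₁, ?_⟩
      obtain ⟨c, rfl⟩ := exists_eq_smul_ex hy₁ hy₁' (tDeriv₂_eq_zero hJ₂ _)
      rw [e₁, map_smul, show pB Γ J₁ J₂ (ex α) = 0 by
        rw [← pB_xA_σ₁, xA_σ₁ (hσ ▸ α.2), show (⟨σ₁, hσ ▸ α.2⟩ : Γ) = α from Subtype.ext hσ.symm],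
        smul_zero]
  have he₂ := Submodule.sub_mem _ hd (adB_mem_derGr hu₂)
  obtain ⟨y, hy, e, e'⟩ := hp he₂ h₂ 2
  rw [show 2 - 1 = 1 from rfl, pow_one, e₂, smul_zero] at e'
  by_cases hσ : (α : F × F) = σ₁
  · obtain ⟨c, hc⟩ := (pB_eq_zero_iff (hdom _)).1 e'
    rw [xA_σ₁ (hσ ▸ α.2), show (⟨σ₁, hσ ▸ α.2⟩ : Γ) = α from Subtype.ext hσ.symm] at hc
    have hx : pB Γ J₁ J₂ (ex α) = 0 := by
      rw [← pB_xA_σ₁, xA_σ₁ (hσ ▸ α.2), show (⟨σ₁, hσ ▸ α.2⟩ : Γ) = α from Subtype.ext hσ.symm]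
    -- The derivation `v ↦ -x^{σ₁} ∂₁(v)` is `d₁` if `J₂ = {0}` and `ad` of `x^{σ₁} t₂` if `J₂ = ℕ`.
    -- It kills `1` and `t₁` in `B` and sends `t₁ ^ 2` to `-2 x^{σ₁} t₁`, so the multiple `c / 2`
    -- removes the part of the value at `t₁ ^ 2` which is not killed by `∂₁`.
    obtain ⟨s, hs, f, hsf⟩ : ∃ s ∈ gr Γ J₁ J₂ α, ∃ f : F, ∀ v,
        (adB s + f • d₁ Γ J₁ J₂) (pB Γ J₁ J₂ v) = pB Γ J₁ J₂ (-(ex α * ∂₁ v)) := by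
      by_cases hJ₂ : J₂.1 = ⊥
      · refine ⟨0, Submodule.zero_mem _, 1, fun v => ?_⟩
        rw [adB_zero, one_smul, zero_add, d₁_pB hJ₂ (hdom v), xA_σ₁ (hσ ▸ α.2),
          show (⟨σ₁, hσ ▸ α.2⟩ : Γ) = α from Subtype.ext hσ.symm]
      · have hJ₂' := ExpMonoid.eq_top_of_ne_bot hJ₂
        have hz : (ex α * t₂ : SemigroupAlg Γ J₁ J₂) ∈ hA J₁ J₂ α := by
          simpa using ex_t_mem_hA (J₁ := J₁) α (j := 1) (zero_mem _) (by simp [hJ₂'])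
        refine ⟨pB Γ J₁ J₂ (ex α * t₂), pB_mem_gr hz, 0, fun v => ?_⟩
        rw [zero_smul, add_zero, adB_pB (hdom _) (hdom _), br_eq, sd₂_mul, sd₂_ex, pd₂_t₂ hJ₂',
          Derivation.leibniz, pd₁_ex, pd₁_t₂, hα, hσ]
        simp [σ₁, mul_comm]
    have hmem : adB s + f • d₁ Γ J₁ J₂ ∈ derGr Γ J₁ J₂ α :=
      Submodule.add_mem _ (adB_mem_derGr hs) (Submodule.smul_mem _ _ (d₁_mem_derGr hσ))
    have hz : (ex α * t₁ : SemigroupAlg Γ J₁ J₂) ∈ hA J₁ J₂ α := by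
      simpa using ex_t_mem_hA (J₂ := J₂) α (i := 1) (by simp [hJ]) (zero_mem _)
    refine ⟨u₂ - (c / 2) • s, Submodule.sub_mem _ hu₂ (Submodule.smul_mem _ _ hs), -(c / 2 * f),
      fun h => absurd hσ h, d - adB u₂ + (c / 2) • (adB s + f • d₁ Γ J₁ J₂),
      Submodule.add_mem _ he₂ (Submodule.smul_mem _ _ hmem), ?_, ?_, ?_, y - c • (ex α * t₁),
      Submodule.sub_mem _ hy (Submodule.smul_mem _ _ hz), ?_, ?_⟩
    · rw [adB_sub, adB_smul, smul_add, smul_smul, neg_smul]; abel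
    · rw [LieDerivation.add_apply, h₂, LieDerivation.smul_apply, hsf]; simp
    · rw [LieDerivation.add_apply, e₂, LieDerivation.smul_apply, hsf, pd₁_t₁ hJ]; simp [hx]
    · rw [LieDerivation.add_apply, e, LieDerivation.smul_apply, hsf, Derivation.leibniz_pow,
        pd₁_t₁ hJ, ← map_smul, ← map_add]
      congr 1
      simp only [smul_eq_mul, nsmul_eq_mul]
      simp only [Algebra.smul_def]
      have : algebraMap F (SemigroupAlg Γ J₁ J₂) (c / 2) * 2 = algebraMap F _ c := by
        rw [← map_ofNat (algebraMap F (SemigroupAlg Γ J₁ J₂)) 2, ← map_mul]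
        congr 1
        ring
      rw [← this]
      push_cast
      ring
    · rw [map_sub, hc, Derivation.map_smul, Derivation.leibniz, pd₁_ex, pd₁_t₁ hJ, hα]
      simp
  · refine ⟨u₂, hu₂, 0, fun _ => rfl, _, he₂, by simp, h₂, e₂, y, hy, e, ?_⟩
    exact eq_zero_of_pB_eq_zero hσ (hdom _) (pd₁_mem hy) e'

theorem apply_mem_gr_zero {e : Der Γ J₁ J₂} (he : e ∈ derGr Γ J₁ J₂ 0) {β : Γ} {b : B Γ J₁ J₂}
    (hb : b ∈ gr Γ J₁ J₂ β) : e b ∈ gr Γ J₁ J₂ β := by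
  have := mem_derGr.1 he β b hb
  rwa [zero_add] at this

theorem pd₁_eq_of_lie_one_eq (hJ : J₁.1 = ⊤) {γ : Γ} (hγ : (γ : F × F) ≠ σ₁) {b : B Γ J₁ J₂}
    (hb : b ∈ gr Γ J₁ J₂ γ) {c : F} (h : ⁅pB Γ J₁ J₂ 1, b⁆ = c • b) :
    ∂₁ (ιB Γ J₁ J₂ b) = c • ιB Γ J₁ J₂ b := by
  have hw := ιB_mem_hA hb
  rw [← sub_eq_zero]
  refine eq_zero_of_pB_eq_zero hγ (mem_dom_of_top hJ _)
    (Submodule.sub_mem _ (pd₁_mem hw) (Submodule.smul_mem _ _ hw)) ?_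
  rw [map_sub, map_smul, pB_ιB, ← br_one, ← lie_pB hJ, pB_ιB, h, sub_self]

theorem sd₂_eq_of_lie_t₁_eq (hJ : J₁.1 = ⊤) {γ : Γ} (hγ : (γ : F × F) ≠ σ₁) {b : B Γ J₁ J₂}
    (hb : b ∈ gr Γ J₁ J₂ γ) (h1 : ⁅pB Γ J₁ J₂ 1, b⁆ = 0) {c : F}
    (h : ⁅pB Γ J₁ J₂ t₁, b⁆ = c • b) : 𝔇 (ιB Γ J₁ J₂ b) = c • ιB Γ J₁ J₂ b := by
  have hw := ιB_mem_hA hb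
  have h0 : ∂₁ (ιB Γ J₁ J₂ b) = 0 := by
    rw [pd₁_eq_of_lie_one_eq hJ hγ hb (c := 0) (by rw [h1, zero_smul]), zero_smul]
  rw [← sub_eq_zero]
  refine eq_zero_of_pB_eq_zero hγ (mem_dom_of_top hJ _)
    (Submodule.sub_mem _ (sd₂_mem hw) (Submodule.smul_mem _ _ hw)) ?_
  have h2 := br_t₁ hJ (ιB Γ J₁ J₂ b)
  rw [h0, mul_zero, add_zero] at h2
  rw [map_sub, map_smul, pB_ιB, ← h2, ← lie_pB hJ, pB_ιB, h, sub_self]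

/-- On the kernel of `∂₁`, `ad t₁` coincides with `D`, whose only possible eigenvalue in degree `γ`
is `γ₂ - 1`. -/
theorem eq_zero_of_lie_eq (hJ : J₁.1 = ⊤) {γ : Γ} (hγ : (γ : F × F) ≠ σ₁) {b : B Γ J₁ J₂}
    (hb : b ∈ gr Γ J₁ J₂ γ) (h1 : ⁅pB Γ J₁ J₂ 1, b⁆ = 0) {c : F}
    (h : ⁅pB Γ J₁ J₂ t₁, b⁆ = c • b) (hc : c + 1 ≠ (γ : F × F).2) : b = 0 := by
  rw [← pB_ιB b, eq_zero_of_pd₂_eq (ιB_mem_hA hb) hc, map_zero]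
  have := sd₂_eq_of_lie_t₁_eq hJ hγ hb h1 h
  rw [sd₂_apply, sub_eq_iff_eq_add] at this
  rw [this, add_smul, one_smul]

/-- The element `x^γ` is killed by `ad 1` and has `ad t₁`-eigenvalue `γ₂ - 1`. Its image has the
same properties but lies in degree `α + γ`, where the eigenvalue would have to be `α₂ + γ₂ - 1`. -/
theorem apply_ex_eq_zero (hJ : J₁.1 = ⊤) {α γ : Γ} (hα : (α : F × F).2 ≠ 0)
    (hγ : (γ : F × F).1 = 0) (hs : ((α + γ : Γ) : F × F) ≠ σ₁) {e : Der Γ J₁ J₂}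
    (he : e ∈ derGr Γ J₁ J₂ α) (h1 : e (pB Γ J₁ J₂ 1) = 0) (ht : e (pB Γ J₁ J₂ t₁) = 0) :
    e (pB Γ J₁ J₂ (ex γ)) = 0 := by
  refine eq_zero_of_lie_eq hJ hs (c := (γ : F × F).2 - 1)
    (mem_derGr.1 he γ _ (pB_mem_gr (ex_mem_hA γ))) ?_ ?_ ?_
  · rw [← apply_lie_of_eq_zero h1, lie_pB hJ, br_one, pd₁_ex, hγ, zero_smul, map_zero, map_zero]
  · rw [← apply_lie_of_eq_zero ht, lie_pB hJ, br_t₁ hJ, pd₁_ex, hγ, zero_smul, mul_zero, add_zero,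
      sd₂_ex, map_smul, map_smul]
  · simpa using hα

theorem exists_nsmul_generic {a : F} (ha : a ≠ 0) (s : Finset F) : ∃ n : ℕ, (n : F) * a ∉ s := by
  have hinj : Function.Injective fun n : ℕ => (n : F) * a := fun m n h =>
    Nat.cast_injective (mul_right_cancel₀ ha h)
  obtain ⟨_, ⟨n, rfl⟩, hn⟩ := (Set.infinite_range_of_injective hinj).exists_notMem_finset s
  exact ⟨n, hn⟩

/-- A normalized derivation of degree `(0, a)`, `a ≠ 0`, vanishes. -/
theorem eq_zero_of_normalized (hJ : J₁.1 = ⊤) {α : Γ} (hα₁ : (α : F × F).1 = 0)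
    (hα₂ : (α : F × F).2 ≠ 0) {e : Der Γ J₁ J₂} (he : e ∈ derGr Γ J₁ J₂ α)
    (h1 : e (pB Γ J₁ J₂ 1) = 0) (ht : e (pB Γ J₁ J₂ t₁) = 0) {y : SemigroupAlg Γ J₁ J₂}
    (hty : e (pB Γ J₁ J₂ (t₁ ^ 2)) = pB Γ J₁ J₂ y) (hy : ∂₁ y = 0) : e = 0 := by
  classical
  have hdom := mem_dom_of_top (Γ := Γ) (J₂ := J₂) hJ
  -- With `δ = n α`, the excluded values ensure in turn that `δ₂`, `1 - δ₂` and `δ₂ + 1` can be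
  -- divided by, and that neither `α + δ` nor `α - δ` is `σ₁`.
  obtain ⟨n, hn⟩ := exists_nsmul_generic hα₂
    {0, 1, -1, 1 - (α : F × F).2, (α : F × F).2 - 1}
  simp only [Finset.mem_insert, Finset.mem_singleton, not_or] at hn
  obtain ⟨n0, n1, n2, n3, n4⟩ := hn
  obtain ⟨δ, hδ⟩ : ∃ δ : Γ, δ = n • α := ⟨_, rfl⟩
  have hδ₁ : (δ : F × F).1 = 0 := by simp [hδ, hα₁]
  have hδ₂ : (δ : F × F).2 = n * (α : F × F).2 := by simp [hδ]
  rw [← hδ₂] at n0 n1 n2 n3 n4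
  have d1 : e (pB Γ J₁ J₂ (ex δ)) = 0 := by
    refine apply_ex_eq_zero hJ hα₂ hδ₁ (fun h => n3 ?_) he h1 ht
    have := congrArg Prod.snd h
    simp [σ₁] at this
    linear_combination this
  have d2 : e (pB Γ J₁ J₂ (ex (-δ))) = 0 := by
    refine apply_ex_eq_zero hJ hα₂ (by simp [hδ₁]) (fun h => n4 ?_) he h1 ht
    have := congrArg Prod.snd h
    simp [σ₁] at this
    linear_combination -this
  -- Use `[x^δ, t₁^2] = 2 (1 - δ₂) x^δ t₁`; the image of the left side is `[x^δ, y]`, which vanishes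
  -- because `∂₁ y = 0`.
  have d3 : e (pB Γ J₁ J₂ (ex δ * t₁)) = 0 := by
    have h := apply_lie_of_eq_zero d1 (pB Γ J₁ J₂ (t₁ ^ 2))
    rw [hty, lie_pB hJ, lie_pB hJ, br_ex_of_fst hδ₁, br_ex_of_fst hδ₁, hy, mul_zero, smul_zero,
      map_zero, Derivation.leibniz_pow, pd₁_t₁ hJ, show 2 - 1 = 1 from rfl, pow_one, smul_eq_mul,
      mul_one, mul_smul_comm, map_smul, map_smul, map_nsmul, map_nsmul, smul_eq_zero,
      sub_eq_zero] at h
    have h' := h.resolve_left (Ne.symm n1)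
    rw [← Nat.cast_smul_eq_nsmul F, smul_eq_zero] at h'
    exact h'.resolve_left (by norm_num)
  -- The composite `ad(x^{-δ}) ad(x^δ t₁)` equals `(δ₂ + 1) (∂₁ D - (δ₂ - 1) ∂₁ t₁ ∂₁)`, while
  -- `ad(1) ad(t₁) = ∂₁ D + ∂₁ t₁ ∂₁`. Eliminating `∂₁ t₁ ∂₁` leaves `δ₂ ∂₁ D`, so `∂₁ D` is a
  -- combination of `ad`s of elements killed by `e`.
  have key : (adB (pB Γ J₁ J₂ 1)).toLinearMap * sdB Γ J₁ J₂ = ((δ : F × F).2)⁻¹ •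
      (((δ : F × F).2 + 1)⁻¹ • ((adB (pB Γ J₁ J₂ (ex (-δ)))).toLinearMap *
          (adB (pB Γ J₁ J₂ (ex δ * t₁))).toLinearMap) +
        ((δ : F × F).2 - 1) • ((adB (pB Γ J₁ J₂ 1)).toLinearMap *
          (adB (pB Γ J₁ J₂ t₁)).toLinearMap)) := by
    refine LinearMap.ext fun b => ?_
    obtain ⟨v, -, rfl⟩ := exists_pB b
    simp only [Module.End.mul_apply, LinearMap.smul_apply, LinearMap.add_apply,
      LieDerivation.coeFn_coe, sdB_pB hJ, adB_pB (hdom _) (hdom _), br_one, br_t₁ hJ,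
      ← map_smul, ← map_add]
    congr 1
    have n2' : (δ : F × F).2 + 1 ≠ 0 := fun h => n2 (eq_neg_of_add_eq_zero_left h)
    rw [eq_inv_smul_iff₀ n0, ← sub_eq_iff_eq_add, eq_inv_smul_iff₀ n2',
      br_ex_of_fst (by simp [hδ₁])]
    have e1 : br (ex δ * t₁) v = ex δ * 𝔇 v - ((δ : F × F).2 - 1) • (ex δ * t₁ * ∂₁ v) := by
      rw [br_eq, sd₂_mul, sd₂_ex, pd₂_t₁, Derivation.leibniz, pd₁_ex, pd₁_t₁ hJ, hδ₁]
      simp only [smul_eq_mul, zero_smul]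
      simp only [Algebra.smul_def, map_sub, map_one]
      ring
    have e2 : ex (-δ) * ∂₁ (br (ex δ * t₁) v) =
        ∂₁ (𝔇 v) - ((δ : F × F).2 - 1) • ∂₁ (t₁ * ∂₁ v) := by
      rw [e1, map_sub, Derivation.map_smul, mul_assoc (ex δ) t₁, Derivation.leibniz,
        Derivation.leibniz, pd₁_ex, hδ₁, zero_smul, smul_zero, smul_zero, add_zero, add_zero,
        smul_eq_mul, smul_eq_mul, mul_sub, mul_smul_comm, ← mul_assoc, ← mul_assoc,
        mul_comm (ex (-δ)), ex_mul_ex_neg, one_mul, one_mul]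
    rw [e2, map_add]
    simp only [AddSubgroup.coe_neg, Prod.snd_neg, Algebra.smul_def, map_sub, map_add, map_one,
      map_neg]
    ring
  have hcomm := commute_sdB hJ h1 (by
    rw [key]
    exact ((((commute_adB d2).mul_left (commute_adB d3)).smul_left _).add_left
      (((commute_adB h1).mul_left (commute_adB ht)).smul_left _)).smul_left _)
  refine eq_zero_of_commute he hcomm (c := fun β => (β : F × F).2 - 1)
    (fun β b hb => gr_le_maxGenEigenspace_sdB hJ hb) fun β h => hα₂ ?_
  simp at h
  exact h

/-! ### Degree `0` in the case `J₁ = ℕ` -/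

/-- By induction the value at `t₁^{n+1}` is killed by `∂₁`. It has `ad t₁`-eigenvalue `n`, whereas
`D` has only the eigenvalue `-1` on the kernel of `∂₁` in degree `0`. -/
theorem apply_t₁_pow_eq_zero (hJ : J₁.1 = ⊤) {e : Der Γ J₁ J₂} (he : e ∈ derGr Γ J₁ J₂ 0)
    (h1 : e (pB Γ J₁ J₂ 1) = 0) (ht : e (pB Γ J₁ J₂ t₁) = 0) (n : ℕ) :
    e (pB Γ J₁ J₂ (t₁ ^ n)) = 0 := by
  induction n with
  | zero => rw [pow_zero, h1]
  | succ n ih =>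
    have hm : (t₁ ^ (n + 1) : SemigroupAlg Γ J₁ J₂) ∈ hA J₁ J₂ 0 := by
      simpa [ex_zero] using
        ex_t_mem_hA (J₂ := J₂) (0 : Γ) (i := n + 1) (by simp [hJ]) (zero_mem _)
    have hd : ∂₁ (t₁ ^ (n + 1) : SemigroupAlg Γ J₁ J₂) = (n + 1) • t₁ ^ n := by
      rw [Derivation.leibniz_pow, pd₁_t₁ hJ, smul_eq_mul, mul_one, Nat.add_sub_cancel]
    refine eq_zero_of_lie_eq hJ (γ := 0) (c := n) (fun h => ?_)
      (apply_mem_gr_zero he (pB_mem_gr hm)) ?_ ?_ ?_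
    · simpa [σ₁] using congrArg Prod.snd h
    · rw [← apply_lie_of_eq_zero h1, lie_pB hJ, br_one, hd, map_nsmul, map_nsmul, ih, smul_zero]
    · rw [← apply_lie_of_eq_zero ht, lie_pB hJ, br_t₁ hJ, hd]
      have : 𝔇 (t₁ ^ (n + 1)) + t₁ * ((n + 1) • t₁ ^ n) =
          (n : F) • (t₁ ^ (n + 1) : SemigroupAlg Γ J₁ J₂) := by
        rw [sd₂_of_mem hm]
        have h0 : tDeriv₂ _ _ _ (t₁ ^ (n + 1) : SemigroupAlg Γ J₁ J₂) = 0 := by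
          rw [Derivation.leibniz_pow, tDeriv₂_t₁]; simp
        rw [h0]
        simp only [nsmul_eq_mul]
        simp only [ZeroMemClass.coe_zero, Prod.snd_zero, Algebra.smul_def, map_sub,
          map_zero, map_one, map_natCast]
        push_cast
        ring
      rw [this, map_smul, map_smul]
    · simpa using Nat.cast_add_one_ne_zero (R := F) n

/-- From `[1, t₂] = 0` and `[t₁, t₂] = 1 - t₂` the value at `t₂` is killed by `∂₁` and by `∂₂`; in
degree `0` only scalars remain. -/
theorem exists_apply_t₂_eq (hJ : J₁.1 = ⊤) (hJ₂ : J₂.1 = ⊤) {e : Der Γ J₁ J₂}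
    (he : e ∈ derGr Γ J₁ J₂ 0) (h1 : e (pB Γ J₁ J₂ 1) = 0) (ht : e (pB Γ J₁ J₂ t₁) = 0) :
    ∃ f : F, e (pB Γ J₁ J₂ t₂) = f • pB Γ J₁ J₂ 1 := by
  have hm : (t₂ : SemigroupAlg Γ J₁ J₂) ∈ hA J₁ J₂ 0 := by
    simpa [ex_zero] using ex_t_mem_hA (J₁ := J₁) (0 : Γ) (zero_mem _) (j := 1) (by simp [hJ₂])
  have h0 : ((0 : Γ) : F × F) ≠ σ₁ := fun h => by simpa [σ₁] using congrArg Prod.snd h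
  have hb := apply_mem_gr_zero he (pB_mem_gr hm)
  have l1 : ⁅pB Γ J₁ J₂ 1, e (pB Γ J₁ J₂ t₂)⁆ = 0 := by
    rw [← apply_lie_of_eq_zero h1, lie_pB hJ, br_one, pd₁_t₂, map_zero, map_zero]
  have l2 : ⁅pB Γ J₁ J₂ t₁, e (pB Γ J₁ J₂ t₂)⁆ = (-1 : F) • e (pB Γ J₁ J₂ t₂) := by
    rw [← apply_lie_of_eq_zero ht, lie_pB hJ, br_t₁ hJ, pd₁_t₂, mul_zero, add_zero, sd₂_apply,
      pd₂_t₂ hJ₂, map_sub, map_sub, h1]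
    simp
  have m1 := pd₁_eq_of_lie_one_eq hJ h0 hb (c := 0) (by rw [l1, zero_smul])
  have m2 := sd₂_eq_of_lie_t₁_eq hJ h0 hb l1 l2
  rw [pd₁_of_mem (ιB_mem_hA hb)] at m1
  rw [sd₂_of_mem (ιB_mem_hA hb)] at m2
  simp only [ZeroMemClass.coe_zero, Prod.fst_zero, zero_smul, zero_add] at m1
  simp only [ZeroMemClass.coe_zero, Prod.snd_zero, zero_sub, add_eq_left] at m2
  obtain ⟨f, hf⟩ := exists_eq_smul_ex (ιB_mem_hA hb) m1 m2
  refine ⟨f, ?_⟩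
  rw [← pB_ιB (e _), hf, ex_zero, map_smul]

/-- A derivation of degree zero which commutes with `∂₂ - 1` and kills the powers of `t₁`, and
`t₂`. -/
structure IsDiagonal (e : Der Γ J₁ J₂) : Prop where
  mem : e ∈ derGr Γ J₁ J₂ 0
  t₁_pow : ∀ n, e (pB Γ J₁ J₂ (t₁ ^ n)) = 0
  t₂_eq : e (pB Γ J₁ J₂ t₂) = 0
  comm : Commute (sdB Γ J₁ J₂) e.toLinearMap

/-- If `J₂ = {0}`, `D` is a scalar on each component and commutation is automatic. If `J₂ = ℕ`, a
multiple of `∂_{t₂}` makes the value at `t₂` vanish; then `t₁ t₂` is killed too, because `[t₂, t₁^2]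
= 2 (t₁ t₂ - t₁)`, and `∂₁ D` is again expressed by `ad`s of killed elements. -/
theorem exists_isDiagonal (hJ : J₁.1 = ⊤) {e : Der Γ J₁ J₂} (he : e ∈ derGr Γ J₁ J₂ 0)
    (h1 : e (pB Γ J₁ J₂ 1) = 0) (ht : e (pB Γ J₁ J₂ t₁) = 0) :
    ∃ f : F, IsDiagonal (e - f • dt₂ Γ J₁ J₂) := by
  have hdom := mem_dom_of_top (Γ := Γ) (J₂ := J₂) hJ
  by_cases hJ₂ : J₂.1 = ⊥
  · refine ⟨0, ?_⟩
    rw [zero_smul, sub_zero]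
    refine ⟨he, apply_t₁_pow_eq_zero hJ he h1 ht, by rw [t₂_eq_zero hJ₂, map_zero, map_zero], ?_⟩
    have hs : ∀ β : Γ, ∀ b ∈ gr Γ J₁ J₂ β, sdB Γ J₁ J₂ b = ((β : F × F).2 - 1) • b := by
      intro β b hb
      rw [← pB_ιB b, sdB_pB hJ, sd₂_of_mem (ιB_mem_hA hb), tDeriv₂_eq_zero hJ₂, add_zero, map_smul]
    refine LinearMap.ext fun b => ?_
    refine span_gr (LinearMap.eqLocus (sdB Γ J₁ J₂ * e.toLinearMap) (e.toLinearMap * sdB Γ J₁ J₂))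
      (fun β b hb => ?_) b
    rw [LinearMap.mem_eqLocus, Module.End.mul_apply, Module.End.mul_apply, LieDerivation.coeFn_coe,
      hs β b hb, hs β _ (apply_mem_gr_zero he hb), map_smul]
  · have hJ₂' := ExpMonoid.eq_top_of_ne_bot hJ₂
    obtain ⟨f, hf⟩ := exists_apply_t₂_eq hJ hJ₂' he h1 ht
    refine ⟨f, ?_⟩
    have he' : e - f • dt₂ Γ J₁ J₂ ∈ derGr Γ J₁ J₂ 0 :=
      Submodule.sub_mem _ he (Submodule.smul_mem _ _ dt₂_mem_derGr)
    have h1' : (e - f • dt₂ Γ J₁ J₂) (pB Γ J₁ J₂ 1) = 0 := by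
      rw [LieDerivation.sub_apply, h1, LieDerivation.smul_apply, dt₂_pB (hdom _),
        Derivation.map_one_eq_zero, map_zero, smul_zero, sub_zero]
    have ht' : (e - f • dt₂ Γ J₁ J₂) (pB Γ J₁ J₂ t₁) = 0 := by
      rw [LieDerivation.sub_apply, ht, LieDerivation.smul_apply, dt₂_pB (hdom _),
        tDeriv₂_t₁, map_zero, smul_zero, sub_zero]
    have ht₂ : (e - f • dt₂ Γ J₁ J₂) (pB Γ J₁ J₂ t₂) = 0 := by
      rw [LieDerivation.sub_apply, hf, LieDerivation.smul_apply, dt₂_pB (hdom _),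
        tDeriv₂_t₂ hJ₂', sub_self]
    have htn := apply_t₁_pow_eq_zero hJ he' h1' ht'
    refine ⟨he', htn, ht₂, ?_⟩
    obtain ⟨e', he'⟩ : ∃ e', e' = e - f • dt₂ Γ J₁ J₂ := ⟨_, rfl⟩
    rw [← he'] at h1' ht' ht₂ htn ⊢
    have htt : e' (pB Γ J₁ J₂ (t₁ * t₂)) = 0 := by
      have h := apply_lie_of_eq_zero ht₂ (pB Γ J₁ J₂ (t₁ ^ 2))
      rw [htn, lie_zero, lie_pB hJ] at h
      have hb : br t₂ (t₁ ^ 2) = (2 : F) • (t₁ * t₂ - t₁ : SemigroupAlg Γ J₁ J₂) := by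
        rw [br_eq, pd₁_t₂, Derivation.leibniz_pow, pd₁_t₁ hJ, sd₂_apply t₂, pd₂_t₂ hJ₂']
        simp only [smul_eq_mul, nsmul_eq_mul]
        simp only [Algebra.smul_def, map_ofNat]
        push_cast
        ring
      rw [hb, map_smul, map_smul, map_sub, map_sub, ht', sub_zero] at h
      exact (smul_eq_zero.1 h).resolve_left two_ne_zero
    refine commute_sdB hJ h1' ?_
    -- The operator `ad t₂ + ad 1` is `t₂ ∂₁`, and the inner difference equals `∂₁ t₁ ∂₁`.
    -- Subtracting it from `ad(1) ad(t₁) = ∂₁ D + ∂₁ t₁ ∂₁` leaves `∂₁ D`.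
    have key : (adB (pB Γ J₁ J₂ 1)).toLinearMap * sdB Γ J₁ J₂ =
        (adB (pB Γ J₁ J₂ 1)).toLinearMap * (adB (pB Γ J₁ J₂ t₁)).toLinearMap -
          (((adB (pB Γ J₁ J₂ t₂)).toLinearMap + (adB (pB Γ J₁ J₂ 1)).toLinearMap) *
            (adB (pB Γ J₁ J₂ t₁)).toLinearMap -
          (adB (pB Γ J₁ J₂ 1)).toLinearMap * (adB (pB Γ J₁ J₂ (t₁ * t₂))).toLinearMap) := by
      refine LinearMap.ext fun b => ?_
      obtain ⟨v, -, rfl⟩ := exists_pB b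
      simp only [Module.End.mul_apply, LinearMap.sub_apply, LinearMap.add_apply,
        LieDerivation.coeFn_coe, sdB_pB hJ, adB_pB (hdom _) (hdom _), br_one, br_t₁ hJ,
        ← map_add, ← map_sub]
      congr 1
      have e1 : ∀ z : SemigroupAlg Γ J₁ J₂, br t₂ z = (t₂ - 1) * ∂₁ z := fun z => by
        rw [br_eq, pd₁_t₂, sd₂_apply t₂, pd₂_t₂ hJ₂']; ring
      have e2 : br (t₁ * t₂) v = t₂ * 𝔇 v + (t₁ * t₂ - t₁) * ∂₁ v := by
        rw [br_eq, sd₂_mul, sd₂_t₁, pd₂_t₂ hJ₂', Derivation.leibniz, pd₁_t₁ hJ, pd₁_t₂]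
        simp only [smul_eq_mul]
        ring
      rw [e1, e2]
      simp only [map_add, map_sub, Derivation.leibniz, pd₁_t₁ hJ, pd₁_t₂, smul_eq_mul]
      ring
    rw [key]
    have c1 := commute_adB h1'
    exact (c1.mul_left (commute_adB ht')).sub_left
      ((((commute_adB ht₂).add_left c1).mul_left (commute_adB ht')).sub_left
        (c1.mul_left (commute_adB htt)))

/-! ### Diagonal derivations -/

/-- The vectors on which `e` acts as the scalar `c`. -/
def scalarLocus (e : Der Γ J₁ J₂) (c : F) : Submodule F (SemigroupAlg Γ J₁ J₂) :=
  LinearMap.eqLocus (e.toLinearMap ∘ₗ pB Γ J₁ J₂) (c • pB Γ J₁ J₂)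

theorem mem_scalarLocus {e : Der Γ J₁ J₂} {c : F} {v : SemigroupAlg Γ J₁ J₂} :
    v ∈ scalarLocus e c ↔ e (pB Γ J₁ J₂ v) = c • pB Γ J₁ J₂ v := Iff.rfl

namespace IsDiagonal

variable {e : Der Γ J₁ J₂}

/-- A derivation commutes with `ad` of any element it kills. Applied to `1`, `t₁`, `t₂` and combined
with the commutation with `D`, this makes the locus stable under `∂₁`, `D`, `t₁ ∂₁` and `t₂ ∂₁`;
these move one vector of a component to all its monomials. -/
theorem br_mem_scalarLocus (hJ : J₁.1 = ⊤) {u v : SemigroupAlg Γ J₁ J₂}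
    (hu : e (pB Γ J₁ J₂ u) = 0) {c : F} (hv : v ∈ scalarLocus e c) :
    br u v ∈ scalarLocus e c := by
  rw [mem_scalarLocus] at hv ⊢
  rw [← lie_pB hJ, apply_lie_of_eq_zero hu, hv, lie_smul]

theorem pd₁_mem_scalarLocus (he : IsDiagonal e) (hJ : J₁.1 = ⊤) {v : SemigroupAlg Γ J₁ J₂} {c : F}
    (hv : v ∈ scalarLocus e c) : ∂₁ v ∈ scalarLocus e c := by
  rw [← br_one]
  exact br_mem_scalarLocus hJ (by simpa using he.t₁_pow 0) hv

theorem apply_t₁ (he : IsDiagonal e) : e (pB Γ J₁ J₂ t₁) = 0 := by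
  simpa using he.t₁_pow 1

theorem apply_one (he : IsDiagonal e) : e (pB Γ J₁ J₂ 1) = 0 := by
  simpa using he.t₁_pow 0

theorem sd₂_mem_scalarLocus (he : IsDiagonal e) (hJ : J₁.1 = ⊤) {v : SemigroupAlg Γ J₁ J₂} {c : F}
    (hv : v ∈ scalarLocus e c) : 𝔇 v ∈ scalarLocus e c := by
  rw [mem_scalarLocus] at hv ⊢
  have := LinearMap.congr_fun he.comm (pB Γ J₁ J₂ v)
  simp only [Module.End.mul_apply, LieDerivation.coeFn_coe, sdB_pB hJ] at this
  rw [← this, hv, map_smul, sdB_pB hJ]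

theorem t₁_mul_mem_scalarLocus (he : IsDiagonal e) (hJ : J₁.1 = ⊤) {v : SemigroupAlg Γ J₁ J₂}
    {c : F} (hv : v ∈ scalarLocus e c) : t₁ * ∂₁ v ∈ scalarLocus e c := by
  have h1 := br_mem_scalarLocus hJ he.apply_t₁ hv
  rw [br_t₁ hJ] at h1
  exact ((scalarLocus e c).add_mem_iff_right (he.sd₂_mem_scalarLocus hJ hv)).1 h1

theorem t₂_mul_mem_scalarLocus (he : IsDiagonal e) (hJ : J₁.1 = ⊤) {v : SemigroupAlg Γ J₁ J₂}
    {c : F} (hv : v ∈ scalarLocus e c) : t₂ * ∂₁ v ∈ scalarLocus e c := by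
  by_cases hJ₂ : J₂.1 = ⊥
  · rw [t₂_eq_zero hJ₂, zero_mul]; exact Submodule.zero_mem _
  · have h1 := br_mem_scalarLocus hJ he.t₂_eq hv
    have h2 := he.pd₁_mem_scalarLocus hJ hv
    have h3 : br t₂ v = t₂ * ∂₁ v - ∂₁ v := by
      rw [br_eq, pd₁_t₂, sd₂_apply t₂, pd₂_t₂ (ExpMonoid.eq_top_of_ne_bot hJ₂)]; ring
    rw [h3] at h1
    exact ((scalarLocus e c).sub_mem_iff_left h2).1 h1

theorem sdB_apply (he : IsDiagonal e) (hJ : J₁.1 = ⊤) (v : SemigroupAlg Γ J₁ J₂) :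
    pB Γ J₁ J₂ (𝔇 (ιB Γ J₁ J₂ (e (pB Γ J₁ J₂ v)))) = e (pB Γ J₁ J₂ (𝔇 v)) := by
  have := LinearMap.congr_fun he.comm (pB Γ J₁ J₂ v)
  simp only [Module.End.mul_apply, LieDerivation.coeFn_coe] at this
  rw [← sdB_pB hJ, pB_ιB, this, sdB_pB hJ]

theorem pd₁_apply (he : IsDiagonal e) (hJ : J₁.1 = ⊤) (v : SemigroupAlg Γ J₁ J₂) :
    pB Γ J₁ J₂ (∂₁ (ιB Γ J₁ J₂ (e (pB Γ J₁ J₂ v)))) = e (pB Γ J₁ J₂ (∂₁ v)) := by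
  rw [← br_one, ← br_one, ← lie_pB hJ, ← lie_pB hJ, pB_ιB, apply_lie_of_eq_zero he.apply_one]

theorem t₁_mul_apply (he : IsDiagonal e) (hJ : J₁.1 = ⊤) (v : SemigroupAlg Γ J₁ J₂) :
    pB Γ J₁ J₂ (t₁ * ∂₁ (ιB Γ J₁ J₂ (e (pB Γ J₁ J₂ v)))) = e (pB Γ J₁ J₂ (t₁ * ∂₁ v)) := by
  have h1 : ∀ z : SemigroupAlg Γ J₁ J₂, t₁ * ∂₁ z = br t₁ z - 𝔇 z := fun z => by
    rw [br_t₁ hJ, add_sub_cancel_left]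
  rw [h1, h1, map_sub, map_sub, map_sub, he.sdB_apply hJ, ← lie_pB hJ, ← lie_pB hJ, pB_ιB,
    apply_lie_of_eq_zero he.apply_t₁]

/-- The image of `x^β` is a true eigenvector of `∂₁` and `D` with the eigenvalues of degree `β`, so
it is killed by both `∂_{t₁}` and `∂_{t₂}`. -/
theorem exists_ex_mem_scalarLocus (he : IsDiagonal e) (hJ : J₁.1 = ⊤) {β : Γ}
    (hβ : (β : F × F).1 ≠ 0) : ∃ c : F, ex β ∈ scalarLocus e c := by
  have hb := apply_mem_gr_zero he.mem (pB_mem_gr (ex_mem_hA β))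
  have hσ : (β : F × F) ≠ σ₁ := fun h => hβ (congrArg Prod.fst h)
  have hw := ιB_mem_hA hb
  have key : ∀ {v : SemigroupAlg Γ J₁ J₂}, v ∈ hA J₁ J₂ β → ∀ c : F,
      pB Γ J₁ J₂ v = c • e (pB Γ J₁ J₂ (ex β)) → v = c • ιB Γ J₁ J₂ (e (pB Γ J₁ J₂ (ex β))) := by
    intro v hv c h
    rw [← sub_eq_zero]
    refine eq_zero_of_pB_eq_zero hσ (mem_dom_of_top hJ _)
      (Submodule.sub_mem _ hv (Submodule.smul_mem _ _ hw)) ?_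
    rw [map_sub, map_smul, pB_ιB, h, sub_self]
  have h1 := key (pd₁_mem hw) (β : F × F).1 (by rw [he.pd₁_apply hJ, pd₁_ex, map_smul, map_smul])
  have h2 := key (sd₂_mem hw) ((β : F × F).2 - 1)
    (by rw [he.sdB_apply hJ, sd₂_ex, map_smul, map_smul])
  rw [pd₁_of_mem hw, add_eq_left] at h1
  rw [sd₂_of_mem hw, add_eq_left] at h2
  obtain ⟨c, hc⟩ := exists_eq_smul_ex hw h1 h2
  refine ⟨c, ?_⟩
  rw [mem_scalarLocus, ← map_smul, ← hc, pB_ιB]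

/-- When `β₁ = 0` the monomial `x^β` may be zero in `B`, so `x^β t₁` is used. A lift `w` of its
image satisfies `t₁ ∂₁ w = w` and `D w = (β₂ - 1) w` up to multiples of `x^{σ₁}`. Applying `∂₁`
removes these errors and shows `∂₁ w = c x^β`; the first relation then recovers `w` as `c x^β t₁` in
`B`. -/
theorem exists_ex_mul_t₁_mem_scalarLocus (he : IsDiagonal e) (hJ : J₁.1 = ⊤) {β : Γ}
    (hβ : (β : F × F).1 = 0) : ∃ c : F, ex β * t₁ ∈ scalarLocus e c := by
  have hm : (ex β * t₁ : SemigroupAlg Γ J₁ J₂) ∈ hA J₁ J₂ β := by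
    simpa using ex_t_mem_hA (J₂ := J₂) β (i := 1) (by simp [hJ]) (zero_mem _)
  have hb := apply_mem_gr_zero he.mem (pB_mem_gr hm)
  have hw := ιB_mem_hA hb
  have key : ∀ {v : SemigroupAlg Γ J₁ J₂}, ∀ c : F,
      pB Γ J₁ J₂ v = c • e (pB Γ J₁ J₂ (ex β * t₁)) →
      ∃ c' : F, v = c • ιB Γ J₁ J₂ (e (pB Γ J₁ J₂ (ex β * t₁))) + c' • xA Γ J₁ J₂ σ₁ 0 := by
    intro v c h
    obtain ⟨c', hc'⟩ := (pB_eq_zero_iff (mem_dom_of_top hJ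
      (v - c • ιB Γ J₁ J₂ (e (pB Γ J₁ J₂ (ex β * t₁)))))).1 (by
        rw [map_sub, map_smul, pB_ιB, h, sub_self])
    exact ⟨c', by rw [← hc']; abel⟩
  have hd : ∂₁ (ex β * t₁ : SemigroupAlg Γ J₁ J₂) = ex β := by
    rw [Derivation.leibniz, pd₁_ex, pd₁_t₁ hJ, hβ, zero_smul, smul_zero, add_zero, smul_eq_mul,
      mul_one]
  have hD : 𝔇 (ex β * t₁ : SemigroupAlg Γ J₁ J₂) = ((β : F × F).2 - 1) • (ex β * t₁) := by
    rw [sd₂_mul, pd₂_t₁, mul_zero, add_zero, sd₂_ex, smul_mul_assoc]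
  obtain ⟨c₁, h1⟩ := key 1 (by
    rw [he.t₁_mul_apply hJ, hd, one_smul, mul_comm t₁])
  obtain ⟨c₂, h2⟩ := key ((β : F × F).2 - 1) (by
    rw [he.sdB_apply hJ, hD, map_smul, map_smul])
  obtain ⟨w, hw'⟩ : ∃ w, w = ιB Γ J₁ J₂ (e (pB Γ J₁ J₂ (ex β * t₁))) := ⟨_, rfl⟩
  rw [← hw'] at h1 h2 hw
  rw [one_smul] at h1
  have h3 : tDeriv₁ _ _ _ (∂₁ w) = 0 := by
    have h := congrArg ∂₁ h1
    rw [Derivation.leibniz, pd₁_t₁ hJ, map_add, Derivation.map_smul, pd₁_xσ₁, smul_zero, add_zero,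
      smul_eq_mul, smul_eq_mul, mul_one, add_eq_right] at h
    have h := t₁_mul_eq_zero hJ h
    rwa [pd₁_of_mem (pd₁_mem hw), hβ, zero_smul, zero_add] at h
  have h4 : tDeriv₂ _ _ _ (∂₁ w) = 0 := by
    have h := congrArg ∂₁ h2
    rw [pd₁_sd₂, map_add, Derivation.map_smul, Derivation.map_smul, pd₁_xσ₁, smul_zero, add_zero,
      sd₂_of_mem (pd₁_mem hw), add_eq_left] at h
    exact h
  obtain ⟨c, hc⟩ := exists_eq_smul_ex (pd₁_mem hw) h3 h4
  refine ⟨c, ?_⟩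
  rw [mem_scalarLocus]
  have h5 := congrArg (pB Γ J₁ J₂) h1
  rw [map_add, map_smul, pB_xA_σ₁, smul_zero, add_zero, hc, hw', pB_ιB, mul_smul_comm, map_smul,
    mul_comm] at h5
  exact h5.symm

theorem br_t₁_pow (hJ : J₁.1 = ⊤) (u : SemigroupAlg Γ J₁ J₂) (n : ℕ) :
    br (t₁ ^ n) u = n • (t₁ ^ (n - 1) * 𝔇 u) + t₁ ^ n * ∂₁ u := by
  have h : ∂₂ (t₁ ^ n : SemigroupAlg Γ J₁ J₂) = 0 := by
    rw [Derivation.leibniz_pow, pd₂_t₁, smul_zero, smul_zero]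
  rw [br_eq, sd₂_apply (t₁ ^ n), h, Derivation.leibniz_pow, pd₁_t₁ hJ]
  simp only [smul_eq_mul, nsmul_eq_mul]
  ring

/-- For `β₁ ≠ 0`, `t₁ ∂₁` raises the exponent. For `β₁ = 0` one uses `[t₁^{k+1}, x^β] = (k+1)(β₂ -
1) x^β t₁^k`, and if `β₂ = 1` instead `[t₁^k, x^β t₁] = x^β t₁^k`. -/
theorem ex_mul_t₁_pow_mem (he : IsDiagonal e) (hJ : J₁.1 = ⊤) (β : Γ) :
    ∃ c : F, ∀ k : ℕ, ex β * t₁ ^ k ∈ scalarLocus e c := by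
  by_cases hβ : (β : F × F).1 = 0
  · obtain ⟨c, hc⟩ := he.exists_ex_mul_t₁_mem_scalarLocus hJ hβ
    refine ⟨c, fun k => ?_⟩
    have hd : ∂₁ (ex β * t₁ : SemigroupAlg Γ J₁ J₂) = ex β := by
      rw [Derivation.leibniz, pd₁_ex, pd₁_t₁ hJ, hβ, zero_smul, smul_zero, add_zero, smul_eq_mul,
        mul_one]
    have h0 := he.pd₁_mem_scalarLocus hJ hc
    rw [hd] at h0
    by_cases h2 : (β : F × F).2 = 1
    · have hD : 𝔇 (ex β * t₁ : SemigroupAlg Γ J₁ J₂) = 0 := by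
        rw [sd₂_mul, pd₂_t₁, mul_zero, add_zero, sd₂_ex, h2, sub_self, zero_smul, zero_mul]
      have h := br_mem_scalarLocus hJ (he.t₁_pow k) hc
      rw [br_t₁_pow hJ, hD, mul_zero, smul_zero, zero_add, hd, mul_comm] at h
      exact h
    · have h := br_mem_scalarLocus hJ (he.t₁_pow (k + 1)) h0
      rw [br_t₁_pow hJ, pd₁_ex, hβ, zero_smul, mul_zero, add_zero, sd₂_ex, mul_smul_comm,
        ← Nat.cast_smul_eq_nsmul F, Nat.add_sub_cancel, smul_smul, mul_comm (t₁ ^ k)] at h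
      refine ((scalarLocus e c).smul_mem_iff ?_).1 h
      exact mul_ne_zero (Nat.cast_ne_zero.2 k.succ_ne_zero) (sub_ne_zero.2 h2)
  · obtain ⟨c, hc⟩ := he.exists_ex_mem_scalarLocus hJ hβ
    refine ⟨c, fun k => ?_⟩
    induction k with
    | zero => rwa [pow_zero, mul_one]
    | succ k ih =>
      have h := he.t₁_mul_mem_scalarLocus hJ ih
      have h' : t₁ * ∂₁ (ex β * t₁ ^ k : SemigroupAlg Γ J₁ J₂) =
          (β : F × F).1 • (ex β * t₁ ^ (k + 1)) + (k : F) • (ex β * t₁ ^ k) := by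
        rw [Derivation.leibniz, Derivation.leibniz_pow, pd₁_t₁ hJ, pd₁_ex]
        simp only [smul_eq_mul, nsmul_eq_mul]
        simp only [Algebra.smul_def, map_natCast]
        cases k with
        | zero => simp; ring
        | succ k => rw [Nat.add_sub_cancel]; ring
      rw [h', (scalarLocus e c).add_mem_iff_left (Submodule.smul_mem _ _ ih)] at h
      exact ((scalarLocus e c).smul_mem_iff hβ).1 h

/-- The operator `t₂ ∂₁` raises the exponent of `t₂`. If `β₁ = 0` it also lowers that of `t₁`, so
one starts one power of `t₁` higher; if `β₁ ≠ 0` the extra term is handled by induction on the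
exponent of `t₁`. -/
theorem exists_hA_le_scalarLocus (he : IsDiagonal e) (hJ : J₁.1 = ⊤) (β : Γ) :
    ∃ c : F, hA J₁ J₂ β ≤ scalarLocus e c := by
  obtain ⟨c, hc⟩ := he.ex_mul_t₁_pow_mem hJ β
  refine ⟨c, fun v hv => hA_induction _ (fun i j _ hj => ?_) hv⟩
  by_cases hJ₂ : J₂.1 = ⊥
  · rw [hJ₂, AddSubmonoid.mem_bot] at hj
    rw [hj, pow_zero, mul_one]
    exact hc i
  have hd : ∀ i j : ℕ, t₂ * ∂₁ (ex β * t₁ ^ i * t₂ ^ j : SemigroupAlg Γ J₁ J₂) =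
      (β : F × F).1 • (ex β * t₁ ^ i * t₂ ^ (j + 1)) +
        (i : F) • (ex β * t₁ ^ (i - 1) * t₂ ^ (j + 1)) := by
    intro i j
    rw [Derivation.leibniz, Derivation.leibniz, Derivation.leibniz_pow, Derivation.leibniz_pow,
      pd₁_t₁ hJ, pd₁_ex, pd₁_t₂]
    simp only [smul_eq_mul, nsmul_eq_mul]
    simp only [Algebra.smul_def, map_natCast]
    ring
  clear hj
  induction j generalizing i with
  | zero => rw [pow_zero, mul_one]; exact hc i
  | succ j ihj =>
    by_cases hβ : (β : F × F).1 = 0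
    · have h := he.t₂_mul_mem_scalarLocus hJ (ihj (i + 1) (by simp [hJ]))
      rw [hd, hβ, zero_smul, zero_add, Nat.add_sub_cancel] at h
      exact ((scalarLocus e c).smul_mem_iff (Nat.cast_ne_zero.2 i.succ_ne_zero)).1 h
    · have step : ∀ i : ℕ, (i : F) • (ex β * t₁ ^ (i - 1) * t₂ ^ (j + 1)) ∈ scalarLocus e c →
          ex β * t₁ ^ i * t₂ ^ (j + 1) ∈ scalarLocus e c := by
        intro i hi
        have h := he.t₂_mul_mem_scalarLocus hJ (ihj i (by simp [hJ]))
        rw [hd, (scalarLocus e c).add_mem_iff_left hi] at h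
        exact ((scalarLocus e c).smul_mem_iff hβ).1 h
      have : ∀ i : ℕ, ex β * t₁ ^ i * t₂ ^ (j + 1) ∈ scalarLocus e c := by
        intro i
        induction i with
        | zero => exact step 0 (by rw [Nat.cast_zero, zero_smul]; exact Submodule.zero_mem _)
        | succ i ih => exact step _ (Submodule.smul_mem _ _ ih)
      exact this i

end IsDiagonal

theorem eq_zero_of_pB_ex_t₁_eq_zero (hJ : J₁.1 = ⊤) {δ : Γ} {k : ℕ} (hk : k ≠ 0) {a b : F}
    (h : pB Γ J₁ J₂ (a • (ex δ * t₁ ^ (k + 1)) + b • (ex δ * t₁ ^ k)) = 0) : a = 0 ∧ b = 0 := by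
  classical
  obtain ⟨c, hc⟩ := (pB_eq_zero_iff (mem_dom_of_top hJ _)).1 h
  rw [ex_t_eq_single' hJ, ex_t_eq_single' hJ] at hc
  constructor
  · have := congrArg (fun z => z.coeff (δ, ⟨k + 1, by simp [hJ]⟩, 0)) hc
    simpa [coeff_xA_σ₁, Finsupp.single_apply, Prod.ext_iff, Subtype.ext_iff] using this
  · have := congrArg (fun z => z.coeff (δ, ⟨k, by simp [hJ]⟩, 0)) hc
    simpa [coeff_xA_σ₁, Finsupp.single_apply, Prod.ext_iff, Subtype.ext_iff, hk] using this

theorem br_ex_t₁ (hJ : J₁.1 = ⊤) (β γ : Γ) (n m : ℕ) :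
    br (ex β * t₁ ^ (n + 1)) (ex γ * t₁ ^ (m + 1) : SemigroupAlg Γ J₁ J₂) =
      ((β : F × F).1 * ((γ : F × F).2 - 1) - (γ : F × F).1 * ((β : F × F).2 - 1)) •
        (ex (β + γ) * t₁ ^ (n + m + 1 + 1)) +
      ((n + 1) * ((γ : F × F).2 - 1) - (m + 1) * ((β : F × F).2 - 1)) •
        (ex (β + γ) * t₁ ^ (n + m + 1)) := by
  have h1 : ∀ (β : Γ) (n : ℕ), ∂₁ (ex β * t₁ ^ (n + 1) : SemigroupAlg Γ J₁ J₂) =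
      (β : F × F).1 • (ex β * t₁ ^ (n + 1)) + ((n : F) + 1) • (ex β * t₁ ^ n) := by
    intro β n
    rw [Derivation.leibniz, Derivation.leibniz_pow, pd₁_t₁ hJ, pd₁_ex, Nat.add_sub_cancel]
    simp only [smul_eq_mul, nsmul_eq_mul]
    simp only [Algebra.smul_def, map_natCast, map_add, map_one]
    push_cast
    ring
  have h2 : ∀ (β : Γ) (n : ℕ), 𝔇 (ex β * t₁ ^ (n + 1) : SemigroupAlg Γ J₁ J₂) =
      ((β : F × F).2 - 1) • (ex β * t₁ ^ (n + 1)) := by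
    intro β n
    have h : ∂₂ (t₁ ^ (n + 1) : SemigroupAlg Γ J₁ J₂) = 0 := by
      rw [Derivation.leibniz_pow, pd₂_t₁, smul_zero, smul_zero]
    rw [sd₂_mul, h, mul_zero, add_zero, sd₂_ex, smul_mul_assoc]
  rw [br_eq, h1, h1, h2, h2, ex_add]
  simp only [Algebra.smul_def, map_natCast, map_add, map_sub, map_mul, map_one]
  ring

/-- If `C` denotes the scalars, the Leibniz rule says that `C(β + γ) - C(β) - C(γ)` kills `[B_β,
B_γ]`. This bracket space is nonzero unless possibly `β₂ = γ₂ = 1`, and that case reduces to the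
others by passing through `-γ`. -/
theorem IsDiagonal.exists_eq_dHom {e : Der Γ J₁ J₂} (he : IsDiagonal e) (hJ : J₁.1 = ⊤) :
    ∃ μ : Γ →+ F, e = dHom Γ J₁ J₂ μ := by
  choose C hC using he.exists_hA_le_scalarLocus hJ
  have hm : ∀ (β : Γ) (n : ℕ), (ex β * t₁ ^ n : SemigroupAlg Γ J₁ J₂) ∈ hA J₁ J₂ β := by
    intro β n
    simpa using ex_t_mem_hA (J₂ := J₂) β (i := n) (by simp [hJ]) (zero_mem _)
  have hlie : ∀ (β γ : Γ) (u v : SemigroupAlg Γ J₁ J₂), u ∈ hA J₁ J₂ β → v ∈ hA J₁ J₂ γ →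
      (C (β + γ) - (C β + C γ)) • pB Γ J₁ J₂ (br u v) = 0 := by
    intro β γ u v hu hv
    have h1 := mem_scalarLocus.1 (hC _ (br_mem hu hv))
    rw [← lie_pB hJ, e.apply_lie_eq_add, mem_scalarLocus.1 (hC _ hu), mem_scalarLocus.1 (hC _ hv),
      lie_smul, smul_lie, ← add_smul, lie_pB hJ] at h1
    rw [sub_smul, ← h1, ← sub_smul, add_comm (C γ), sub_self, zero_smul]
  have hadd : ∀ β γ : Γ, ¬ ((β : F × F).2 = 1 ∧ (γ : F × F).2 = 1) → C (β + γ) = C β + C γ := by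
    intro β γ hne
    by_contra hC'
    have hz : ∀ n m : ℕ, pB Γ J₁ J₂ (br (ex β * t₁ ^ (n + 1)) (ex γ * t₁ ^ (m + 1))) = 0 :=
      fun n m => (smul_eq_zero.1 (hlie β γ _ _ (hm _ _) (hm _ _))).resolve_left (sub_ne_zero.2 hC')
    -- The lower coefficients of `[x^β t₁, x^γ t₁]` and `[x^β t₁, x^γ t₁^2]` are `(γ₂ - 1) - (β₂ -
    -- 1)` and `(γ₂ - 1) - 2(β₂ - 1)`; both vanish only for `β₂ = γ₂ = 1`.
    have z1 := hz 0 0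
    have z2 := hz 0 1
    rw [br_ex_t₁ hJ] at z1 z2
    have y1 := (eq_zero_of_pB_ex_t₁_eq_zero hJ (by omega) z1).2
    have y2 := (eq_zero_of_pB_ex_t₁_eq_zero hJ (by omega) z2).2
    push_cast at y1 y2
    have hβ : (β : F × F).2 = 1 := by linear_combination y1 - y2
    exact hne ⟨hβ, by linear_combination y1 + hβ⟩
  have h0 : C 0 = 0 := by
    have := mem_scalarLocus.1 (hC _ (hm 0 1))
    rw [ex_zero, one_mul, he.t₁_pow, eq_comm, smul_eq_zero] at this
    refine this.resolve_right fun h => ?_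
    have := (eq_zero_of_pB_ex_t₁_eq_zero (J₂ := J₂) (δ := (0 : Γ)) (k := 1) hJ one_ne_zero (a := 0) (b := 1)
      (by rw [zero_smul, zero_add, one_smul, ex_zero, one_mul, h])).2
    exact one_ne_zero this
  let μ : Γ →+ F :=
    { toFun := C
      map_zero' := h0
      map_add' := fun β γ => by
        by_cases h : (β : F × F).2 = 1 ∧ (γ : F × F).2 = 1
        · have h1 := hadd (β + γ) (-γ) (fun h' => by
            have := h'.1
            simp [h.1, h.2] at this)
          have h2 := hadd γ (-γ) (fun h' => by
            have := h'.2
            rw [AddSubgroup.coe_neg, Prod.snd_neg, h.2] at this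
            have h2 : (2 : F) = 0 := by linear_combination -this
            exact two_ne_zero h2)
          rw [add_neg_cancel_right] at h1
          rw [add_neg_cancel, h0] at h2
          linear_combination h2 - h1
        · exact hadd β γ h }
  refine ⟨μ, LieDerivation_ext_pB fun v hv => ?_⟩
  rw [dHom_pB μ hv]
  refine span_hA (LinearMap.eqLocus (e.toLinearMap ∘ₗ pB Γ J₁ J₂)
    (pB Γ J₁ J₂ ∘ₗ (homDeriv J₁ J₂ μ).toLinearMap)) (fun β v hv => ?_) v
  rw [LinearMap.mem_eqLocus, LinearMap.comp_apply, LinearMap.comp_apply, LieDerivation.coeFn_coe,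
    Derivation.coeFn_coe, mem_scalarLocus.1 (hC β hv), homDeriv_of_mem μ hv, map_smul]
  rfl

/-- The classification of derivations of degree `(0, a)` in the case `J₁ = ℕ`. -/
theorem exists_eq_stdDer_of_top (hJ : J₁.1 = ⊤) {α : Γ} (hα : (α : F × F).1 = 0)
    {d : Der Γ J₁ J₂} (hd : d ∈ derGr Γ J₁ J₂ α) :
    ∃ u ∈ gr Γ J₁ J₂ α, ∃ (μ : Γ →+ F) (f₁ f₄ : F), (α ≠ 0 → μ = 0 ∧ f₄ = 0) ∧
      ((α : F × F) ≠ σ₁ → f₁ = 0) ∧ d = stdDer u μ f₁ 0 0 f₄ := by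
  obtain ⟨u, hu, f, hf, e, he, rfl, h1, ht, y, hy, hty, hy'⟩ := exists_normalized_of_top hJ hα hd
  by_cases h2 : (α : F × F).2 = 0
  · have h0 : α = 0 := Subtype.ext (Prod.ext hα h2)
    subst h0
    obtain ⟨f₄, h4⟩ := exists_isDiagonal hJ he h1 ht
    obtain ⟨μ, hμ⟩ := h4.exists_eq_dHom hJ
    refine ⟨u, hu, μ, f, f₄, fun h => absurd rfl h, hf, ?_⟩
    rw [sub_eq_iff_eq_add] at hμ
    rw [hμ, stdDer, zero_smul, zero_smul, add_zero, add_zero]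
    abel
  · refine ⟨u, hu, 0, f, 0, fun _ => ⟨rfl, rfl⟩, hf, ?_⟩
    have hz : dHom Γ J₁ J₂ 0 = 0 := LieDerivation_ext_pB fun v hv => by
      rw [dHom_pB 0 hv, homDeriv_zero, map_zero, LieDerivation.zero_apply]
    rw [eq_zero_of_normalized hJ hα h2 he h1 ht hty hy', stdDer, hz]
    simp

/-! ### Derivations of degree `(0, a)` in the case `J₁ = {0}` -/

theorem pd₁_of_mem_of_bot (hJ : J₁.1 = ⊥) {β : Γ} {v : SemigroupAlg Γ J₁ J₂}
    (hv : v ∈ hA J₁ J₂ β) : ∂₁ v = (β : F × F).1 • v := by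
  rw [pd₁_of_mem hv, tDeriv₁_eq_zero hJ, add_zero]

theorem br_of_mem (hJ : J₁.1 = ⊥) {β γ : Γ} {u v : SemigroupAlg Γ J₁ J₂} (hu : u ∈ hA J₁ J₂ β)
    (hv : v ∈ hA J₁ J₂ γ) :
    br u v = (β : F × F).1 • (u * 𝔇 v) - (γ : F × F).1 • (v * 𝔇 u) := by
  rw [br_eq, pd₁_of_mem_of_bot hJ hu, pd₁_of_mem_of_bot hJ hv, smul_mul_assoc, smul_mul_assoc]

theorem eq_of_pB_eq {β : Γ} (hβ : (β : F × F).1 ≠ 0) {u v : SemigroupAlg Γ J₁ J₂}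
    (hu : u ∈ hA J₁ J₂ β) (hv : v ∈ hA J₁ J₂ β) (h : pB Γ J₁ J₂ u = pB Γ J₁ J₂ v) : u = v := by
  rw [← sub_eq_zero]
  refine eq_zero_of_pB_eq_zero (fun h => hβ (congrArg Prod.fst h))
    (hA_le_dom_of_fst hβ (Submodule.sub_mem _ hu hv)) (Submodule.sub_mem _ hu hv) ?_
  rw [map_sub, h, sub_self]

/-- The elements of `B` of degree `(0, a)` are determined by their action on `x^{β,0}`. -/
theorem eq_zero_of_lie_ex_eq_zero (hJ : J₁.1 = ⊥) {δ β : Γ} (hδ : (δ : F × F).1 = 0)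
    (hβ : (β : F × F).1 ≠ 0) {b : B Γ J₁ J₂} (hb : b ∈ gr Γ J₁ J₂ δ)
    (h : ⁅b, pB Γ J₁ J₂ (ex β)⁆ = 0) : b = 0 := by
  have hg := ιB_mem_hA hb
  have hne : ((δ + β : Γ) : F × F).1 ≠ 0 := by simpa [hδ] using hβ
  rw [← pB_ιB b, pB_lie (ιB_mem_dom b) (hA_le_dom_of_fst hβ (ex_mem_hA β))] at h
  have h1 := eq_of_pB_eq hne (br_mem hg (ex_mem_hA β)) (Submodule.zero_mem _)
    (h.trans (map_zero _).symm)
  rw [br_of_mem hJ hg (ex_mem_hA β), hδ, zero_smul, zero_sub, neg_eq_zero, smul_eq_zero] at h1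
  have h2 := ex_mul_eq_zero (h1.resolve_left hβ)
  rw [sd₂_apply, sub_eq_zero] at h2
  rw [← pB_ιB b]
  by_cases ha : (δ : F × F).2 = 1
  · have h3 := pd₂_of_mem hg
    rw [h2, ha, one_smul, left_eq_add] at h3
    obtain ⟨c, hc⟩ := exists_eq_smul_ex hg (tDeriv₁_eq_zero hJ _) h3
    have hσ : (δ : F × F) = σ₁ := Prod.ext hδ ha
    rw [hc, map_smul, show ex δ = xA Γ J₁ J₂ σ₁ 0 by
      rw [xA_σ₁ (hσ ▸ δ.2)]; exact congrArg ex (Subtype.ext hσ), pB_xA_σ₁, smul_zero]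
  · rw [eq_zero_of_pd₂_eq hg (c := 1) (Ne.symm ha) (by rw [h2, one_smul]), map_zero]

/-- For `b` of degree `γ` with `γ₁ = 0`, both `x^β` and `[b, x^β]` have degrees with nonzero first
coordinate, so `[d b, x^β] = 0`, and this determines `d b`. -/
theorem eq_zero_of_forall_fst_ne_zero (hJ : J₁.1 = ⊥) {α : Γ} (hα : (α : F × F).1 = 0)
    {d : Der Γ J₁ J₂} (hd : d ∈ derGr Γ J₁ J₂ α)
    (h : ∀ β : Γ, (β : F × F).1 ≠ 0 → ∀ v ∈ hA J₁ J₂ β, d (pB Γ J₁ J₂ v) = 0) : d = 0 := by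
  obtain ⟨β, hβ⟩ := exists_fst_ne_zero (Nondegenerate.proj₁_ne_zero (Γ := Γ) (J₂ := J₂) hJ)
  refine LieDerivation_ext_gr fun γ b hb => ?_
  rw [LieDerivation.zero_apply]
  by_cases hγ : (γ : F × F).1 = 0
  · refine eq_zero_of_lie_ex_eq_zero hJ (δ := α + γ) (by simp [hα, hγ]) hβ
      (mem_derGr.1 hd γ b hb) ?_
    have h1 := d.apply_lie_eq_add b (pB Γ J₁ J₂ (ex β))
    have h2 := lie_mem_gr hb (pB_mem_gr (ex_mem_hA (J₁ := J₁) (J₂ := J₂) β))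
    rw [h β hβ _ (ex_mem_hA β), lie_zero, zero_add, ← pB_ιB ⁅b, _⁆,
      h (γ + β) (by simpa [hγ] using hβ) _ (ιB_mem_hA h2)] at h1
    exact h1.symm
  · rw [← pB_ιB b, h γ hγ _ (ιB_mem_hA hb)]

/-- The lift of a derivation of `B` to the semigroup algebra. -/
def lift (d : Der Γ J₁ J₂) : SemigroupAlg Γ J₁ J₂ →ₗ[F] SemigroupAlg Γ J₁ J₂ :=
  ιB Γ J₁ J₂ ∘ₗ d.toLinearMap ∘ₗ pB Γ J₁ J₂

theorem pB_lift (d : Der Γ J₁ J₂) (v : SemigroupAlg Γ J₁ J₂) :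
    pB Γ J₁ J₂ (lift d v) = d (pB Γ J₁ J₂ v) := pB_ιB _

theorem lift_mem {α β : Γ} {d : Der Γ J₁ J₂} (hd : d ∈ derGr Γ J₁ J₂ α) {v : SemigroupAlg Γ J₁ J₂}
    (hv : v ∈ hA J₁ J₂ β) : lift d v ∈ hA J₁ J₂ (α + β) :=
  ιB_mem_hA (mem_derGr.1 hd β _ (pB_mem_gr hv))

/-- The Leibniz rule lifts from `B` to the semigroup algebra because no dead monomial has a degree
with nonzero first coordinate. -/
theorem lift_br {α β γ : Γ} {d : Der Γ J₁ J₂} (hd : d ∈ derGr Γ J₁ J₂ α)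
    (hα : (α : F × F).1 = 0) (hne : ((β + γ : Γ) : F × F).1 ≠ 0) {u v : SemigroupAlg Γ J₁ J₂}
    (hu : u ∈ hA J₁ J₂ β) (hu' : u ∈ dom Γ J₁ J₂) (hv : v ∈ hA J₁ J₂ γ) (hv' : v ∈ dom Γ J₁ J₂) :
    lift d (br u v) = br (lift d u) v + br u (lift d v) := by
  refine eq_of_pB_eq (β := α + (β + γ)) (by simpa [hα] using hne) (lift_mem hd (br_mem hu hv))
    (Submodule.add_mem _ ?_ ?_) ?_
  · rw [← add_assoc]; exact br_mem (lift_mem hd hu) hv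
  · rw [add_left_comm]; exact br_mem hu (lift_mem hd hv)
  · have hl : ∀ z, lift d z ∈ dom Γ J₁ J₂ := fun z => ιB_mem_dom _
    rw [pB_lift, ← pB_lie hu' hv', map_add, ← pB_lie (hl u) hv', ← pB_lie hu' (hl v),
      d.apply_lie_eq_add, add_comm, pB_lift, pB_lift]

/-- Multiplication by `r` commutes with the lift of `d` up to multiplication by `s`, on the
components of degree `β` with `β₁ ≠ 0`. -/
def IsMult (d : Der Γ J₁ J₂) (r s : SemigroupAlg Γ J₁ J₂) : Prop :=
  ∀ β : Γ, (β : F × F).1 ≠ 0 → ∀ v ∈ hA J₁ J₂ β, lift d (r * v) = s * v + r * lift d v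

namespace IsMult

variable {d : Der Γ J₁ J₂} {r s r' s' : SemigroupAlg Γ J₁ J₂}

theorem add (h : IsMult d r s) (h' : IsMult d r' s') : IsMult d (r + r') (s + s') :=
  fun β hβ v hv => by rw [add_mul, map_add, h β hβ v hv, h' β hβ v hv]; ring

theorem smul (c : F) (h : IsMult d r s) : IsMult d (c • r) (c • s) :=
  fun β hβ v hv => by
    rw [smul_mul_assoc, map_smul, h β hβ v hv, smul_add, smul_mul_assoc, smul_mul_assoc]

theorem one : IsMult d 1 0 := fun β _ v _ => by rw [one_mul, zero_mul, zero_add, one_mul]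

theorem mul (h : IsMult d r s) {γ : Γ} (hγ : (γ : F × F).1 = 0) (hr' : r' ∈ hA J₁ J₂ γ)
    (h' : IsMult d r' s') : IsMult d (r * r') (s * r' + r * s') :=
  fun β hβ v hv => by
    rw [mul_assoc, h (γ + β) (by simpa [hγ] using hβ) _ (mul_mem_hA hr' hv), h' β hβ v hv]
    ring

/-- For `g` with `∂₁ g = 0`, `ad g` acts on degree `β` as multiplication by `-β₁ D g`. Comparing the
Leibniz rule for `[g, v]` with this formula and cancelling `-β₁` gives the multiplier. -/
theorem of_sd₂ (hJ : J₁.1 = ⊥) {α γ : Γ} (hd : d ∈ derGr Γ J₁ J₂ α) (hα : (α : F × F).1 = 0)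
    (hγ : (γ : F × F).1 = 0) {g : SemigroupAlg Γ J₁ J₂} (hg : g ∈ hA J₁ J₂ γ)
    (hg' : g ∈ dom Γ J₁ J₂) : IsMult d (𝔇 g) (𝔇 (lift d g)) := by
  intro β hβ v hv
  have h := lift_br hd hα (by simpa [hγ] using hβ) hg hg' hv (hA_le_dom_of_fst hβ hv)
  rw [br_of_mem hJ hg hv, br_of_mem hJ (lift_mem hd hg) hv, br_of_mem hJ hg (lift_mem hd hv)] at h
  simp only [AddSubgroup.coe_add, Prod.fst_add, hα, hγ, zero_add, zero_smul, zero_sub, map_neg,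
    map_smul, ← neg_add, neg_inj, ← smul_add] at h
  have h' := smul_right_injective _ hβ h
  rw [mul_comm, h']
  ring

theorem mem_hA {α γ : Γ} (hd : d ∈ derGr Γ J₁ J₂ α) (hJ : J₁.1 = ⊥) (h : IsMult d r s)
    (hr : r ∈ hA J₁ J₂ γ) : s ∈ hA J₁ J₂ (α + γ) := by
  obtain ⟨β, hβ⟩ := exists_fst_ne_zero (Nondegenerate.proj₁_ne_zero (Γ := Γ) (J₂ := J₂) hJ)
  have h1 := h β hβ _ (ex_mem_hA β)
  have h2 : s = (lift d (r * ex β) - r * lift d (ex β)) * ex (-β) := by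
    rw [h1, add_sub_cancel_right, mul_assoc, ex_mul_ex_neg, mul_one]
  have h3 : lift d (r * ex β) - r * lift d (ex β) ∈ hA J₁ J₂ (α + (γ + β)) := by
    refine Submodule.sub_mem _ (lift_mem hd (mul_mem_hA hr (ex_mem_hA β))) ?_
    rw [add_left_comm]
    exact mul_mem_hA hr (lift_mem hd (ex_mem_hA β))
  have h4 := mul_mem_hA h3 (ex_mem_hA (J₁ := J₁) (J₂ := J₂) (-β))
  rw [← h2] at h4
  rwa [show α + (γ + β) + -β = α + γ by abel] at h4

end IsMult

/-- Usually `r = D g` with `g` in `dom`. For `J₂ = {0}` this can fail only when `γ₂ = 1`, where `D`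
is not onto, or `γ₂ = 2`, where `g` may not represent an element of `B`. Then `x^γ = x^{3γ}
x^{-2γ}`, and neither factor has second coordinate `1` or `2`. -/
theorem exists_isMult (hJ : J₁.1 = ⊥) {α γ : Γ} {d : Der Γ J₁ J₂} (hd : d ∈ derGr Γ J₁ J₂ α)
    (hα : (α : F × F).1 = 0) (hγ : (γ : F × F).1 = 0) {r : SemigroupAlg Γ J₁ J₂}
    (hr : r ∈ hA J₁ J₂ γ) : ∃ s, IsMult d r s := by
  have key : ∀ η : Γ, (η : F × F).1 = 0 → ((η : F × F).2 ≠ 1 ∨ J₂.1 = ⊤) →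
      ((η : F × F) ≠ σ₂ ∨ J₂.1 = ⊤) → ∀ r ∈ hA J₁ J₂ η, ∃ s, IsMult d r s := by
    intro η hη h1 h2 r hr
    obtain ⟨g, hg, -, rfl⟩ := exists_sd₂_eq h1 hr (tDeriv₁_eq_zero hJ _)
    refine ⟨_, IsMult.of_sd₂ hJ hd hα hη hg ?_⟩
    rcases h2 with h2 | h2
    · exact hA_le_dom h2 hg
    · rw [dom_eq_top fun hs => absurd (h2.symm.trans hs.2.1) top_ne_bot]
      trivial
  by_cases hJ₂ : J₂.1 = ⊤
  · exact key γ hγ (Or.inr hJ₂) (Or.inr hJ₂) r hr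
  by_cases h12 : (γ : F × F).2 = 1 ∨ (γ : F × F).2 = 2
  · obtain ⟨c, rfl⟩ := exists_eq_smul_ex hr (tDeriv₁_eq_zero hJ _)
      (tDeriv₂_eq_zero (J₂.2.resolve_right hJ₂) _)
    have h3 : ((3 • γ : Γ) : F × F).1 = 0 := by simp [hγ]
    have h2 : ((-(2 • γ) : Γ) : F × F).1 = 0 := by simp [hγ]
    have e : γ = 3 • γ + -(2 • γ) := by abel
    obtain ⟨s, hs⟩ := key (3 • γ) h3 (Or.inl fun h => by
        rcases h12 with h' | h' <;> simp [h'] at h <;> norm_num at h)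
      (Or.inl fun h => by
        have h := congrArg Prod.snd h
        rcases h12 with h' | h' <;> simp [h', σ₂] at h) _ (ex_mem_hA _)
    obtain ⟨s', hs'⟩ := key (-(2 • γ)) h2 (Or.inl fun h => by
        rcases h12 with h' | h' <;> simp [h'] at h <;> norm_num [neg_eq_iff_eq_neg] at h)
      (Or.inl fun h => by
        have h := congrArg Prod.snd h
        rcases h12 with h' | h' <;> simp [h', σ₂] at h <;> norm_num [neg_eq_iff_eq_neg] at h) _
      (ex_mem_hA _)
    rw [e, ex_add]
    exact ⟨_, (hs.mul h2 (ex_mem_hA _) hs').smul c⟩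
  · push Not at h12
    exact key γ hγ (Or.inl h12.1) (Or.inl fun h => h12.2 (by rw [h]; rfl)) r hr

/-- The ratio of `d (x^{β,0})` and `x^{β,0}`. -/
def ratio (d : Der Γ J₁ J₂) (β : Γ) : SemigroupAlg Γ J₁ J₂ := lift d (ex β) * ex (-β)

theorem lift_ex (d : Der Γ J₁ J₂) (β : Γ) : lift d (ex β) = ratio d β * ex β := by
  rw [ratio, mul_assoc, mul_comm (ex (-β)), ex_mul_ex_neg, mul_one]

theorem ratio_mem {α : Γ} {d : Der Γ J₁ J₂} (hd : d ∈ derGr Γ J₁ J₂ α) (β : Γ) :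
    ratio d β ∈ hA J₁ J₂ α := by
  have := mul_mem_hA (lift_mem hd (ex_mem_hA β)) (ex_mem_hA (J₁ := J₁) (J₂ := J₂) (-β))
  rwa [add_neg_cancel_right] at this

/-- This is the Leibniz rule for `[x^β, s x^γ]`, with `s` moved through the lift by its multiplier,
divided by `x^{β+γ}`. The freedom in `s` is what later isolates the defect of additivity. -/
theorem ratio_identity (hJ : J₁.1 = ⊥) {α β γ : Γ} {d : Der Γ J₁ J₂} (hd : d ∈ derGr Γ J₁ J₂ α)
    (hα : (α : F × F).1 = 0) (hβ : (β : F × F).1 ≠ 0) (hγ : (γ : F × F).1 ≠ 0)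
    (hβγ : (β : F × F).1 + (γ : F × F).1 ≠ 0) {η : Γ} (hη : (η : F × F).1 = 0)
    {s s' s'' : SemigroupAlg Γ J₁ J₂} (hs : s ∈ hA J₁ J₂ η) (hs' : IsMult d s s')
    (hs'' : IsMult d (∂₂ s) s'') :
    (β : F × F).1 • (s'' - ∂₂ s') + ((β : F × F).1 • ∂₂ s +
        ((β : F × F).1 * ((γ : F × F).2 - 1) - (γ : F × F).1 * ((β : F × F).2 - 1)) • s) *
          (ratio d (β + γ) - ratio d β - ratio d γ) =
      s * ((β : F × F).1 • ∂₂ (ratio d γ) - (γ : F × F).1 • ∂₂ (ratio d β)) := by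
  have hsγ := mul_mem_hA hs (ex_mem_hA (J₁ := J₁) (J₂ := J₂) γ)
  have hηγ : ((η + γ : Γ) : F × F).1 ≠ 0 := by simpa [hη] using hγ
  have h := lift_br hd hα (β := β) (γ := η + γ) (by simpa [hη] using hβγ) (ex_mem_hA β)
    (hA_le_dom_of_fst hβ (ex_mem_hA β)) hsγ (hA_le_dom_of_fst hηγ hsγ)
  have hz := (hs''.smul (β : F × F).1).add (hs'.smul
    ((β : F × F).1 * ((γ : F × F).2 - 1) - (γ : F × F).1 * ((β : F × F).2 - 1)))
  have hbr : br (ex β) (s * ex γ) = ((β : F × F).1 • ∂₂ s +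
        ((β : F × F).1 * ((γ : F × F).2 - 1) - (γ : F × F).1 * ((β : F × F).2 - 1)) • s) *
          ex (β + γ) := by
    rw [br_of_mem hJ (ex_mem_hA β) hsγ, sd₂_mul', sd₂_ex, sd₂_ex, ex_add]
    simp only [AddSubgroup.coe_add, Prod.fst_add, hη, zero_add, Algebra.smul_def, map_sub, map_mul,
      map_one]
    ring
  rw [hbr, hz (β + γ) (by simpa using hβγ) _ (ex_mem_hA _),
    br_of_mem hJ (lift_mem hd (ex_mem_hA β)) hsγ, br_of_mem hJ (ex_mem_hA β) (lift_mem hd hsγ),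
    hs' γ hγ _ (ex_mem_hA γ), lift_ex, lift_ex, lift_ex] at h
  have hl : 𝔇 (s' * ex γ + s * (ratio d γ * ex γ)) =
      (∂₂ s' + ∂₂ s * ratio d γ + s * ∂₂ (ratio d γ) +
        ((γ : F × F).2 - 1) • (s' + s * ratio d γ)) * ex γ := by
    rw [map_add, sd₂_mul', sd₂_mul', sd₂_mul', sd₂_ex]
    simp only [Algebra.smul_def, map_sub, map_one]
    ring
  have hr : 𝔇 (ratio d β * ex β) =
      (∂₂ (ratio d β) + ((β : F × F).2 - 1) • ratio d β) * ex β := by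
    rw [sd₂_mul', sd₂_ex]
    simp only [Algebra.smul_def, map_sub, map_one]
    ring
  rw [hl, hr, sd₂_mul' s, sd₂_ex, sd₂_ex] at h
  rw [← sub_eq_zero]
  refine ex_mul_eq_zero (β := β + γ) ?_
  rw [ex_add] at h ⊢
  simp only [AddSubgroup.coe_add, Prod.fst_add, hη, hα, zero_add, Algebra.smul_def, map_sub,
    map_mul, map_one] at h ⊢
  linear_combination h

/-! ### Extension of additive maps -/

section extend

variable {G : Type*} [AddCommGroup G]

theorem exists_generic {π : G →+ F} (hπ : ∃ β, π β ≠ 0) (s : Finset F) :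
    ∃ θ : G, ∀ c ∈ s, π θ + c ≠ 0 := by
  classical
  obtain ⟨β, hβ⟩ := hπ
  obtain ⟨n, hn⟩ := exists_nsmul_generic hβ (s.image Neg.neg)
  refine ⟨n • β, fun c hc h => hn (Finset.mem_image.2 ⟨c, hc, ?_⟩)⟩
  rw [map_nsmul, nsmul_eq_mul] at h
  linear_combination -h

/-- A map which is additive off the kernel of a nonzero `π` agrees there with an additive map. -/
theorem exists_addMonoidHom_eq {V : Type*} [AddCommGroup V] {π : G →+ F} (hπ : ∃ β, π β ≠ 0)
    {m : G → V} (hm : ∀ β γ, π β ≠ 0 → π γ ≠ 0 → π β + π γ ≠ 0 → m (β + γ) = m β + m γ) :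
    ∃ μ : G →+ V, ∀ γ, π γ ≠ 0 → μ γ = m γ := by
  classical
  -- The difference `m(γ + η) - m(η)` does not depend on the admissible `η`: two choices are
  -- compared through a third, generic `θ`. Its common value defines the extension at every `γ`,
  -- including the kernel of `π`.
  have h1 : ∀ γ, ∃ x, ∀ η, π η ≠ 0 → π γ + π η ≠ 0 → m (γ + η) - m η = x := by
    intro γ
    obtain ⟨η, hη⟩ := exists_generic hπ {0, π γ}
    simp only [Finset.mem_insert, Finset.mem_singleton, forall_eq_or_imp, forall_eq,
      add_zero] at hη
    refine ⟨m (γ + η) - m η, fun ζ hζ hγζ => ?_⟩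
    obtain ⟨θ, hθ⟩ := exists_generic hπ {0, π γ, π γ + π η, π γ + π ζ}
    simp only [Finset.mem_insert, Finset.mem_singleton, forall_eq_or_imp, forall_eq,
      add_zero] at hθ
    obtain ⟨t0, t1, t2, t3⟩ := hθ
    have key : ∀ ξ, π ξ ≠ 0 → π γ + π ξ ≠ 0 → π θ + (π γ + π ξ) ≠ 0 →
        m (γ + ξ) - m ξ = m (γ + θ) - m θ := by
      intro ξ x0 x1 x2
      have e1 := hm (γ + ξ) θ (by rwa [map_add]) t0 (by rwa [map_add, add_comm])
      have e2 := hm (γ + θ) ξ (by rwa [map_add, add_comm]) x0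
        (by rw [map_add]; convert x2 using 1; ring)
      rw [add_right_comm, e1] at e2
      rw [sub_eq_sub_iff_add_eq_add, e2]
    rw [key ζ hζ hγζ t3, key η hη.1 (by rw [add_comm]; exact hη.2) t2]
  choose μ hμ using h1
  have hμm : ∀ γ, π γ ≠ 0 → μ γ = m γ := by
    intro γ hγ
    obtain ⟨η, hη⟩ := exists_generic hπ {0, π γ}
    simp only [Finset.mem_insert, Finset.mem_singleton, forall_eq_or_imp, forall_eq,
      add_zero] at hη
    have h2 : π γ + π η ≠ 0 := by rw [add_comm]; exact hη.2
    rw [← hμ γ η hη.1 h2, hm γ η hγ hη.1 h2, add_sub_cancel_right]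
  refine ⟨AddMonoidHom.mk' μ fun γ δ => ?_, hμm⟩
  obtain ⟨η, hη⟩ := exists_generic hπ {0, π δ, π γ + π δ}
  simp only [Finset.mem_insert, Finset.mem_singleton, forall_eq_or_imp, forall_eq,
    add_zero] at hη
  obtain ⟨t0, t1, t2⟩ := hη
  rw [← hμ (γ + δ) η t0 (by rwa [map_add, add_comm]), ← hμ δ η t0 (by rwa [add_comm]),
    ← hμ γ (δ + η) (by rwa [map_add, add_comm])
      (by rw [map_add]; convert t2 using 1; ring), add_assoc]
  abel

end extend

/-! ### The cocycle attached to a derivation -/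

/-- The defect of additivity of `ratio`. -/
def defect (d : Der Γ J₁ J₂) (β γ : Γ) : SemigroupAlg Γ J₁ J₂ :=
  ratio d (β + γ) - ratio d β - ratio d γ

section cocycle

variable {α : Γ} {d : Der Γ J₁ J₂}

theorem smul_defect (hJ : J₁.1 = ⊥) (hd : d ∈ derGr Γ J₁ J₂ α) (hα : (α : F × F).1 = 0)
    {β γ : Γ} (hβ : (β : F × F).1 ≠ 0) (hγ : (γ : F × F).1 ≠ 0)
    (hβγ : (β : F × F).1 + (γ : F × F).1 ≠ 0) :
    ((β : F × F).1 * ((γ : F × F).2 - 1) - (γ : F × F).1 * ((β : F × F).2 - 1)) • defect d β γ =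
      (β : F × F).1 • ∂₂ (ratio d γ) - (γ : F × F).1 • ∂₂ (ratio d β) := by
  have h0 : IsMult d (∂₂ (1 : SemigroupAlg Γ J₁ J₂)) 0 := by
    rw [Derivation.map_one_eq_zero]
    simpa using (IsMult.one (d := d)).smul 0
  have h := ratio_identity hJ hd hα hβ hγ hβγ (η := 0) rfl one_mem_hA IsMult.one h0
  rw [Derivation.map_one_eq_zero, map_zero, sub_zero, smul_zero, zero_add, zero_add,
    smul_mul_assoc, one_mul, one_mul] at h
  exact h

/-- Subtract `s` times the identity for `s = 1` from the identity for `s`; the terms with the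
derivatives of the ratios cancel. The right side does not involve `β` and `γ`, so the defect is
constant as soon as some `∂₂ s` is not a zero divisor. -/
theorem mul_defect (hJ : J₁.1 = ⊥) (hd : d ∈ derGr Γ J₁ J₂ α) (hα : (α : F × F).1 = 0)
    {β γ : Γ} (hβ : (β : F × F).1 ≠ 0) (hγ : (γ : F × F).1 ≠ 0)
    (hβγ : (β : F × F).1 + (γ : F × F).1 ≠ 0) {η : Γ} (hη : (η : F × F).1 = 0)
    {s s' s'' : SemigroupAlg Γ J₁ J₂} (hs : s ∈ hA J₁ J₂ η) (hs' : IsMult d s s')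
    (hs'' : IsMult d (∂₂ s) s'') : ∂₂ s * defect d β γ = ∂₂ s' - s'' := by
  have h := ratio_identity hJ hd hα hβ hγ hβγ hη hs hs' hs''
  rw [← smul_defect hJ hd hα hβ hγ hβγ] at h
  have h' : (β : F × F).1 • (∂₂ s * defect d β γ) = (β : F × F).1 • (∂₂ s' - s'') := by
    rw [← defect] at h
    simp only [Algebra.smul_def] at h ⊢
    linear_combination h
  exact smul_right_injective _ hβ h'

theorem defect_mem (hd : d ∈ derGr Γ J₁ J₂ α) (β γ : Γ) : defect d β γ ∈ hA J₁ J₂ α :=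
  Submodule.sub_mem _ (Submodule.sub_mem _ (ratio_mem hd _) (ratio_mem hd _)) (ratio_mem hd _)

/-- If the kernel of `∂₁` is not reduced to the scalars then the defect is constant. -/
theorem defect_const (hJ : J₁.1 = ⊥) (hd : d ∈ derGr Γ J₁ J₂ α) (hα : (α : F × F).1 = 0)
    (h : J₂.1 = ⊤ ∨ ∃ η : Γ, (η : F × F).1 = 0 ∧ (η : F × F).2 ≠ 0)
    {β γ β' γ' : Γ} (hβ : (β : F × F).1 ≠ 0) (hγ : (γ : F × F).1 ≠ 0)
    (hβγ : (β : F × F).1 + (γ : F × F).1 ≠ 0) (hβ' : (β' : F × F).1 ≠ 0)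
    (hγ' : (γ' : F × F).1 ≠ 0) (hβγ' : (β' : F × F).1 + (γ' : F × F).1 ≠ 0) :
    defect d β γ = defect d β' γ' := by
  obtain ⟨η, hη, s, hs, hreg⟩ : ∃ η : Γ, (η : F × F).1 = 0 ∧ ∃ s ∈ hA J₁ J₂ η,
      ∀ z, ∂₂ s * z = 0 → z = 0 := by
    rcases h with h | ⟨η, hη, hη'⟩
    · refine ⟨0, rfl, t₂, ?_, fun z hz => ?_⟩
      · simpa [ex_zero] using ex_t_mem_hA (J₁ := J₁) (0 : Γ) (zero_mem _) (j := 1) (by simp [h])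
      · rwa [pd₂_t₂ h, one_mul] at hz
    · refine ⟨η, hη, ex η, ex_mem_hA η, fun z hz => ?_⟩
      rw [pd₂_ex, smul_mul_assoc, smul_eq_zero] at hz
      exact ex_mul_eq_zero (hz.resolve_left hη')
  obtain ⟨s', hs'⟩ := exists_isMult hJ hd hα hη hs
  obtain ⟨s'', hs''⟩ := exists_isMult hJ hd hα hη (pd₂_mem hs)
  rw [← sub_eq_zero]
  apply hreg
  rw [mul_sub, mul_defect hJ hd hα hβ hγ hβγ hη hs hs' hs'',
    mul_defect hJ hd hα hβ' hγ' hβγ' hη hs hs' hs'', sub_self]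

/-- Here `π₁` is injective, so `α = 0` and all ratios are scalars killed by `∂₂`. Hence the defect
vanishes whenever `S(β, γ) = β₁(γ₂ - 1) - γ₁(β₂ - 1)` is nonzero. If `S(β, γ) = 0`, the cocycle
relation among `β`, `γ`, `kβ` expresses the defect by three others. -/
theorem defect_eq_zero_of_trivial (hJ : J₁.1 = ⊥) (hd : d ∈ derGr Γ J₁ J₂ α)
    (hα : (α : F × F).1 = 0) (hJ₂ : J₂.1 = ⊥)
    (hΓ : ∀ η : Γ, (η : F × F).1 = 0 → (η : F × F).2 = 0)
    {β γ : Γ} (hβ : (β : F × F).1 ≠ 0) (hγ : (γ : F × F).1 ≠ 0)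
    (hβγ : (β : F × F).1 + (γ : F × F).1 ≠ 0) : defect d β γ = 0 := by
  classical
  have hr : ∀ β, ∂₂ (ratio d β) = 0 := fun β => by
    rw [pd₂_of_mem (ratio_mem hd β), tDeriv₂_eq_zero hJ₂, hΓ α hα, zero_smul, zero_add]
  have key : ∀ {β γ : Γ}, (β : F × F).1 ≠ 0 → (γ : F × F).1 ≠ 0 →
      (β : F × F).1 + (γ : F × F).1 ≠ 0 →
      (β : F × F).1 * ((γ : F × F).2 - 1) - (γ : F × F).1 * ((β : F × F).2 - 1) ≠ 0 →
      defect d β γ = 0 := by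
    intro β γ hβ hγ hβγ hS
    have h := smul_defect hJ hd hα hβ hγ hβγ
    rw [hr, hr, smul_zero, smul_zero, sub_zero, smul_eq_zero] at h
    exact h.resolve_left hS
  by_cases hS : (β : F × F).1 * ((γ : F × F).2 - 1) - (γ : F × F).1 * ((β : F × F).2 - 1) = 0
  swap
  · exact key hβ hγ hβγ hS
  -- The excluded values of `k` keep the first coordinates of `kβ`, `γ + kβ` and `β + γ + kβ`
  -- nonzero, and also the values of `S` at the other three pairs, which for `S(β, γ) = 0` are, up
  -- to sign, `(k - 1)γ₁ - β₁`, `(k - 1)γ₁` and `kβ₁`.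
  obtain ⟨k, hk⟩ := exists_nsmul_generic (one_ne_zero (α := F)) {0, 1,
    1 + (β : F × F).1 / (γ : F × F).1, -1 - (γ : F × F).1 / (β : F × F).1,
    -(γ : F × F).1 / (β : F × F).1}
  simp only [Finset.mem_insert, Finset.mem_singleton, not_or, mul_one] at hk
  obtain ⟨k0, k1, k2, k3, k4⟩ := hk
  have c1 : ((k • β : Γ) : F × F).1 = k * (β : F × F).1 := by simp
  have c2 : ((k • β : Γ) : F × F).2 = k * (β : F × F).2 := by simp
  have m1 : (k : F) * (β : F × F).1 ≠ 0 := mul_ne_zero k0 hβ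
  have m2 : ((k : F) - 1) * (γ : F × F).1 - (β : F × F).1 ≠ 0 := fun h => k2 (by
    field_simp; linear_combination h)
  have m3 : (β : F × F).1 + (γ : F × F).1 + k * (β : F × F).1 ≠ 0 := fun h => k3 (by
    field_simp; linear_combination h)
  have m4 : (γ : F × F).1 + k * (β : F × F).1 ≠ 0 := fun h => k4 (by
    field_simp; linear_combination h)
  have m5 : ((k : F) - 1) * (γ : F × F).1 ≠ 0 := mul_ne_zero (sub_ne_zero.2 k1) hγ
  have e1 := key (β := β + γ) (γ := k • β) (by simpa using hβγ) (by simpa using m1)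
    (by simpa using m3) (by
      simp only [AddSubgroup.coe_add, Prod.fst_add, Prod.snd_add, c1, c2]
      intro h
      exact m2 (by linear_combination h + k * hS))
  have e2 := key (β := γ) (γ := k • β) hγ (by simpa using m1) (by simpa using m4) (by
      simp only [c1, c2]
      intro h
      exact m5 (by linear_combination h + k * hS))
  have e3 := key (β := β) (γ := γ + k • β) hβ (by simpa using m4)
    (by simpa [add_assoc] using m3) (by
      simp only [AddSubgroup.coe_add, Prod.fst_add, Prod.snd_add, c1, c2]
      intro h
      exact m1 (by linear_combination h - hS))
  rw [defect] at e1 e2 e3 ⊢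
  rw [← add_assoc] at e3
  linear_combination e3 + e2 - e1

/-- When the defect is a constant `K`, the identity for the pair `β₀, 2β₀` reads `K = ∂₂ K`, since
`K` is also `ratio(2β₀) - 2 ratio(β₀)`. In degree `(0, a)` this forces `K = 0` unless `a = 1`, and
then `K` is a multiple of `x^{σ₁}`. -/
theorem exists_defect_eq (hJ : J₁.1 = ⊥) (hd : d ∈ derGr Γ J₁ J₂ α) (hα : (α : F × F).1 = 0) :
    ∃ h : F, ((α : F × F) ≠ σ₁ → h = 0) ∧ ∀ β γ : Γ, (β : F × F).1 ≠ 0 → (γ : F × F).1 ≠ 0 →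
      (β : F × F).1 + (γ : F × F).1 ≠ 0 → defect d β γ = h • ex α := by
  by_cases hR : J₂.1 = ⊤ ∨ ∃ η : Γ, (η : F × F).1 = 0 ∧ (η : F × F).2 ≠ 0
  · obtain ⟨β₀, h₀⟩ := exists_fst_ne_zero (Nondegenerate.proj₁_ne_zero (Γ := Γ) (J₂ := J₂) hJ)
    have h1 : (β₀ : F × F).1 + (β₀ : F × F).1 ≠ 0 := by
      rw [← two_mul]; exact mul_ne_zero two_ne_zero h₀
    have h2 : ((β₀ + β₀ : Γ) : F × F).1 ≠ 0 := h1
    have h3 : (β₀ : F × F).1 + ((β₀ + β₀ : Γ) : F × F).1 ≠ 0 := by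
      have : (β₀ : F × F).1 + ((β₀ + β₀ : Γ) : F × F).1 = 3 * (β₀ : F × F).1 := by
        simp only [AddSubgroup.coe_add, Prod.fst_add]; ring
      rw [this]
      exact mul_ne_zero three_ne_zero h₀
    have e := smul_defect hJ hd hα h₀ h2 h3
    have hK := defect_mem hd β₀ β₀
    have e2 : ∂₂ (defect d β₀ β₀) = defect d β₀ β₀ := by
      rw [defect_const hJ hd hα hR h₀ h2 h3 h₀ h₀ h1] at e
      refine smul_right_injective _ h₀ ?_
      conv_lhs => rw [defect, map_sub, map_sub]
      simp only [AddSubgroup.coe_add, Prod.fst_add, Prod.snd_add, Algebra.smul_def, map_sub,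
        map_mul, map_add, map_one] at e ⊢
      linear_combination -e
    by_cases ha : (α : F × F).2 = 1
    · have hσ : (α : F × F) = σ₁ := Prod.ext hα ha
      rw [pd₂_of_mem hK, ha, one_smul, add_eq_left] at e2
      obtain ⟨h, hh⟩ := exists_eq_smul_ex hK (tDeriv₁_eq_zero hJ _) e2
      exact ⟨h, fun h' => absurd hσ h', fun β γ hβ hγ hβγ => by
        rw [← hh, defect_const hJ hd hα hR hβ hγ hβγ h₀ h₀ h1]⟩
    · refine ⟨0, fun _ => rfl, fun β γ hβ hγ hβγ => ?_⟩
      rw [defect_const hJ hd hα hR hβ hγ hβγ h₀ h₀ h1,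
        eq_zero_of_pd₂_eq hK (c := 1) (Ne.symm ha) (by rw [e2, one_smul]), zero_smul]
  · push Not at hR
    exact ⟨0, fun _ => rfl, fun β γ hβ hγ hβγ => by
      rw [zero_smul, defect_eq_zero_of_trivial hJ hd hα (J₂.2.resolve_right hR.1) hR.2 hβ hγ hβγ]⟩

/-- After subtracting a multiple of `dBar₁`, the defect vanishes. -/
theorem exists_sub_dBar₁ (hJ : J₁.1 = ⊥) (hd : d ∈ derGr Γ J₁ J₂ α) (hα : (α : F × F).1 = 0) :
    ∃ h : F, ((α : F × F) ≠ σ₁ → h = 0) ∧ d - h • dBar₁ Γ J₁ J₂ ∈ derGr Γ J₁ J₂ α ∧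
      ∀ β γ : Γ, (β : F × F).1 ≠ 0 → (γ : F × F).1 ≠ 0 →
      (β : F × F).1 + (γ : F × F).1 ≠ 0 → defect (d - h • dBar₁ Γ J₁ J₂) β γ = 0 := by
  obtain ⟨h, h1, h2⟩ := exists_defect_eq hJ hd hα
  refine ⟨h, h1, ?_⟩
  by_cases hσ : (α : F × F) = σ₁
  · have hB := dBar₁_mem_derGr (J₁ := J₁) (J₂ := J₂) hσ
    refine ⟨Submodule.sub_mem _ hd (Submodule.smul_mem _ _ hB), fun β γ hβ hγ hβγ => ?_⟩
    have hx : xA Γ J₁ J₂ σ₁ 0 = ex α := by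
      rw [xA_σ₁ (hσ ▸ α.2)]; exact congrArg ex (Subtype.ext hσ.symm)
    -- The ratio of `dBar₁` at `β` is `(β₂ - 1) x^{σ₁}`, so its defect is `(β₂ + γ₂ - 1) - (β₂ - 1)
    -- - (γ₂ - 1) = 1` times `x^{σ₁}`.
    have hr : ∀ β : Γ, (β : F × F).1 ≠ 0 → ratio (d - h • dBar₁ Γ J₁ J₂) β =
        ratio d β - (h * ((β : F × F).2 - 1)) • ex α := by
      intro β hβ
      have e : lift (dBar₁ Γ J₁ J₂) (ex β) = ((β : F × F).2 - 1) • (ex α * ex β) := by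
        refine eq_of_pB_eq (β := α + β) (by simpa [hα] using hβ) (lift_mem hB (ex_mem_hA β))
          (Submodule.smul_mem _ _ (mul_mem_hA (ex_mem_hA α) (ex_mem_hA β))) ?_
        rw [pB_lift, dBar₁_pB hJ (hA_le_dom_of_fst hβ (ex_mem_hA β)), hx, sd₂_ex, mul_smul_comm]
      have e' : lift (d - h • dBar₁ Γ J₁ J₂) (ex β) =
          lift d (ex β) - h • lift (dBar₁ Γ J₁ J₂) (ex β) := by
        simp only [lift, LinearMap.comp_apply, LieDerivation.coeFn_coe, LieDerivation.sub_apply,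
          LieDerivation.smul_apply, map_sub, map_smul]
      rw [ratio, e', e, smul_smul, sub_mul, ← ratio, smul_mul_assoc, mul_assoc, ex_mul_ex_neg,
        mul_one]
    have h3 := h2 β γ hβ hγ hβγ
    rw [defect] at h3 ⊢
    rw [hr β hβ, hr γ hγ, hr (β + γ) (by simpa using hβγ)]
    simp only [AddSubgroup.coe_add, Prod.snd_add, Algebra.smul_def, map_sub, map_mul,
      map_add, map_one] at h3 ⊢
    linear_combination h3
  · rw [h1 hσ, zero_smul, sub_zero]
    refine ⟨hd, fun β γ hβ hγ hβγ => ?_⟩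
    rw [h2 β γ hβ hγ hβγ, h1 hσ, zero_smul]

end cocycle

/-! ### Derivations with vanishing defect. -/

section additive

variable {α : Γ} {d : Der Γ J₁ J₂}

/-- An element of the kernel of `∂₂` of degree `(0, a)` is a scalar, zero if `a ≠ 0`. -/
theorem exists_eq_smul_one_of_pd₂ (hJ : J₁.1 = ⊥) (hα : (α : F × F).1 = 0)
    {v : SemigroupAlg Γ J₁ J₂} (hv : v ∈ hA J₁ J₂ α) (h : ∂₂ v = 0) :
    ∃ f : F, (α ≠ 0 → f = 0) ∧ v = f • 1 := by
  by_cases h0 : α = 0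
  · subst h0
    rw [pd₂_of_mem hv, ZeroMemClass.coe_zero, Prod.snd_zero, zero_smul, zero_add] at h
    obtain ⟨f, hf⟩ := exists_eq_smul_ex hv (tDeriv₁_eq_zero hJ _) h
    exact ⟨f, fun h => absurd rfl h, by rw [hf, ex_zero]⟩
  · refine ⟨0, fun _ => rfl, ?_⟩
    rw [zero_smul]
    exact eq_zero_of_pd₂_eq hv (c := 0)
      (fun h => h0 (Subtype.ext (Prod.ext hα h.symm))) (by rw [h, zero_smul])

/-- With zero defect, `mul_defect` for `s = t₂` says that `∂₂` kills the multiplier of `t₂`, because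
`∂₂ t₂ = 1` has multiplier `0`. So the multiplier is a scalar `f`, and the product rule for
multipliers gives the powers. -/
theorem exists_isMult_t₂ (hJ : J₁.1 = ⊥) (hd : d ∈ derGr Γ J₁ J₂ α) (hα : (α : F × F).1 = 0)
    (h : ∀ β γ : Γ, (β : F × F).1 ≠ 0 → (γ : F × F).1 ≠ 0 →
      (β : F × F).1 + (γ : F × F).1 ≠ 0 → defect d β γ = 0) :
    ∃ f : F, (α ≠ 0 → f = 0) ∧ ∀ j : ℕ, IsMult d (t₂ ^ j) (f • tDeriv₂ _ _ _ (t₂ ^ j)) := by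
  obtain ⟨f, hf, h1⟩ : ∃ f : F, (α ≠ 0 → f = 0) ∧ IsMult d t₂ (f • tDeriv₂ _ _ _ t₂) := by
    by_cases hJ₂ : J₂.1 = ⊥
    · refine ⟨0, fun _ => rfl, ?_⟩
      rw [t₂_eq_zero hJ₂]
      simpa using (IsMult.one (d := d)).smul 0
    · have hJ₂' := ExpMonoid.eq_top_of_ne_bot hJ₂
      have ht : (t₂ : SemigroupAlg Γ J₁ J₂) ∈ hA J₁ J₂ 0 := by
        simpa [ex_zero] using
          ex_t_mem_hA (J₁ := J₁) (0 : Γ) (zero_mem _) (j := 1) (by simp [hJ₂'])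
      obtain ⟨s, hs⟩ := exists_isMult hJ hd hα (γ := 0) rfl ht
      obtain ⟨β₀, h₀⟩ := exists_fst_ne_zero (Nondegenerate.proj₁_ne_zero (Γ := Γ) (J₂ := J₂) hJ)
      have h1 : (β₀ : F × F).1 + (β₀ : F × F).1 ≠ 0 := by
        rw [← two_mul]; exact mul_ne_zero two_ne_zero h₀
      have e := mul_defect hJ hd hα h₀ h₀ h1 (η := 0) rfl ht hs (by
        rw [pd₂_t₂ hJ₂']; exact IsMult.one)
      rw [h β₀ β₀ h₀ h₀ h1, mul_zero, sub_zero] at e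
      have hs' := hs.mem_hA hd hJ ht
      rw [add_zero] at hs'
      obtain ⟨f, hf, rfl⟩ := exists_eq_smul_one_of_pd₂ hJ hα hs' e.symm
      exact ⟨f, hf, by rwa [tDeriv₂_t₂ hJ₂']⟩
  refine ⟨f, hf, fun j => ?_⟩
  induction j with
  | zero => simpa using IsMult.one (d := d)
  | succ j ih =>
    by_cases hJ₂ : J₂.1 = ⊥
    · rw [t₂_eq_zero hJ₂, zero_pow j.succ_ne_zero, map_zero, smul_zero]
      simpa using (IsMult.one (d := d)).smul 0
    have ht : (t₂ : SemigroupAlg Γ J₁ J₂) ∈ hA J₁ J₂ 0 := by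
      simpa [ex_zero] using ex_t_mem_hA (J₁ := J₁) (0 : Γ) (zero_mem _) (j := 1)
        (by simp [ExpMonoid.eq_top_of_ne_bot hJ₂])
    have := ih.mul (γ := 0) rfl ht h1
    rw [pow_succ, Derivation.leibniz]
    convert this using 1
    simp only [smul_eq_mul, Algebra.smul_def]
    ring

/-- Put `w = ratio(β₀) / (β₀)₁`. The identity for the pair `β₀, γ` gives `∂₂(ratio γ) = γ₁ ∂₂ w`, so
`ratio γ - γ₁ w` is a scalar, zero if `α ≠ 0`. These scalars are additive off the kernel of `π₁` and
extend to `Γ`. -/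
theorem exists_ratio_eq (hJ : J₁.1 = ⊥) (hd : d ∈ derGr Γ J₁ J₂ α) (hα : (α : F × F).1 = 0)
    (h : ∀ β γ : Γ, (β : F × F).1 ≠ 0 → (γ : F × F).1 ≠ 0 →
      (β : F × F).1 + (γ : F × F).1 ≠ 0 → defect d β γ = 0) :
    ∃ w ∈ hA J₁ J₂ α, ∃ μ : Γ →+ F, (α ≠ 0 → μ = 0) ∧
      ∀ γ : Γ, (γ : F × F).1 ≠ 0 → ratio d γ = (γ : F × F).1 • w + μ γ • 1 := by
  obtain ⟨β₀, h₀⟩ := exists_fst_ne_zero (Nondegenerate.proj₁_ne_zero (Γ := Γ) (J₂ := J₂) hJ)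
  obtain ⟨w, hw⟩ : ∃ w, w = ((β₀ : F × F).1)⁻¹ • ratio d β₀ := ⟨_, rfl⟩
  have hwm : w ∈ hA J₁ J₂ α := hw ▸ Submodule.smul_mem _ _ (ratio_mem hd _)
  have h1 : ∀ γ : Γ, (γ : F × F).1 ≠ 0 → (β₀ : F × F).1 + (γ : F × F).1 ≠ 0 →
      ∂₂ (ratio d γ) = (γ : F × F).1 • ∂₂ w := by
    intro γ hγ hβγ
    have e := smul_defect hJ hd hα h₀ hγ hβγ
    rw [h β₀ γ h₀ hγ hβγ, smul_zero, eq_comm, sub_eq_zero] at e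
    rw [hw, Derivation.map_smul, smul_comm, ← e, smul_smul, inv_mul_cancel₀ h₀, one_smul]
  have h2 : ∀ γ : Γ, (γ : F × F).1 ≠ 0 → ∂₂ (ratio d γ - (γ : F × F).1 • w) = 0 := by
    intro γ hγ
    rw [map_sub, Derivation.map_smul, sub_eq_zero]
    -- If `γ₁ = -(β₀)₁`, the pair `β₀, γ` is not admissible. The result for `2γ` applies instead,
    -- and `ratio(2γ) = 2 ratio(γ)`.
    by_cases hβγ : (β₀ : F × F).1 + (γ : F × F).1 = 0
    · have g2 : (γ : F × F).1 + (γ : F × F).1 ≠ 0 := by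
        rw [← two_mul]; exact mul_ne_zero two_ne_zero hγ
      have e1 := h1 (γ + γ) (by simpa using g2) (by
        simp only [AddSubgroup.coe_add, Prod.fst_add, ← add_assoc, hβγ, zero_add]; exact hγ)
      have e2 := h γ γ hγ hγ g2
      rw [defect, sub_sub, sub_eq_zero] at e2
      rw [e2, AddSubgroup.coe_add, Prod.fst_add, map_add, add_smul, ← two_smul F, ← two_smul F] at e1
      exact smul_right_injective _ two_ne_zero e1
    · exact h1 γ hγ hβγ
  have h3 : ∀ γ : Γ, ∃ f : F, (α ≠ 0 → f = 0) ∧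
      ((γ : F × F).1 ≠ 0 → ratio d γ - (γ : F × F).1 • w = f • 1) := by
    intro γ
    by_cases hγ : (γ : F × F).1 = 0
    · exact ⟨0, fun _ => rfl, fun h => absurd hγ h⟩
    · obtain ⟨f, hf, e⟩ := exists_eq_smul_one_of_pd₂ hJ hα
        (Submodule.sub_mem _ (ratio_mem hd γ) (Submodule.smul_mem _ _ hwm)) (h2 γ hγ)
      exact ⟨f, hf, fun _ => e⟩
  choose m hm0 hm using h3
  by_cases h0 : α = 0
  · obtain ⟨μ, hμ⟩ := exists_addMonoidHom_eq (π := proj₁ Γ) ⟨β₀, h₀⟩ (m := m) (by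
      intro β γ hβ hγ hβγ
      have e1 := hm (β + γ) hβγ
      have e2 := h β γ hβ hγ hβγ
      rw [defect, sub_sub, sub_eq_zero] at e2
      have e3 : (m (β + γ) - (m β + m γ)) • (1 : SemigroupAlg Γ J₁ J₂) = 0 := by
        rw [sub_smul, add_smul, ← e1, ← hm β hβ, ← hm γ hγ, e2, AddSubgroup.coe_add, Prod.fst_add,
          add_smul]
        abel
      rw [← ex_zero] at e3
      exact sub_eq_zero.1 ((smul_eq_zero.1 e3).resolve_right (ex_ne_zero _)))
    refine ⟨w, hwm, μ, fun h => absurd h0 h, fun γ hγ => ?_⟩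
    rw [hμ γ hγ, ← hm γ hγ]
    abel
  · refine ⟨w, hwm, 0, fun _ => rfl, fun γ hγ => ?_⟩
    have e := hm γ hγ
    rw [hm0 γ h0, zero_smul, sub_eq_zero] at e
    rw [e, AddMonoidHom.zero_apply, zero_smul, add_zero]

theorem exists_lift_eq (hJ : J₁.1 = ⊥) (hd : d ∈ derGr Γ J₁ J₂ α) (hα : (α : F × F).1 = 0)
    (h : ∀ β γ : Γ, (β : F × F).1 ≠ 0 → (γ : F × F).1 ≠ 0 →
      (β : F × F).1 + (γ : F × F).1 ≠ 0 → defect d β γ = 0) :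
    ∃ w ∈ hA J₁ J₂ α, ∃ (μ : Γ →+ F) (f : F), (α ≠ 0 → μ = 0 ∧ f = 0) ∧
      ∀ β : Γ, (β : F × F).1 ≠ 0 → ∀ v ∈ hA J₁ J₂ β, lift d v = opA 0 (-w) μ f v := by
  obtain ⟨f, hf, hf'⟩ := exists_isMult_t₂ hJ hd hα h
  obtain ⟨w, hw, μ, hμ, hμ'⟩ := exists_ratio_eq hJ hd hα h
  refine ⟨w, hw, μ, f, fun h => ⟨hμ h, hf h⟩, fun β hβ v hv => ?_⟩
  refine hA_induction (LinearMap.eqLocus (lift d) (opA 0 (-w) μ f)) (fun i j hi hj => ?_) hv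
  rw [hJ, AddSubmonoid.mem_bot] at hi
  have hm : (ex β * t₁ ^ i * t₂ ^ j : SemigroupAlg Γ J₁ J₂) ∈ hA J₁ J₂ β :=
    ex_t_mem_hA β (by rw [hi]; exact zero_mem _) hj
  rw [LinearMap.mem_eqLocus, opA_apply, homDeriv_of_mem μ hm, pd₁_of_mem_of_bot hJ hm, hi,
    pow_zero, mul_one, mul_comm (ex β), hf' j β hβ _ (ex_mem_hA β), lift_ex, hμ' β hβ,
    Derivation.leibniz, tDeriv₂_ex]
  simp only [smul_eq_mul, Algebra.smul_def]
  ring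

end additive

/-- Multiplication of `∂₁` by an element of degree `(0, a)` is a standard derivation. -/
theorem exists_stdDer_eq_mul_pd₁ (hJ : J₁.1 = ⊥) {α : Γ} (hα : (α : F × F).1 = 0)
    {w : SemigroupAlg Γ J₁ J₂} (hw : w ∈ hA J₁ J₂ α) :
    ∃ u ∈ gr Γ J₁ J₂ α, ∃ f₁ f₃ : F, ((α : F × F) ≠ σ₁ → f₁ = 0) ∧
      ((α : F × F) ≠ σ₂ → f₃ = 0) ∧ ∀ v ∈ dom Γ J₁ J₂,
        (adB u + f₁ • d₁ Γ J₁ J₂ + f₃ • d₂ Γ J₁ J₂) (pB Γ J₁ J₂ v) = pB Γ J₁ J₂ (w * ∂₁ v) := by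
  -- If `D u = -w` with `∂₁ u = 0`, then `ad_u = w ∂₁`. For `J₂ = {0}` this breaks down in degree
  -- `σ₁`, where `D` vanishes, and possibly in degree `σ₂`, where `u` need not represent an element
  -- of `B`; there `d₁` and `d₂` take over.
  by_cases hJ₂ : J₂.1 = ⊥ ∧ ((α : F × F) = σ₁ ∨ (α : F × F) = σ₂)
  · obtain ⟨c, rfl⟩ := exists_eq_smul_ex hw (tDeriv₁_eq_zero hJ _) (tDeriv₂_eq_zero hJ₂.1 _)
    rcases hJ₂.2 with hσ | hσ
    · refine ⟨0, Submodule.zero_mem _, -c, 0, fun h => absurd hσ h, fun _ => rfl, fun v hv => ?_⟩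
      have hx : xA Γ J₁ J₂ σ₁ 0 = ex α := by
        rw [xA_σ₁ (hσ ▸ α.2)]; exact congrArg ex (Subtype.ext hσ.symm)
      rw [adB_zero, zero_add, zero_smul, add_zero, LieDerivation.smul_apply, d₁_pB hJ₂.1 hv, hx,
        map_neg, neg_smul_neg, smul_mul_assoc, map_smul]
    · refine ⟨0, Submodule.zero_mem _, 0, -c, fun _ => rfl, fun h => absurd hσ h, fun v hv => ?_⟩
      have hx : xA Γ J₁ J₂ σ₂ 0 = ex α := by
        rw [show (σ₂ : F × F) = α from hσ.symm]
        exact xA_of_mem (α, 0, 0)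
      have hb : br (ex α) v = -(ex α * ∂₁ v) := by
        rw [br_eq, pd₁_ex, hα, zero_smul, zero_mul, zero_sub, sd₂_ex, hσ, σ₂]
        norm_num [mul_comm]
      rw [adB_zero, zero_add, zero_smul, zero_add, LieDerivation.smul_apply,
        d₂_pB ⟨hJ, hJ₂.1⟩ hv, hx, hb, map_neg, neg_smul_neg, smul_mul_assoc, map_smul]
  · have hs : (α : F × F).2 ≠ 1 ∨ J₂.1 = ⊤ := by
      by_contra! hh
      exact hJ₂ ⟨J₂.2.resolve_right hh.2, Or.inl (Prod.ext hα hh.1)⟩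
    obtain ⟨u, hu, -, hu'⟩ := exists_sd₂_eq hs (Submodule.neg_mem _ hw) (tDeriv₁_eq_zero hJ _)
    have hd : u ∈ dom Γ J₁ J₂ := by
      by_cases hσ : (α : F × F) = σ₂
      · rw [dom_eq_top fun hS => hJ₂ ⟨hS.2.1, Or.inr hσ⟩]
        trivial
      · exact hA_le_dom hσ hu
    refine ⟨pB Γ J₁ J₂ u, pB_mem_gr hu, 0, 0, fun _ => rfl, fun _ => rfl, fun v hv => ?_⟩
    rw [zero_smul, zero_smul, add_zero, add_zero, adB_pB hd hv, br_eq, hu',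
      pd₁_of_mem_of_bot hJ hu, hα]
    congr 1
    rw [zero_smul]
    ring

/-- The classification of derivations of degree `(0, a)` in the case `J₁ = {0}`. -/
theorem exists_eq_stdDer_of_bot (hJ : J₁.1 = ⊥) {α : Γ} (hα : (α : F × F).1 = 0)
    {d : Der Γ J₁ J₂} (hd : d ∈ derGr Γ J₁ J₂ α) :
    ∃ u ∈ gr Γ J₁ J₂ α, ∃ (μ : Γ →+ F) (f₁ f₂ f₃ f₄ : F), (α ≠ 0 → μ = 0 ∧ f₄ = 0) ∧
      ((α : F × F) ≠ σ₁ → f₁ = 0 ∧ f₂ = 0) ∧ ((α : F × F) ≠ σ₂ → f₃ = 0) ∧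
        d = stdDer u μ f₁ f₂ f₃ f₄ := by
  obtain ⟨f₂, h2, hd', hdef⟩ := exists_sub_dBar₁ hJ hd hα
  obtain ⟨w, hw, μ, f₄, h4, hl⟩ := exists_lift_eq hJ hd' hα hdef
  obtain ⟨u, hu, f₁, f₃, h1, h3, hs⟩ := exists_stdDer_eq_mul_pd₁ hJ hα hw
  have h12 : (α : F × F) ≠ σ₁ → f₁ = 0 ∧ f₂ = 0 := fun h => ⟨h1 h, h2 h⟩
  refine ⟨u, hu, μ, f₁, f₂, f₃, f₄, h4, h12, h3, ?_⟩
  rw [← sub_eq_zero]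
  -- It suffices to compare both sides in degrees with nonzero first coordinate, which is where the
  -- lift was computed.
  refine eq_zero_of_forall_fst_ne_zero hJ hα
    (Submodule.sub_mem _ hd (stdDer_mem_derGr hu h4 h12 h3)) fun β hβ v hv => ?_
  have hv' := hA_le_dom_of_fst hβ hv
  have e := hl β hβ v hv
  have e2 : d - stdDer u μ f₁ f₂ f₃ f₄ = (d - f₂ • dBar₁ Γ J₁ J₂) -
      ((adB u + f₁ • d₁ Γ J₁ J₂ + f₃ • d₂ Γ J₁ J₂) + dHom Γ J₁ J₂ μ + f₄ • dt₂ Γ J₁ J₂) := by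
    rw [stdDer]; abel
  have e3 := hs v hv'
  generalize adB u + f₁ • d₁ Γ J₁ J₂ + f₃ • d₂ Γ J₁ J₂ = X at e2 e3
  rw [e2, LieDerivation.sub_apply, ← pB_lift, e, LieDerivation.add_apply,
    LieDerivation.add_apply, e3, dHom_pB μ hv', LieDerivation.smul_apply, dt₂_pB hv', opA_apply]
  simp only [map_add, map_sub, map_smul, neg_mul, zero_mul, map_zero, map_neg]
  abel

/-! ### The classification -/

theorem dHom_add (μ ν : Γ →+ F) :
    dHom Γ J₁ J₂ (μ + ν) = dHom Γ J₁ J₂ μ + dHom Γ J₁ J₂ ν :=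
  LieDerivation_ext_pB fun v hv => by
    rw [LieDerivation.add_apply, dHom_pB _ hv, dHom_pB _ hv, dHom_pB _ hv, homDeriv_add, map_add]

theorem dHom_smul (c : F) (μ : Γ →+ F) :
    dHom Γ J₁ J₂ (c • μ) = c • dHom Γ J₁ J₂ μ :=
  LieDerivation_ext_pB fun v hv => by
    rw [LieDerivation.smul_apply, dHom_pB _ hv, dHom_pB _ hv, homDeriv_smul, map_smul]

theorem dHom_zero : dHom Γ J₁ J₂ 0 = 0 := by
  rw [← zero_smul F (0 : Γ →+ F), dHom_smul, zero_smul]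

theorem dHom_proj₁ (hJ : J₁.1 = ⊥) : dHom Γ J₁ J₂ (proj₁ Γ) = adB (pB Γ J₁ J₂ 1) :=
  LieDerivation_ext_pB fun v hv => by
    rw [dHom_pB _ hv, adB_one_pB hv, pd₁, Derivation.add_apply, tDeriv₁_eq_zero hJ, add_zero]

theorem exists_eq_stdDer {α : Γ} {d : Der Γ J₁ J₂} (hd : d ∈ derGr Γ J₁ J₂ α) :
    ∃ u ∈ gr Γ J₁ J₂ α, ∃ (μ : Γ →+ F) (f₁ f₂ f₃ f₄ : F), (α ≠ 0 → μ = 0 ∧ f₄ = 0) ∧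
      ((α : F × F) ≠ σ₁ → f₁ = 0 ∧ f₂ = 0) ∧ ((α : F × F) ≠ σ₂ → f₃ = 0) ∧
        d = stdDer u μ f₁ f₂ f₃ f₄ := by
  by_cases hα : (α : F × F).1 = 0
  · rcases J₁.2 with hJ | hJ
    · exact exists_eq_stdDer_of_bot hJ hα hd
    · obtain ⟨u, hu, μ, f₁, f₄, h0, h1, rfl⟩ := exists_eq_stdDer_of_top hJ hα hd
      exact ⟨u, hu, μ, f₁, 0, 0, f₄, h0, fun h => ⟨h1 h, rfl⟩, fun _ => rfl, rfl⟩
  · obtain ⟨u, hu, rfl⟩ := exists_eq_adB_of_fst_ne_zero hα hd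
    exact ⟨u, hu, 0, 0, 0, 0, 0, fun _ => ⟨rfl, rfl⟩, fun _ => ⟨rfl, rfl⟩, fun _ => rfl, by
      simp [stdDer, dHom_zero]⟩

/-- Modulo a multiple of `ad 1`, `μ` can be chosen in `Hom*`. -/
theorem exists_dHom_eq {H : Submodule F (Γ →+ F)} (hH : IsHomStar J₁ H) (μ : Γ →+ F) :
    ∃ (k : F), ∃ ν ∈ H, dHom Γ J₁ J₂ μ = k • adB (pB Γ J₁ J₂ 1) + dHom Γ J₁ J₂ ν := by
  by_cases h : proj₁ Γ ≠ 0 ∧ J₁.1 = ⊥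
  · have hm : μ ∈ (F ∙ proj₁ Γ) ⊔ H := by rw [(hH.1 h).sup_eq_top]; trivial
    obtain ⟨_, h1, ν, hν, rfl⟩ := Submodule.mem_sup.1 hm
    obtain ⟨k, rfl⟩ := Submodule.mem_span_singleton.1 h1
    exact ⟨k, ν, hν, by rw [dHom_add, dHom_smul, dHom_proj₁ h.2]⟩
  · exact ⟨0, μ, by rw [hH.2 h]; trivial, by rw [zero_smul, zero_add]⟩

theorem derGr_eq {H : Submodule F (Γ →+ F)} (hH : IsHomStar J₁ H) (α : Γ) :
    (derGr Γ J₁ J₂ α : Set (Der Γ J₁ J₂)) =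
      {d | ∃ u ∈ gr Γ J₁ J₂ α, ∃ μ ∈ H, ∃ f₁ f₂ f₃ f₄ : F, (α ≠ 0 → μ = 0 ∧ f₄ = 0) ∧
        ((α : F × F) ≠ σ₁ → f₁ = 0 ∧ f₂ = 0) ∧ ((α : F × F) ≠ σ₂ → f₃ = 0) ∧
        d = stdDer u μ f₁ f₂ f₃ f₄} := by
  ext d
  constructor
  · intro hd
    obtain ⟨u, hu, μ, f₁, f₂, f₃, f₄, h0, h1, h2, rfl⟩ := exists_eq_stdDer hd
    by_cases hα : α = 0
    · subst hα
      -- In degree `0` the component of `μ` along `π₁` is absorbed into the inner part through `ad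
      -- 1`.
      obtain ⟨k, ν, hν, e⟩ := exists_dHom_eq (J₂ := J₂) hH μ
      refine ⟨u + k • pB Γ J₁ J₂ 1, Submodule.add_mem _ hu (Submodule.smul_mem _ _
        (pB_mem_gr one_mem_hA)), ν, hν, f₁, f₂, f₃, f₄, fun h => absurd rfl h, h1, h2, ?_⟩
      rw [stdDer, stdDer, e, adB_add, adB_smul]
      abel
    · exact ⟨u, hu, μ, by rw [(h0 hα).1]; exact H.zero_mem, f₁, f₂, f₃, f₄, h0, h1, h2, rfl⟩
  · rintro ⟨u, hu, μ, -, f₁, f₂, f₃, f₄, h0, h1, h2, rfl⟩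
    exact stdDer_mem_derGr hu h0 h1 h2

/-- In these degrees the derivation is `ad_u`, and its vanishing at `1` means `∂₁ u = 0`, which
leaves `α₁ = 0` as the only case with `u ≠ 0` when `J₁ = {0}`; bracketing with some `x^β`, `β₁ ≠ 0`,
excludes it. When `J₁ = ℕ`, the value at `t₁` is `-D u`, and `∂₁ u = D u = 0` is impossible for `u ≠
0` unless `α = σ₁`. -/
theorem exists_eq_zero_of_apply_eq_zero (Γ : AddSubgroup (F × F)) (J₁ J₂ : ExpMonoid)
    [Nondegenerate Γ J₁ J₂] : ∃ β : Γ, ∃ y ∈ gr Γ J₁ J₂ β, ∀ α : Γ, (α : F × F) ≠ 0 →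
      (α : F × F) ≠ σ₁ → (α : F × F) ≠ σ₂ → ∀ d ∈ derGr Γ J₁ J₂ α, d (pB Γ J₁ J₂ 1) = 0 →
      d y = 0 → d = 0 := by
  have key : ∀ α : Γ, (α : F × F) ≠ 0 → (α : F × F) ≠ σ₁ → (α : F × F) ≠ σ₂ →
      ∀ d ∈ derGr Γ J₁ J₂ α, d (pB Γ J₁ J₂ 1) = 0 → ∃ u ∈ hA J₁ J₂ α, u ∈ dom Γ J₁ J₂ ∧
      d = adB (pB Γ J₁ J₂ u) ∧ ∂₁ u = 0 := by
    intro α h0 h1 h2 d hd hd1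
    obtain ⟨b, hb, μ, f₁, f₂, f₃, f₄, e0, e1, e2, rfl⟩ := exists_eq_stdDer hd
    obtain ⟨rfl, rfl⟩ := e0 fun h => h0 (congrArg Subtype.val h)
    obtain ⟨rfl, rfl⟩ := e1 h1
    obtain rfl := e2 h2
    have e : stdDer b 0 0 0 0 0 = adB (pB Γ J₁ J₂ (ιB Γ J₁ J₂ b)) := by
      rw [pB_ιB]; simp [stdDer, dHom_zero]
    refine ⟨ιB Γ J₁ J₂ b, ιB_mem_hA hb, ιB_mem_dom b, e, ?_⟩
    rw [e, adB_pB (ιB_mem_dom b) one_mem_dom, br_comm, br_one, map_neg, neg_eq_zero] at hd1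
    exact eq_zero_of_pB_eq_zero h1 (hA_le_dom h2 (pd₁_mem (ιB_mem_hA hb))) (pd₁_mem (ιB_mem_hA hb))
      hd1
  rcases J₁.2 with hJ | hJ
  · obtain ⟨β, hβ⟩ := exists_fst_ne_zero (Nondegenerate.proj₁_ne_zero (Γ := Γ) (J₂ := J₂) hJ)
    refine ⟨β, pB Γ J₁ J₂ (ex β), pB_mem_gr (ex_mem_hA β), fun α h0 h1 h2 d hd hd1 hy => ?_⟩
    obtain ⟨u, hu, hu', rfl, hu1⟩ := key α h0 h1 h2 d hd hd1
    by_cases hα : (α : F × F).1 = 0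
    · rw [eq_zero_of_lie_ex_eq_zero hJ hα hβ (pB_mem_gr hu)
        (by rw [← hy, LieDerivation.ad_apply_apply]), adB_zero]
    · rw [eq_zero_of_pd₁_eq hu (c := 0) (Ne.symm hα) (by rw [hu1, zero_smul]), map_zero, adB_zero]
  · have ht : (t₁ : SemigroupAlg Γ J₁ J₂) ∈ hA J₁ J₂ 0 := by
      simpa [ex_zero] using ex_t_mem_hA (J₂ := J₂) (0 : Γ) (i := 1) (by simp [hJ]) (zero_mem _)
    refine ⟨0, pB Γ J₁ J₂ t₁, pB_mem_gr ht, fun α h0 h1 h2 d hd hd1 hy => ?_⟩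
    obtain ⟨u, hu, hu', rfl, hu1⟩ := key α h0 h1 h2 d hd hd1
    rw [adB_pB hu' (mem_dom_of_top hJ _), br_comm, br_t₁ hJ, hu1, mul_zero, add_zero, map_neg,
      neg_eq_zero] at hy
    have h3 := eq_zero_of_pB_eq_zero h1 (mem_dom_of_top hJ _) (sd₂_mem hu) hy
    rw [sd₂_apply, sub_eq_zero] at h3
    have : u = 0 := by
      by_cases hα : (α : F × F).1 = 0
      · exact eq_zero_of_pd₂_eq hu (c := 1) (fun h => h1 (Prod.ext hα h.symm)) (by rw [h3, one_smul])
      · exact eq_zero_of_pd₁_eq hu (c := 0) (Ne.symm hα) (by rw [hu1, zero_smul])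
    rw [this, map_zero, adB_zero]

theorem exists_compDer_support (d : Der Γ J₁ J₂) :
    ∃ t : Finset Γ, ∀ α ∉ t, compDer α d = 0 := by
  obtain ⟨β, y, hy, h⟩ := exists_eq_zero_of_apply_eq_zero Γ J₁ J₂
  have hfin : {α : Γ | (α : F × F) ∈ ({0, σ₁, σ₂} : Set (F × F))}.Finite :=
    (Set.toFinite _).preimage Subtype.val_injective.injOn
  refine exists_compDer_eq_zero hfin.toFinset (pB_mem_gr one_mem_hA) hy
    (fun α hα d hd hd1 hdy => ?_) d
  simp only [Set.Finite.mem_toFinset, Set.mem_ofPred_eq, Set.mem_insert_iff,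
    Set.mem_singleton_iff, not_or] at hα
  exact h α hα.1 hα.2.1 hα.2.2 d hd hd1 hdy

/-! ### Locally finite derivations -/

/-- The vectors which lie in a finite-dimensional invariant subspace. -/
def locFin {V : Type*} [AddCommGroup V] [Module F V] (T : V →ₗ[F] V) : Submodule F V where
  carrier := {v | ∃ W : Submodule F V, FiniteDimensional F W ∧ v ∈ W ∧ ∀ w ∈ W, T w ∈ W}
  zero_mem' := ⟨⊥, inferInstance, zero_mem _, fun w hw => by
    rw [(Submodule.mem_bot F).1 hw, map_zero]; exact zero_mem _⟩
  add_mem' := by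
    rintro u v ⟨U, _, hu, hU⟩ ⟨V, _, hv, hV⟩
    refine ⟨U ⊔ V, inferInstance, Submodule.add_mem_sup hu hv, fun w hw => ?_⟩
    obtain ⟨x, hx, y, hy, rfl⟩ := Submodule.mem_sup.1 hw
    rw [map_add]
    exact Submodule.add_mem_sup (hU x hx) (hV y hy)
  smul_mem' := by
    rintro c v ⟨W, h, hv, hW⟩
    exact ⟨W, h, Submodule.smul_mem _ c hv, hW⟩

/-- Adjoining `v` to the invariant subspace of `T v - c v` keeps it invariant. This is the induction
step for triangular operators. -/
theorem mem_locFin_of_sub_mem {V : Type*} [AddCommGroup V] [Module F V] {T : V →ₗ[F] V} {c : F}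
    {v : V} (h : T v - c • v ∈ locFin T) : v ∈ locFin T := by
  obtain ⟨W, _, hv, hW⟩ := h
  refine ⟨W ⊔ F ∙ v, inferInstance, Submodule.mem_sup_right (Submodule.mem_span_singleton_self v),
    fun w hw => ?_⟩
  obtain ⟨x, hx, y, hy, rfl⟩ := Submodule.mem_sup.1 hw
  obtain ⟨a, rfl⟩ := Submodule.mem_span_singleton.1 hy
  have e : T (x + a • v) = T x + a • (T v - c • v) + (a * c) • v := by
    rw [map_add, map_smul, smul_sub, smul_smul]; abel
  rw [e]
  exact Submodule.add_mem_sup (Submodule.add_mem _ (hW x hx) (Submodule.smul_mem _ _ hv))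
    (Submodule.smul_mem _ _ (Submodule.mem_span_singleton_self v))

/-- The triangular array of values `φ n (T^k b)` makes the iterates `T^n b` linearly independent, so
no finite-dimensional invariant subspace contains `b`. -/
theorem notMem_locFin {V : Type*} [AddCommGroup V] [Module F V] {T : V →ₗ[F] V} {b : V}
    (φ : ℕ → V →ₗ[F] F) (h : ∀ n, φ n ((T ^ n) b) ≠ 0)
    (h' : ∀ n k, k < n → φ n ((T ^ k) b) = 0) : b ∉ locFin T := by
  rintro ⟨W, _, hb, hW⟩
  have hmem : ∀ n, (T ^ n) b ∈ W := fun n => by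
    induction n with
    | zero => simpa using hb
    | succ n ih => rw [pow_succ']; exact hW _ ih
  have hli : LinearIndependent F fun n => (T ^ n) b := by
    rw [linearIndependent_iff]
    intro l hl
    by_contra hne
    have hs : l.support.Nonempty := Finsupp.support_nonempty_iff.2 hne
    have hn := l.support.max'_mem hs
    have e := congrArg (φ (l.support.max' hs)) hl
    rw [Finsupp.linearCombination_apply, Finsupp.sum, map_sum, map_zero,
      Finset.sum_eq_single (l.support.max' hs)] at e
    · rw [map_smul, smul_eq_mul] at e
      exact mul_ne_zero (Finsupp.mem_support_iff.1 hn) (h _) e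
    · intro k hk hk'
      rw [map_smul, h' _ _ (lt_of_le_of_ne (l.support.le_max' k hk) hk'), smul_zero]
    · exact fun h => absurd hn h
  have hli' : LinearIndependent F fun n => (⟨(T ^ n) b, hmem n⟩ : W) :=
    LinearIndependent.of_comp W.subtype hli
  exact not_finite_iff_infinite.2 (inferInstance : Infinite ℕ) hli'.finite

theorem isLocallyFinite_iff {d : Der Γ J₁ J₂} :
    IsLocallyFinite d ↔ ∀ b, b ∈ locFin d.toLinearMap := Iff.rfl

/-- A derivation is a finite sum of homogeneous ones, each standard, and the induced shape is closed
under sums. -/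
theorem exists_isInduced (d : Der Γ J₁ J₂) : ∃ P Q μ f, IsInduced d P Q μ f := by
  classical
  obtain ⟨t, ht⟩ := exists_compDer_support d
  have key : ∀ s : Finset Γ, ∃ P Q μ f, IsInduced (∑ α ∈ s, compDer α d) P Q μ f := by
    intro s
    induction s using Finset.induction_on with
    | empty => exact ⟨_, _, _, _, isInduced_zero⟩
    | insert α s hα ih =>
      obtain ⟨P, Q, μ, f, h⟩ := ih
      obtain ⟨u, -, ν, f₁, f₂, f₃, f₄, -, -, -, e⟩ := exists_eq_stdDer (compDer_mem α d)
      obtain ⟨P', Q', h'⟩ := exists_isInduced_stdDer u ν f₁ f₂ f₃ f₄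
      rw [Finset.sum_insert hα, e]
      exact ⟨_, _, _, _, h'.add h⟩
  obtain ⟨P, Q, μ, f, h⟩ := key t
  rw [← eq_sum_compDer ht] at h
  exact ⟨P, Q, μ, f, h⟩

theorem IsInduced.eq {d e : Der Γ J₁ J₂} {P Q : SemigroupAlg Γ J₁ J₂} {μ : Γ →+ F} {f : F}
    (hd : IsInduced d P Q μ f) (he : IsInduced e P Q μ f) : d = e :=
  LieDerivation_ext_pB fun v hv => by rw [hd.apply_pB v hv, he.apply_pB v hv]

/-! ### A criterion for local finiteness. -/

theorem span_mono_of_tDeriv₁ (W : Submodule F (SemigroupAlg Γ J₁ J₂))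
    (h : ∀ (α : Γ) (j : ℕ), j ∈ J₂.1 → ex α * t₂ ^ j ∈ W) {v : SemigroupAlg Γ J₁ J₂}
    (hv : tDeriv₁ _ _ _ v = 0) : v ∈ W := by
  have : v = v.coeff.sum (fun m c => single m c) := by
    conv_lhs => rw [← AddMonoidAlgebra.ofCoeff_coeff v, ← Finsupp.sum_single v.coeff]
    rw [AddMonoidAlgebra.ofCoeff_finsuppSum]; rfl
  rw [this]
  refine W.sum_mem fun m hm => ?_
  have hm1 : (m.2.1 : ℕ) = 0 := by
    by_contra hne
    exact (Finsupp.mem_support_iff.1 hm) (coeff_eq_zero_of_tDeriv₁ hv hne)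
  dsimp only
  rw [single_eq, hm1, pow_zero, mul_one]
  exact W.smul_mem _ (h _ _ m.2.2.2)

theorem tDeriv₁_mono {γ : Γ} {k l : ℕ} (hk : k ∈ J₁.1) :
    tDeriv₁ _ _ _ (ex γ * t₁ ^ k * t₂ ^ l : SemigroupAlg Γ J₁ J₂) =
      (k : F) • (ex γ * t₁ ^ (k - 1) * t₂ ^ l) := by
  by_cases hJ : J₁.1 = ⊥
  · obtain rfl : k = 0 := by simpa [hJ] using hk
    rw [tDeriv₁_eq_zero hJ]; simp
  · exact tDeriv₁_ex_t (ExpMonoid.eq_top_of_ne_bot hJ) γ k l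

theorem tDeriv₂_mono {γ : Γ} {k l : ℕ} (hl : l ∈ J₂.1) :
    tDeriv₂ _ _ _ (ex γ * t₁ ^ k * t₂ ^ l : SemigroupAlg Γ J₁ J₂) =
      (l : F) • (ex γ * t₁ ^ k * t₂ ^ (l - 1)) := by
  by_cases hJ : J₂.1 = ⊥
  · obtain rfl : l = 0 := by simpa [hJ] using hl
    rw [tDeriv₂_eq_zero hJ]; simp
  · exact tDeriv₂_ex_t (ExpMonoid.eq_top_of_ne_bot hJ) γ k l

/-- The hypotheses cover both shapes that occur: `p = 0` with `Q` a scalar, and `π₁ = 0` with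
arbitrary `p`. Besides a diagonal term, one term lowers the exponent of `t₂`, and the last one
lowers that of `t₁` when `Q` does not involve `t₁`. -/
theorem opA_mono {p : F} {Q : SemigroupAlg Γ J₁ J₂} {μ : Γ →+ F} {f : F} {γ : Γ}
    (hp : p * (γ : F × F).1 = 0) {q : F} (hq : (γ : F × F).1 • Q = q • 1) {k l : ℕ}
    (hk : k ∈ J₁.1) (hl : l ∈ J₂.1) :
    opA (p • 1) (Q - p • t₁) μ f (ex γ * t₁ ^ k * t₂ ^ l) =
      (p * ((γ : F × F).2 - 1) - q + p * k + μ γ) • (ex γ * t₁ ^ k * t₂ ^ l) +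
        ((p + f) * l) • (ex γ * t₁ ^ k * t₂ ^ (l - 1)) -
          (k : F) • (Q * (ex γ * t₁ ^ (k - 1) * t₂ ^ l)) := by
  have hx := ex_t_mem_hA γ hk hl
  have ht : (t₁ : SemigroupAlg Γ J₁ J₂) * ((k : F) • (ex γ * t₁ ^ (k - 1) * t₂ ^ l)) =
      (k : F) • (ex γ * t₁ ^ k * t₂ ^ l) := by
    cases k with
    | zero => simp
    | succ k => rw [mul_smul_comm, Nat.add_sub_cancel, pow_succ]; congr 1; ring
  rw [opA_apply, sd₂_of_mem hx, pd₁_of_mem hx, homDeriv_of_mem _ hx, tDeriv₁_mono hk,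
    tDeriv₂_mono hl, sub_mul, mul_add (Q : SemigroupAlg Γ J₁ J₂), mul_smul_comm _ Q, ← smul_mul_assoc _ Q, hq,
    smul_mul_assoc p t₁, mul_add (t₁ : SemigroupAlg Γ J₁ J₂), ht, mul_smul_comm _ (t₁ : SemigroupAlg Γ J₁ J₂), smul_add p, smul_smul p, hp,
    mul_smul_comm _ Q]
  simp only [smul_mul_assoc, one_mul, smul_add, smul_smul, zero_smul, zero_add]
  module

/-- Induction on the exponent of `t₁`, then on that of `t₂`, for all degrees at once. Multiplication
by `Q` may change the degree and raise the power of `t₂`, but it comes with a smaller power of `t₁`,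
where the outer hypothesis covers everything. -/
theorem isLocallyFinite_of_isInduced {d : Der Γ J₁ J₂} {p : F} {Q : SemigroupAlg Γ J₁ J₂}
    {μ : Γ →+ F} {f : F} (hd : IsInduced d (p • 1) (Q - p • t₁) μ f)
    (hp : ∀ γ : Γ, p * (γ : F × F).1 = 0) (hQ : tDeriv₁ _ _ _ Q = 0)
    (hQ' : ∀ γ : Γ, ∃ q : F, (γ : F × F).1 • Q = q • 1) : IsLocallyFinite d := by
  have key : ∀ k ∈ J₁.1, ∀ l ∈ J₂.1, ∀ γ : Γ,
      pB Γ J₁ J₂ (ex γ * t₁ ^ k * t₂ ^ l) ∈ locFin d.toLinearMap := by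
    intro k
    induction k using Nat.strong_induction_on with | _ k ihk
    intro hk l
    induction l using Nat.strong_induction_on with | _ l ihl
    intro hl γ
    have hQk : pB Γ J₁ J₂ ((k : F) • (Q * (ex γ * t₁ ^ (k - 1) * t₂ ^ l))) ∈
        locFin d.toLinearMap := by
      rcases Nat.eq_zero_or_pos k with rfl | hk0
      · simp
      · rw [map_smul]
        refine Submodule.smul_mem _ _ ?_
        have h := span_mono_of_tDeriv₁ ((locFin d.toLinearMap).comap (pB Γ J₁ J₂ ∘ₗ
          LinearMap.mulRight F (ex γ * t₁ ^ (k - 1) * t₂ ^ l))) (fun α j hj => ?_) hQ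
        · rw [Submodule.mem_comap] at h
          exact h
        · rw [Submodule.mem_comap, LinearMap.comp_apply, LinearMap.mulRight_apply]
          have h := ihk (k - 1) (by omega) (pred_mem J₁ hk) (j + l) (add_mem hj hl) (α + γ)
          rw [ex_add, pow_add] at h
          convert h using 2
          ring
    have hl' : pB Γ J₁ J₂ (((p + f) * l) • (ex γ * t₁ ^ k * t₂ ^ (l - 1))) ∈
        locFin d.toLinearMap := by
      rcases Nat.eq_zero_or_pos l with rfl | hl0
      · simp
      · rw [map_smul]
        exact Submodule.smul_mem _ _ (ihl (l - 1) (by omega) (pred_mem J₂ hl) γ)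
    by_cases hdom : (ex γ * t₁ ^ k * t₂ ^ l : SemigroupAlg Γ J₁ J₂) ∈ dom Γ J₁ J₂
    · obtain ⟨q, hq⟩ := hQ' γ
      refine mem_locFin_of_sub_mem (c := p * ((γ : F × F).2 - 1) - q + p * k + μ γ) ?_
      rw [LieDerivation.coeFn_coe, hd.apply_pB _ hdom, opA_mono (hp γ) hq hk hl, map_sub, map_add,
        map_smul _ (_ - _ + _ + _), add_sub_assoc, add_sub_cancel_left]
      exact Submodule.sub_mem _ hl' hQk
    -- The only monomial outside `dom` is `x^{σ₂}` in the special case, and `pB` kills it.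
    · have hσ : (γ : F × F) = σ₂ := by
        by_contra h
        exact hdom (hA_le_dom h (ex_t_mem_hA γ hk hl))
      have hs : Special Γ J₁ J₂ := by
        by_contra h
        exact hdom (by rw [dom_eq_top h]; trivial)
      have h0 : pB Γ J₁ J₂ (ex γ * t₁ ^ k * t₂ ^ l) = 0 := by
        rw [pB_eq_zero]
        refine AddMonoidAlgebra.coeff_injective (Finsupp.ext fun m => ?_)
        by_cases hm : m.1 = γ
        · exact coeff_live_of_dead _ (Or.inr ⟨hs, by rw [hm, hσ]⟩)
        · exact live_mem_hA (ex_t_mem_hA γ hk hl) m hm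
      rw [h0]
      exact zero_mem _
  refine isLocallyFinite_iff.2 fun b => ?_
  rw [← pB_ιB b]
  exact span_mono ((locFin d.toLinearMap).comap (pB Γ J₁ J₂))
    (fun γ k l hk hl => key k hk l hl γ) _

/-! ### Leading monomials -/

/-- The weight of a monomial attached to `ρ : Γ → ℚ`, in the lexicographic order: the exponent
of `t₁`, the value of `ρ`, the exponent of `t₂`. -/
def wt (ρ : Γ →+ ℚ) (m : Γ × J₁.1 × J₂.1) : ℕ ×ₗ (ℚ ×ₗ ℕ) :=
  toLex ((m.2.1 : ℕ), toLex (ρ m.1, (m.2.2 : ℕ)))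

variable {ρ : Γ →+ ℚ}

theorem wt_add (m n : Γ × J₁.1 × J₂.1) : wt ρ (m + n) = wt ρ m + wt ρ n := by
  simp only [wt, Prod.fst_add, Prod.snd_add, map_add]
  rfl

theorem wt_lt_wt {m n : Γ × J₁.1 × J₂.1} : wt ρ m < wt ρ n ↔ (m.2.1 : ℕ) < n.2.1 ∨
    (m.2.1 : ℕ) = n.2.1 ∧ (ρ m.1 < ρ n.1 ∨ ρ m.1 = ρ n.1 ∧ (m.2.2 : ℕ) < n.2.2) := by
  simp only [wt, Prod.Lex.toLex_lt_toLex]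

theorem wt_predE₁_lt {m : Γ × J₁.1 × J₂.1} (h : (m.2.1 : ℕ) ≠ 0) :
    wt ρ (m.1, predE J₁ m.2.1, m.2.2) < wt ρ m :=
  wt_lt_wt.2 (Or.inl (by simp only [predE]; omega))

theorem wt_predE₂_lt {m : Γ × J₁.1 × J₂.1} (h : (m.2.2 : ℕ) ≠ 0) :
    wt ρ (m.1, m.2.1, predE J₂ m.2.2) < wt ρ m :=
  wt_lt_wt.2 (Or.inr ⟨rfl, Or.inr ⟨rfl, by simp only [predE]; omega⟩⟩)

/-- A `ℚ`-linear form on `F × F` which separates the finitely many degrees in `S` and `0` makes the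
weight injective on `S`, so the maximum is unique. Its sign is chosen to make some nonzero degree
positive if there is one, so the maximum exceeds the weight of `1`. -/
theorem exists_weight (S : Finset (Γ × J₁.1 × J₂.1)) (hS : ∃ s ∈ S, s ≠ 0) :
    ∃ ρ : Γ →+ ℚ, ∃ m ∈ S, wt ρ (0 : Γ × J₁.1 × J₂.1) < wt ρ m ∧ ∀ s ∈ S, s ≠ m → wt ρ s < wt ρ m := by
  classical
  obtain ⟨φ, hφ⟩ := Module.exists_dual_forall_apply_ne_zero (K := ℚ)
    (fun p : {p : Γ × Γ // p ∈ ((insert 0 (S.image Prod.fst)) ×ˢ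
      (insert 0 (S.image Prod.fst))).filter fun p => p.1 ≠ p.2} =>
        ((p.1.1 : F × F) - (p.1.2 : F × F)))
    (fun p h => (Finset.mem_filter.1 p.2).2 (Subtype.ext (sub_eq_zero.1 h)))
  have hinj : ∀ β ∈ insert 0 (S.image Prod.fst), ∀ γ ∈ insert 0 (S.image Prod.fst),
      φ (β : F × F) = φ (γ : F × F) → β = γ := by
    intro β hβ γ hγ h
    by_contra hne
    refine hφ ⟨(β, γ), Finset.mem_filter.2 ⟨Finset.mem_product.2 ⟨hβ, hγ⟩, hne⟩⟩ ?_
    rw [map_sub, h, sub_self]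
  obtain ⟨ρ, hρ, hρ'⟩ : ∃ ρ : Γ →+ ℚ, (∀ s ∈ S, ∀ s' ∈ S, ρ s.1 = ρ s'.1 → s.1 = s'.1) ∧
      ((∃ s ∈ S, s.1 ≠ 0) → ∃ s ∈ S, 0 < ρ s.1) := by
    have hmem : ∀ s ∈ S, s.1 ∈ insert 0 (S.image Prod.fst) := fun s hs =>
      Finset.mem_insert_of_mem (Finset.mem_image_of_mem _ hs)
    by_cases h : ∃ s ∈ S, 0 < φ (s.1 : F × F)
    · exact ⟨φ.toAddMonoidHom.comp Γ.subtype, fun s hs s' hs' e => hinj _ (hmem s hs) _ (hmem s' hs') e,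
        fun _ => h⟩
    · push Not at h
      refine ⟨(-φ).toAddMonoidHom.comp Γ.subtype, fun s hs s' hs' e =>
        hinj _ (hmem s hs) _ (hmem s' hs') (neg_injective e), ?_⟩
      rintro ⟨s, hs, h0⟩
      refine ⟨s, hs, neg_pos.2 (lt_of_le_of_ne (h s hs) fun e => h0 ?_)⟩
      exact hinj _ (hmem s hs) 0 (Finset.mem_insert_self _ _) (by rw [ZeroMemClass.coe_zero, map_zero]; exact e)
  obtain ⟨s, hs, h0⟩ := hS
  obtain ⟨m, hm, hmax⟩ := S.exists_max_image (wt ρ) ⟨s, hs⟩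
  refine ⟨ρ, m, hm, ?_, fun s' hs' hne => lt_of_le_of_ne (hmax s' hs') fun e => hne ?_⟩
  · suffices ∃ s ∈ S, wt ρ (0 : Γ × J₁.1 × J₂.1) < wt ρ s by
      obtain ⟨s, hs, h⟩ := this
      exact h.trans_le (hmax s hs)
    by_cases h1 : ∃ s ∈ S, s.1 ≠ 0
    · obtain ⟨s', hs', h⟩ := hρ' h1
      refine ⟨s', hs', wt_lt_wt.2 ?_⟩
      rcases Nat.eq_zero_or_pos (s'.2.1 : ℕ) with h2 | h2
      · exact Or.inr ⟨h2.symm, Or.inl (by simpa using h)⟩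
      · exact Or.inl h2
    · push Not at h1
      refine ⟨s, hs, wt_lt_wt.2 ?_⟩
      rcases Nat.eq_zero_or_pos (s.2.1 : ℕ) with h2 | h2
      · refine Or.inr ⟨h2.symm, Or.inr ⟨by rw [h1 s hs]; rfl, Nat.pos_of_ne_zero fun h3 => h0 ?_⟩⟩
        exact Prod.ext (h1 s hs) (Prod.ext (Subtype.ext h2) (Subtype.ext h3))
      · exact Or.inl h2
  · have e1 := congrArg (fun w => (ofLex w).1) e
    have e2 := congrArg (fun w => (ofLex (ofLex w).2).1) e
    have e3 := congrArg (fun w => (ofLex (ofLex w).2).2) e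
    exact Prod.ext (hρ s' hs' m hm e2) (Prod.ext (Subtype.ext e1) (Subtype.ext e3))

/-- The span of the monomials of weight less than `w`. -/
def below (J₁ J₂ : ExpMonoid) (ρ : Γ →+ ℚ) (w : ℕ ×ₗ (ℚ ×ₗ ℕ)) :
    Submodule F (SemigroupAlg Γ J₁ J₂) where
  carrier := {v | ∀ m : Γ × J₁.1 × J₂.1, v.coeff m ≠ 0 → wt ρ m < w}
  zero_mem' := fun _ h => absurd rfl h
  add_mem' := fun {u v} hu hv m hm => by
    by_cases h : u.coeff m = 0
    · refine hv m fun h' => hm ?_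
      rw [AddMonoidAlgebra.coeff_add, Finsupp.add_apply, h, h', add_zero]
    · exact hu m h
  smul_mem' := fun c v hv m hm => hv m fun h => hm (by
    rw [AddMonoidAlgebra.coeff_smul, Finsupp.smul_apply, h, smul_zero])

theorem below_mono {w w' : ℕ ×ₗ (ℚ ×ₗ ℕ)} (h : w ≤ w') :
    below (F := F) (Γ := Γ) J₁ J₂ ρ w ≤ below J₁ J₂ ρ w' :=
  fun _ hv m hm => (hv m hm).trans_le h

theorem single_mem_below {m : Γ × J₁.1 × J₂.1} {w : ℕ ×ₗ (ℚ ×ₗ ℕ)} (h : wt ρ m < w) (c : F) :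
    single m c ∈ below J₁ J₂ ρ w := by
  classical
  intro n hn
  rw [AddMonoidAlgebra.coeff_single, Finsupp.single_apply] at hn
  split_ifs at hn with e
  · rwa [← e]
  · exact absurd rfl hn

theorem mul_mem_below {a b : ℕ ×ₗ (ℚ ×ₗ ℕ)} {u v : SemigroupAlg Γ J₁ J₂}
    (hu : ∀ m : Γ × J₁.1 × J₂.1, u.coeff m ≠ 0 → wt ρ m ≤ a) (hv : v ∈ below J₁ J₂ ρ b) :
    u * v ∈ below J₁ J₂ ρ (a + b) := by
  classical
  intro m hm
  obtain ⟨i, hi, j, hj, rfl⟩ := Finset.mem_add.1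
    (AddMonoidAlgebra.support_coeff_mul_subset u v (Finsupp.mem_support_iff.2 hm))
  rw [wt_add]
  exact add_lt_add_of_le_of_lt (hu i (Finsupp.mem_support_iff.1 hi))
    (hv j (Finsupp.mem_support_iff.1 hj))

theorem single_mul_mem_below {m : Γ × J₁.1 × J₂.1} {c : F} {b : ℕ ×ₗ (ℚ ×ₗ ℕ)}
    {v : SemigroupAlg Γ J₁ J₂} (hv : v ∈ below J₁ J₂ ρ b) :
    single m c * v ∈ below J₁ J₂ ρ (wt ρ m + b) := by
  classical
  refine mul_mem_below (fun n hn => ?_) hv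
  rw [AddMonoidAlgebra.coeff_single, Finsupp.single_apply] at hn
  split_ifs at hn with e
  · rw [e]
  · exact absurd rfl hn

theorem sum_single (v : SemigroupAlg Γ J₁ J₂) : v = v.coeff.sum (fun m c => single m c) := by
  conv_lhs => rw [← AddMonoidAlgebra.ofCoeff_coeff v, ← Finsupp.sum_single v.coeff]
  rw [AddMonoidAlgebra.ofCoeff_finsuppSum]; rfl

/-- A linear map sends `below w` to a submodule if it does so on monomials. -/
theorem below_le {w : ℕ ×ₗ (ℚ ×ₗ ℕ)} {W : Submodule F (SemigroupAlg Γ J₁ J₂)}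
    (h : ∀ m : Γ × J₁.1 × J₂.1, wt ρ m < w → single m 1 ∈ W) : below J₁ J₂ ρ w ≤ W := by
  intro v hv
  rw [sum_single v]
  refine W.sum_mem fun m hm => ?_
  dsimp only
  rw [← mul_one (v.coeff m), ← smul_eq_mul, ← AddMonoidAlgebra.smul_single]
  exact W.smul_mem _ (h m (hv m (Finsupp.mem_support_iff.1 hm)))

/-- `v` is `c x^m` plus a combination of monomials of smaller weight. -/
def Leads (ρ : Γ →+ ℚ) (m : Γ × J₁.1 × J₂.1) (c : F) (v : SemigroupAlg Γ J₁ J₂) : Prop :=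
  v - single m c ∈ below J₁ J₂ ρ (wt ρ m)

section leads

variable {m n : Γ × J₁.1 × J₂.1} {a b : F} {u v : SemigroupAlg Γ J₁ J₂}

theorem Leads.coeff_eq (h : Leads ρ m a v) : v.coeff m = a := by
  by_contra hne
  refine lt_irrefl _ (h m fun e => hne ?_)
  rw [AddMonoidAlgebra.coeff_sub, Finsupp.sub_apply, AddMonoidAlgebra.coeff_single, Finsupp.single_eq_same,
    sub_eq_zero] at e
  exact e

theorem leads_coeff (h : ∀ s, v.coeff s ≠ 0 → s ≠ m → wt ρ s < wt ρ m) :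
    Leads ρ m (v.coeff m) v := by
  classical
  intro s hs
  rw [AddMonoidAlgebra.coeff_sub, Finsupp.sub_apply, AddMonoidAlgebra.coeff_single, Finsupp.single_apply] at hs
  split_ifs at hs with e
  · subst e
    exact absurd (sub_self _) hs
  · exact h s (by simpa using hs) (Ne.symm e)

theorem leads_single : Leads ρ m a (single m a : SemigroupAlg Γ J₁ J₂) := by
  rw [Leads, sub_self]; exact zero_mem _

theorem leads_of_mem_below (h : v ∈ below J₁ J₂ ρ (wt ρ m)) : Leads ρ m 0 v := by
  rw [Leads, AddMonoidAlgebra.single_zero, sub_zero]; exact h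

theorem Leads.add (hu : Leads ρ m a u) (hv : Leads ρ m b v) : Leads ρ m (a + b) (u + v) := by
  rw [Leads, AddMonoidAlgebra.single_add, add_sub_add_comm]
  exact Submodule.add_mem _ hu hv

theorem Leads.smul (c : F) (hv : Leads ρ m b v) : Leads ρ m (c * b) (c • v) := by
  rw [Leads, ← smul_eq_mul, ← AddMonoidAlgebra.smul_single, ← smul_sub]
  exact Submodule.smul_mem _ c hv

theorem Leads.sub (hu : Leads ρ m a u) (hv : Leads ρ m b v) : Leads ρ m (a - b) (u - v) := by
  have := hu.add (hv.smul (-1))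
  rwa [neg_one_mul, neg_one_smul, ← sub_eq_add_neg, ← sub_eq_add_neg] at this

theorem Leads.mem_below {w : ℕ ×ₗ (ℚ ×ₗ ℕ)} (hv : Leads ρ m a v) (h : wt ρ m < w) :
    v ∈ below J₁ J₂ ρ w := by
  rw [← sub_add_cancel v (single m a)]
  exact Submodule.add_mem _ (below_mono h.le hv) (single_mem_below h a)

theorem Leads.lt_of_ne (hv : Leads ρ m a v) {s : Γ × J₁.1 × J₂.1} (hs : v.coeff s ≠ 0)
    (hne : s ≠ m) : wt ρ s < wt ρ m := by
  classical
  refine hv s ?_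
  rwa [AddMonoidAlgebra.coeff_sub, Finsupp.sub_apply, AddMonoidAlgebra.coeff_single,
    Finsupp.single_apply, if_neg (Ne.symm hne), sub_zero]

theorem Leads.le (hv : Leads ρ m a v) (s : Γ × J₁.1 × J₂.1) (hs : v.coeff s ≠ 0) :
    wt ρ s ≤ wt ρ m := by
  by_cases e : s = m
  · rw [e]
  · exact (hv.lt_of_ne hs e).le

theorem Leads.mul (hu : Leads ρ m a u) (hv : Leads ρ n b v) :
    Leads ρ (m + n) (a * b) (u * v) := by
  have e : u * v - single (m + n) (a * b) =
      u * (v - single n b) + single n b * (u - single m a) := by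
    rw [← AddMonoidAlgebra.single_mul_single]; ring
  rw [Leads, e, wt_add]
  refine Submodule.add_mem _ (mul_mem_below hu.le hv) ?_
  rw [add_comm (wt ρ m)]
  exact single_mul_mem_below hu

/-- If `T` shifts leading monomials of monomials by `m`, strict monotonicity of the weight under
addition carries the statement over to any vector with a leading term. The resulting coefficient may
vanish. -/
theorem Leads.map {T : SemigroupAlg Γ J₁ J₂ →ₗ[F] SemigroupAlg Γ J₁ J₂}
    {l : Γ × J₁.1 × J₂.1 → F} (hT : ∀ h, Leads ρ (m + h) (l h) (T (single h 1)))
    (hv : Leads ρ n b v) : Leads ρ (m + n) (b * l n) (T v) := by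
  have e : T v = T (v - single n b) + b • T (single n 1) := by
    rw [← map_smul, AddMonoidAlgebra.smul_single, smul_eq_mul, mul_one, map_sub, sub_add_cancel]
  rw [e, ← zero_add (b * l n)]
  refine (leads_of_mem_below ?_).add ((hT n).smul b)
  refine below_le (W := (below J₁ J₂ ρ (wt ρ (m + n))).comap T) (fun h hh => ?_) hv
  rw [Submodule.mem_comap]
  refine (hT h).mem_below ?_
  rw [wt_add, wt_add]
  exact add_lt_add_right hh _

theorem live_single (hm : ¬ Dead m) : live Γ J₁ J₂ (single m a) = single m a := by
  classical
  refine AddMonoidAlgebra.coeff_injective (Finsupp.ext fun n => ?_)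
  by_cases h : Dead n
  · rw [coeff_live_of_dead _ h, AddMonoidAlgebra.coeff_single, Finsupp.single_apply, if_neg]
    rintro rfl
    exact hm h
  · exact coeff_live _ h

theorem Leads.live (hv : Leads ρ m a v) (hm : ¬ Dead m) : Leads ρ m a (live Γ J₁ J₂ v) := by
  intro n hn
  rw [← live_single hm, ← map_sub] at hn
  by_cases h : Dead n
  · exact absurd (coeff_live_of_dead _ h) hn
  · rw [coeff_live _ h] at hn
    exact hv n hn

theorem tDeriv₂_mem_below : tDeriv₂ Γ J₁ J₂ (single m a) ∈ below J₁ J₂ ρ (wt ρ m) := by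
  rw [tDeriv₂_single]
  by_cases h : (m.2.2 : ℕ) = 0
  · simp [h]
  · exact single_mem_below (wt_predE₂_lt h) _

theorem leads_sd₂ : Leads ρ m ((m.1 : F × F).2 - 1) (𝔇 (single m (1 : F))) := by
  rw [sd₂_of_mem (single_mem_hA m 1)]
  rw [show Leads ρ m ((m.1 : F × F).2 - 1) = Leads ρ m ((m.1 : F × F).2 - 1 + 0) by rw [add_zero]]
  refine Leads.add ?_ (leads_of_mem_below tDeriv₂_mem_below)
  have := (leads_single (ρ := ρ) (m := m) (a := (1 : F))).smul ((m.1 : F × F).2 - 1)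
  rwa [mul_one] at this

theorem leads_pd₁ : Leads ρ m (m.1 : F × F).1 (∂₁ (single m (1 : F))) := by
  rw [pd₁_single, ← add_zero (m.1 : F × F).1, mul_one]
  refine Leads.add ?_ (leads_of_mem_below ?_)
  · rw [add_zero]; exact leads_single
  · by_cases h : (m.2.1 : ℕ) = 0
    · simp [h]
    · exact single_mem_below (wt_predE₁_lt h) _

theorem Leads.sd₂ (hv : Leads ρ m a v) : Leads ρ m (a * ((m.1 : F × F).2 - 1)) (𝔇 v) := by
  have := hv.map (m := 0) (T := BlockLie.sd₂ Γ J₁ J₂) (l := fun h => (h.1 : F × F).2 - 1) fun h => by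
    rw [zero_add]; exact leads_sd₂
  rwa [zero_add] at this

theorem Leads.pd₁ (hv : Leads ρ m a v) : Leads ρ m (a * (m.1 : F × F).1) (∂₁ v) := by
  have := hv.map (m := 0) (T := (BlockLie.pd₁ Γ J₁ J₂).toLinearMap)
    (l := fun h => (h.1 : F × F).1) fun h => by
    rw [zero_add]; exact leads_pd₁
  rwa [zero_add] at this

theorem wt_lt_add (hm : wt ρ (0 : Γ × J₁.1 × J₂.1) < wt ρ m) (n : Γ × J₁.1 × J₂.1) : wt ρ n < wt ρ (m + n) := by
  rw [wt_add]
  conv_lhs => rw [← zero_add n, wt_add]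
  exact add_lt_add_left hm _

end leads

/-- A derivation which shifts the leading monomials in a half-line by `m` is not locally finite. -/
theorem not_isLocallyFinite_of_leads {d : Der Γ J₁ J₂}
    {T : SemigroupAlg Γ J₁ J₂ →ₗ[F] SemigroupAlg Γ J₁ J₂}
    (hd : ∀ v ∈ dom Γ J₁ J₂, d (pB Γ J₁ J₂ v) = pB Γ J₁ J₂ (T v))
    {m g : Γ × J₁.1 × J₂.1} (hm : wt ρ (0 : Γ × J₁.1 × J₂.1) < wt ρ m) {l : Γ × J₁.1 × J₂.1 → F}
    (hT : ∀ h, Leads ρ (m + h) (l h) (T (single h 1))) (hl : ∀ n : ℕ, l (n • m + g) ≠ 0)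
    (hg : ∀ n : ℕ, ¬ Dead (n • m + g)) : ¬ IsLocallyFinite d := by
  intro hlf
  -- The iterates of `b` have leading monomials `n m + g`, of strictly increasing weight. Liveness
  -- of these monomials ensures that the leading terms survive in `B`.
  set b := pB Γ J₁ J₂ (single g 1) with hb
  have key : ∀ n : ℕ, ∃ c : F, c ≠ 0 ∧
      Leads ρ (n • m + g) c (ιB Γ J₁ J₂ ((d.toLinearMap ^ n) b)) := by
    intro n
    induction n with
    | zero =>
      refine ⟨1, one_ne_zero, ?_⟩
      rw [pow_zero, Module.End.one_apply, hb, ιB_pB]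
      have h0 := hg 0
      rw [zero_smul, zero_add] at h0 ⊢
      exact leads_single.live h0
    | succ n ih =>
      obtain ⟨c, hc, h⟩ := ih
      refine ⟨c * l (n • m + g), mul_ne_zero hc (hl n), ?_⟩
      rw [pow_succ', Module.End.mul_apply, LieDerivation.coeFn_coe]
      rw [← pB_ιB ((d.toLinearMap ^ n) b), hd _ (ιB_mem_dom _), ιB_pB]
      have h' := h.map hT
      have hg' := hg (n + 1)
      rw [succ_nsmul', add_assoc] at hg' ⊢
      exact h'.live hg'
  have hmono : ∀ k n : ℕ, k < n → wt ρ (k • m + g) < wt ρ (n • m + g) := by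
    intro k n hkn
    refine strictMono_nat_of_lt_succ (f := fun n : ℕ => wt ρ (n • m + g)) (fun n => ?_) hkn
    rw [succ_nsmul', add_assoc]
    exact wt_lt_add hm _
  refine notMem_locFin (T := d.toLinearMap) (b := b)
    (fun n => coeffL (n • m + g) ∘ₗ ιB Γ J₁ J₂) (fun n => ?_) (fun n k hk => ?_) (hlf b)
  · obtain ⟨c, hc, h⟩ := key n
    rw [LinearMap.comp_apply, coeffL_apply, h.coeff_eq]
    exact hc
  · obtain ⟨c, hc, h⟩ := key k
    rw [LinearMap.comp_apply, coeffL_apply]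
    by_contra hne
    exact absurd (h.le _ hne) (not_le.2 (hmono k n hk))

/-! ### The classification of locally finite derivations -/

variable {ρ : Γ →+ ℚ} {m : Γ × J₁.1 × J₂.1} {P Q R : SemigroupAlg Γ J₁ J₂} {μ : Γ →+ F} {p q f : F}

theorem mem_below_of_wt_lt {μ : Γ →+ F} (hm : wt ρ (0 : Γ × J₁.1 × J₂.1) < wt ρ m)
    (h : Γ × J₁.1 × J₂.1) :
    homDeriv J₁ J₂ μ (single h (1 : F)) + f • tDeriv₂ _ _ _ (single h (1 : F)) ∈
      below J₁ J₂ ρ (wt ρ (m + h)) := by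
  refine Submodule.add_mem _ ?_ (Submodule.smul_mem _ _
    (below_mono (wt_lt_add hm h).le tDeriv₂_mem_below))
  rw [homDeriv_single]
  exact single_mem_below (wt_lt_add hm h) _

/-- Since `m` has positive weight, the terms with `μ` and `∂_{t₂}`, which do not raise the weight,
cannot reach `m + h`. Only the products of leading terms of `P` and `Q` with the diagonal parts of
`D` and `∂₁` contribute. -/
theorem leads_opA (hm : wt ρ (0 : Γ × J₁.1 × J₂.1) < wt ρ m) (hP : Leads ρ m p P)
    (hQ : Leads ρ m q Q) (h : Γ × J₁.1 × J₂.1) :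
    Leads ρ (m + h) (p * ((h.1 : F × F).2 - 1) - q * (h.1 : F × F).1)
      (opA P Q μ f (single h 1)) := by
  rw [opA_apply, add_assoc]
  have := ((hP.mul leads_sd₂).sub (hQ.mul leads_pd₁)).add
    (leads_of_mem_below (mem_below_of_wt_lt (μ := μ) (f := f) hm h))
  rwa [add_zero] at this

theorem pd₁_eq_tDeriv₁ (hΓ : ∀ γ : Γ, (γ : F × F).1 = 0) (v : SemigroupAlg Γ J₁ J₂) :
    ∂₁ v = tDeriv₁ _ _ _ v :=
  span_hA (LinearMap.eqLocus (pd₁ Γ J₁ J₂).toLinearMap (tDeriv₁ Γ J₁ J₂).toLinearMap)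
    (fun γ v hv => by
      rw [LinearMap.mem_eqLocus, Derivation.coeFn_coe, Derivation.coeFn_coe, pd₁_of_mem hv, hΓ,
        zero_smul, zero_add]) v

theorem t₁_mul_tDeriv₁_single (h : Γ × J₁.1 × J₂.1) :
    t₁ * tDeriv₁ _ _ _ (single h (1 : F)) = ((h.2.1 : ℕ) : F) • single h (1 : F) := by
  obtain ⟨γ, i, j⟩ := h
  rw [← ex_t_eq_single, tDeriv₁_mono i.2]
  rcases Nat.eq_zero_or_pos (i : ℕ) with h | h
  · simp [h]
  · obtain ⟨k, hk⟩ := Nat.exists_eq_succ_of_ne_zero h.ne'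
    simp only [hk]
    rw [mul_smul_comm, Nat.succ_sub_one, pow_succ]
    congr 1
    ring

/-- When `π₁ = 0`, `∂₁` is `∂_{t₁}` and lowers the weight. The factor `t₁` in front of `R` restores
the lost power, giving the factor equal to the exponent of `t₁`; the part `Q` without `t₁` cannot
restore it and is negligible, whatever its degrees. -/
theorem leads_opA_of_proj₁_eq_zero (hΓ : ∀ γ : Γ, (γ : F × F).1 = 0)
    (hm : wt ρ (0 : Γ × J₁.1 × J₂.1) < wt ρ m) (hP : Leads ρ m p P)
    (hR : Leads ρ m q R) (hQ : tDeriv₁ _ _ _ Q = 0) (h : Γ × J₁.1 × J₂.1) :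
    Leads ρ (m + h) (p * ((h.1 : F × F).2 - 1) - q * (h.2.1 : ℕ))
      (opA P (t₁ * R + Q) μ f (single h 1)) := by
  classical
  have e : (t₁ * R + Q) * ∂₁ (single h (1 : F)) =
      R * ((h.2.1 : ℕ) : F) • single h (1 : F) + Q * tDeriv₁ _ _ _ (single h (1 : F)) := by
    rw [pd₁_of_mem (single_mem_hA h 1), hΓ, zero_smul, zero_add, add_mul, mul_comm t₁, mul_assoc,
      t₁_mul_tDeriv₁_single]
  have hQ' : Q * tDeriv₁ _ _ _ (single h (1 : F)) ∈ below J₁ J₂ ρ (wt ρ (m + h)) := by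
    rw [tDeriv₁_single]
    rcases Nat.eq_zero_or_pos (h.2.1 : ℕ) with h0 | h0
    · simp [h0]
    · intro n hn
      obtain ⟨i, hi, j, hj, rfl⟩ := Finset.mem_add.1
        (AddMonoidAlgebra.support_coeff_mul_subset _ _ (Finsupp.mem_support_iff.2 hn))
      have hi0 : (i.2.1 : ℕ) = 0 := by
        by_contra h'
        exact Finsupp.mem_support_iff.1 hi (coeff_eq_zero_of_tDeriv₁ hQ h')
      have hj0 : (h.1, predE J₁ h.2.1, h.2.2) = j := by
        by_contra h'
        rw [Finsupp.mem_support_iff, AddMonoidAlgebra.coeff_single, Finsupp.single_apply, if_neg h'] at hj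
        exact hj rfl
      refine wt_lt_wt.2 (Or.inl ?_)
      rw [← hj0]
      simp only [Prod.snd_add, Prod.fst_add, AddSubmonoid.coe_add, hi0, predE]
      omega
  have hR' := hR.mul ((leads_single (ρ := ρ) (m := h) (a := (1 : F))).smul ((h.2.1 : ℕ) : F))
  rw [opA_apply, add_assoc, e]
  have := ((hP.mul leads_sd₂).sub (hR'.add (leads_of_mem_below hQ'))).add
    (leads_of_mem_below (mem_below_of_wt_lt (μ := μ) (f := f) hm h))
  rwa [add_zero, add_zero, mul_one] at this

/-- For `α ≠ 0` the multiples of `α` are distinct and eventually avoid `σ₁` and `σ₂`; for `α = 0`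
they never meet them. The bound `2 ≤ s` keeps the later factors `n + s - 1` nonzero. -/
theorem exists_nsmul_ne (α : Γ) : ∃ s : ℕ, 2 ≤ s ∧ ∀ n : ℕ,
    ((n • α + s • α : Γ) : F × F) ≠ σ₁ ∧ ((n • α + s • α : Γ) : F × F) ≠ σ₂ := by
  by_cases h0 : α = 0
  · refine ⟨2, le_rfl, fun n => ?_⟩
    have : ((n • α + 2 • α : Γ) : F × F) = 0 := by simp [h0]
    rw [this]
    constructor
    · intro h; exact zero_ne_one (congrArg Prod.snd h)
    · intro h; exact two_ne_zero (congrArg Prod.snd h).symm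
  · have hinj : Function.Injective fun n : ℕ => ((n • α : Γ) : F × F) := by
      intro a b hab
      have h1 : ((a : F) - b) • (α : F × F) = 0 := by
        rw [sub_smul, Nat.cast_smul_eq_nsmul, Nat.cast_smul_eq_nsmul, sub_eq_zero]
        exact hab
      rcases smul_eq_zero.1 h1 with h | h
      · exact Nat.cast_injective (R := F) (sub_eq_zero.1 h)
      · exact absurd (Subtype.ext h) h0
    obtain ⟨N, hN⟩ := ((Set.toFinite ({σ₁, σ₂} : Set (F × F))).preimage hinj.injOn).bddAbove
    refine ⟨N + 2, by omega, fun n => ?_⟩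
    rw [← add_smul]
    have key : ((n + (N + 2)) • α : Γ) ∉ Subtype.val ⁻¹' ({σ₁, σ₂} : Set (F × F)) := fun h => by
      have h1 : n + (N + 2) ≤ N := hN h
      omega
    constructor
    · exact fun h => key (Or.inl h)
    · exact fun h => key (Or.inr h)

theorem eq_smul_one {v : SemigroupAlg Γ J₁ J₂} (h : ∀ s, v.coeff s ≠ 0 → s = 0) :
    ∃ c : F, v = c • 1 := by
  classical
  refine ⟨v.coeff 0, AddMonoidAlgebra.coeff_injective (Finsupp.ext fun s => ?_)⟩
  rw [AddMonoidAlgebra.one_def, AddMonoidAlgebra.smul_single, AddMonoidAlgebra.coeff_single,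
    Finsupp.single_apply]
  split_ifs with e
  · rw [← e, smul_eq_mul, mul_one]
  · by_contra hne
    exact e (h s hne).symm

theorem not_dead {m : Γ × J₁.1 × J₂.1} (h₁ : (m.1 : F × F) ≠ σ₁) (h₂ : (m.1 : F × F) ≠ σ₂) :
    ¬ Dead m := by
  rintro (h | h)
  · exact h₁ h.1
  · exact h₂ h.2

/-- If `π₁(Γ) ≠ 0`, a locally finite derivation is induced with constant `Q` and `P = 0`. -/
theorem exists_of_isLocallyFinite (hΓ : proj₁ Γ ≠ 0) {d : Der Γ J₁ J₂}
    (hd : IsInduced d P Q μ f) (hlf : IsLocallyFinite d) : P = 0 ∧ ∃ q : F, Q = q • 1 := by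
  classical
  by_cases hS : ∃ s ∈ P.coeff.support ∪ Q.coeff.support, s ≠ 0
  · exfalso
    obtain ⟨ρ, m, hmS, hm, hmax⟩ := exists_weight _ hS
    have hP : Leads ρ m (P.coeff m) P := leads_coeff fun s hs hne =>
      hmax s (Finset.mem_union_left _ (Finsupp.mem_support_iff.2 hs)) hne
    have hQ : Leads ρ m (Q.coeff m) Q := leads_coeff fun s hs hne =>
      hmax s (Finset.mem_union_right _ (Finsupp.mem_support_iff.2 hs)) hne
    have hcompat : P.coeff m * ((m.1 : F × F).2 - 1) = Q.coeff m * (m.1 : F × F).1 := by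
      rw [← hP.sd₂.coeff_eq, ← hQ.pd₁.coeff_eq, hd.compat]
    -- With `p`, `q` the coefficients of `P`, `Q` at `m`, compatibility says `p m₂ - q m₁ = p`. Each
    -- further shift by `m` therefore increases the factor by exactly `p`.
    have hl : ∀ (n : ℕ) (γ : Γ), P.coeff m * (((n • m + (γ, 0, 0)).1 : F × F).2 - 1) -
        Q.coeff m * ((n • m + (γ, 0, 0)).1 : F × F).1 =
        P.coeff m * ((γ : F × F).2 - 1) - Q.coeff m * (γ : F × F).1 + n * P.coeff m := by
      intro n γ
      have e1 : ((n • m + (γ, 0, 0)).1 : F × F).1 = n * (m.1 : F × F).1 + (γ : F × F).1 := by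
        simp
      have e2 : ((n • m + (γ, 0, 0)).1 : F × F).2 = n * (m.1 : F × F).2 + (γ : F × F).2 := by
        simp
      rw [e1, e2]
      linear_combination (n : F) * hcompat
    -- If `p = 0`, then `q ≠ 0` and compatibility gives `m₁ = 0`, so the factor is the constant `-q
    -- γ₁`. Starting from `x^γ` with `γ₁ ≠ 0`, the first coordinate never vanishes, and no dead
    -- monomial is met.
    by_cases hp : P.coeff m = 0
    · have hq : Q.coeff m ≠ 0 := by
        rcases Finset.mem_union.1 hmS with h | h
        · exact absurd hp (Finsupp.mem_support_iff.1 h)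
        · exact Finsupp.mem_support_iff.1 h
      have hα : (m.1 : F × F).1 = 0 := by
        rw [hp, zero_mul] at hcompat
        exact (mul_eq_zero.1 hcompat.symm).resolve_left hq
      obtain ⟨γ, hγ⟩ := exists_fst_ne_zero hΓ
      have e1 : ∀ n : ℕ, ((n • m + (γ, 0, 0)).1 : F × F).1 = (γ : F × F).1 := fun n => by
        simp [hα]
      refine not_isLocallyFinite_of_leads hd.apply_pB hm (leads_opA hm hP hQ) (g := (γ, 0, 0))
        (fun n => ?_) (fun n => not_dead ?_ ?_) hlf
      · rw [hl, hp]
        simpa using ⟨hq, hγ⟩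
      · exact fun h => hγ (by rw [← e1 n, h]; rfl)
      · exact fun h => hγ (by rw [← e1 n, h]; rfl)
    -- Starting from `s m`, the factor at the `n`-th step is `p (n + s - 1)`.
    · obtain ⟨s, hs, hs'⟩ := exists_nsmul_ne m.1
      refine not_isLocallyFinite_of_leads hd.apply_pB hm (leads_opA hm hP hQ)
        (g := (s • m.1, 0, 0)) (fun n => ?_) (fun n => not_dead (hs' n).1 (hs' n).2) hlf
      have e : P.coeff m * (((s • m.1 : Γ) : F × F).2 - 1) - Q.coeff m * ((s • m.1 : Γ) : F × F).1
          + n * P.coeff m = P.coeff m * ((n + s - 1 : ℕ) : F) := by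
        rw [Nat.cast_sub (by omega)]
        have e1 : ((s • m.1 : Γ) : F × F).1 = s * (m.1 : F × F).1 := by simp
        have e2 : ((s • m.1 : Γ) : F × F).2 = s * (m.1 : F × F).2 := by simp
        rw [e1, e2]
        push_cast
        linear_combination (s : F) * hcompat
      rw [hl, e]
      exact mul_ne_zero hp (Nat.cast_ne_zero.2 (by omega))
  · push Not at hS
    obtain ⟨p, rfl⟩ := eq_smul_one fun s hs =>
      hS s (Finset.mem_union_left _ (Finsupp.mem_support_iff.2 hs))
    obtain ⟨q, rfl⟩ := eq_smul_one fun s hs =>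
      hS s (Finset.mem_union_right _ (Finsupp.mem_support_iff.2 hs))
    refine ⟨?_, q, rfl⟩
    have := hd.compat
    rw [map_smul, sd₂_one, Derivation.map_smul, Derivation.map_one_eq_zero, smul_zero, smul_neg, neg_eq_zero] at this
    exact this

theorem exists_eq_t₁_mul_add (v : SemigroupAlg Γ J₁ J₂) :
    ∃ R Q : SemigroupAlg Γ J₁ J₂, tDeriv₁ _ _ _ Q = 0 ∧ v = t₁ * R + Q := by
  have := span_mono (LinearMap.range (LinearMap.mulLeft F (t₁ : SemigroupAlg Γ J₁ J₂)) ⊔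
    LinearMap.ker (tDeriv₁ Γ J₁ J₂).toLinearMap) (fun γ k l hk hl => ?_) v
  · obtain ⟨_, ⟨R, rfl⟩, Q, hQ, rfl⟩ := Submodule.mem_sup.1 this
    exact ⟨R, Q, hQ, rfl⟩
  · cases k with
    | zero =>
      refine Submodule.mem_sup_right ?_
      rw [LinearMap.mem_ker, Derivation.coeFn_coe, tDeriv₁_mono hk]
      simp
    | succ k =>
      refine Submodule.mem_sup_left ⟨ex γ * t₁ ^ k * t₂ ^ l, ?_⟩
      rw [LinearMap.mulLeft_apply]
      ring

/-- If `π₁(Γ) = 0`, a locally finite derivation is induced with constant `P`. -/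
theorem exists_of_isLocallyFinite_of_proj₁_eq_zero (hJ : J₁.1 = ⊤)
    (hΓ : ∀ γ : Γ, (γ : F × F).1 = 0) {d : Der Γ J₁ J₂} (hd : IsInduced d P Q μ f)
    (hlf : IsLocallyFinite d) : ∃ p : F, P = p • 1 := by
  classical
  obtain ⟨R, Q₀, hQ₀, rfl⟩ := exists_eq_t₁_mul_add Q
  -- The compatibility condition determines `R` by `P`: on a monomial with `t₁`-exponent `i` it
  -- multiplies the coefficient of `R` by `i + 1`, so every monomial of `R` occurs in `D P`.
  have hR : 𝔇 P = R + t₁ * tDeriv₁ _ _ _ R := by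
    rw [hd.compat, map_add, pd₁_eq_tDeriv₁ hΓ Q₀, hQ₀, add_zero, Derivation.leibniz, pd₁_t₁ hJ, pd₁_eq_tDeriv₁ hΓ]
    simp only [smul_eq_mul]
    ring
  have hRc : ∀ s, (R + t₁ * tDeriv₁ _ _ _ R).coeff s = ((s.2.1 : ℕ) + 1 : F) * R.coeff s := by
    intro s
    have key : ∀ v : SemigroupAlg Γ J₁ J₂,
        coeffL s (v + t₁ * tDeriv₁ _ _ _ v) = ((s.2.1 : ℕ) + 1 : F) * coeffL s v := by
      intro v
      induction v using AddMonoidAlgebra.induction_linear with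
      | zero => simp
      | add u v hu hv =>
        rw [map_add (coeffL s) u v, mul_add _ (coeffL s u), ← hu, ← hv, ← map_add, map_add (tDeriv₁ _ _ _)]
        congr 1
        ring
      | single h c =>
        rw [← mul_one c, ← smul_eq_mul, ← AddMonoidAlgebra.smul_single, Derivation.map_smul, mul_smul_comm,
          t₁_mul_tDeriv₁_single, ← smul_add, map_smul, map_add, map_smul, map_smul, coeffL_apply,
          AddMonoidAlgebra.coeff_single, Finsupp.single_apply]
        split_ifs with e
        · subst e; simp only [smul_eq_mul]; ring
        · simp
    exact key R
  refine eq_smul_one ?_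
  by_contra! hS
  obtain ⟨s, hs, hs0⟩ := hS
  obtain ⟨ρ, m, hmS, hm, hmax⟩ := exists_weight P.coeff.support
    ⟨s, Finsupp.mem_support_iff.2 hs, hs0⟩
  have hp := Finsupp.mem_support_iff.1 hmS
  have hP : Leads ρ m (P.coeff m) P := leads_coeff fun s hs hne =>
    hmax s (Finsupp.mem_support_iff.2 hs) hne
  have hRm : Leads ρ m (R.coeff m) R := leads_coeff fun s hs hne => by
    refine hP.sd₂.lt_of_ne ?_ hne
    rw [hR, hRc]
    exact mul_ne_zero (Nat.cast_add_one_ne_zero (s.2.1 : ℕ)) hs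
  have hcompat : P.coeff m * ((m.1 : F × F).2 - 1) = ((m.2.1 : ℕ) + 1 : F) * R.coeff m := by
    rw [← hP.sd₂.coeff_eq, hR, hRc]
  -- With `p`, `r` the coefficients of `P`, `R` at `m` and `i` the `t₁`-exponent of `m`,
  -- compatibility gives `p m₂ - r i = p + r`, the increase of the factor at each step.
  have hl : ∀ (n : ℕ) (γ : Γ) (k : J₁.1), P.coeff m * (((n • m + (γ, k, 0)).1 : F × F).2 - 1) -
      R.coeff m * (((n • m + (γ, k, 0)).2.1 : ℕ) : F) =
      P.coeff m * ((γ : F × F).2 - 1) - R.coeff m * (k : ℕ) + n * (P.coeff m + R.coeff m) := by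
    intro n γ k
    have e1 : (((n • m + (γ, k, 0)).2.1 : ℕ) : F) = n * (m.2.1 : ℕ) + (k : ℕ) := by
      simp
    have e2 : ((n • m + (γ, k, 0)).1 : F × F).2 = n * (m.1 : F × F).2 + (γ : F × F).2 := by
      simp
    rw [e1, e2]
    linear_combination (n : F) * hcompat
  have hdead : ∀ (n : ℕ) (γ : Γ) (k : J₁.1), (k : ℕ) ≠ 0 → ¬ Dead (n • m + (γ, k, 0)) := by
    rintro n γ k hk (h | h)
    · have := congrArg (fun x : J₁.1 × J₂.1 => (x.1 : ℕ)) h.2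
      simp only [Prod.snd_add, Prod.fst_add, AddSubmonoid.coe_add, Prod.fst_zero,
        ZeroMemClass.coe_zero] at this
      omega
    · exact absurd (hJ.symm.trans h.1.1) top_ne_bot
  -- If `p + r = 0`, the start `t₁^2` gives the constant factor `-p - 2r = p`. Otherwise the start
  -- with degree `2 m₁` (the degree part of `m` doubled) and `t₁`-exponent `2 i + 1` gives `(n +
  -- 1)(p + r)`. In both cases the positive power of `t₁` keeps the monomials alive.
  by_cases h0 : P.coeff m + R.coeff m = 0
  · refine not_isLocallyFinite_of_leads hd.apply_pB hm
      (leads_opA_of_proj₁_eq_zero hΓ hm hP hRm hQ₀) (g := (0, ⟨2, by simp [hJ]⟩, 0))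
      (fun n => ?_) (fun n => hdead n _ _ (by simp)) hlf
    rw [hl, h0]
    have e : R.coeff m = -P.coeff m := by linear_combination h0
    rw [e]
    simp only [ZeroMemClass.coe_zero, Prod.snd_zero]
    intro h
    refine hp ?_
    push_cast at h
    linear_combination h
  · refine not_isLocallyFinite_of_leads hd.apply_pB hm
      (leads_opA_of_proj₁_eq_zero hΓ hm hP hRm hQ₀)
      (g := (2 • m.1, ⟨2 * m.2.1 + 1, by simp [hJ]⟩, 0))
      (fun n => ?_) (fun n => hdead n _ _ (by simp)) hlf
    have e : P.coeff m * (((2 • m.1 : Γ) : F × F).2 - 1) -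
        R.coeff m * ((2 * m.2.1 + 1 : ℕ) : F) + n * (P.coeff m + R.coeff m) =
        ((n + 1 : ℕ) : F) * (P.coeff m + R.coeff m) := by
      have e2 : ((2 • m.1 : Γ) : F × F).2 = 2 * (m.1 : F × F).2 := by simp
      rw [e2]
      push_cast
      linear_combination 2 * hcompat
    rw [hl, e]
    exact mul_ne_zero (Nat.cast_ne_zero.2 (by omega)) h0

/-! ### Explicit form of the locally finite derivations. -/

theorem xB_zero_zero : xB Γ J₁ J₂ 0 0 = pB Γ J₁ J₂ 1 := by
  rw [← pB_xA, xA_zero_zero]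

theorem isInduced_of_const (a : F) (μ : Γ →+ F) (f : F) :
    IsInduced (a • adB (pB Γ J₁ J₂ 1) + dHom Γ J₁ J₂ μ + f • dt₂ Γ J₁ J₂) 0 (-a • 1) μ f := by
  convert (((isInduced_adB (one_mem_dom (Γ := Γ) (J₁ := J₁) (J₂ := J₂))).smul a).add
    (isInduced_dHom μ)).add (isInduced_dt₂.smul f) using 1 <;> simp [sd₂_one]

theorem isLocallyFinite_eq {H : Submodule F (Γ →+ F)} (hH : IsHomStar J₁ H) (hΓ : proj₁ Γ ≠ 0) :
    {d : Der Γ J₁ J₂ | IsLocallyFinite d} = {d | ∃ a : F, ∃ μ ∈ H, ∃ f : F,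
      d = a • adB (xB Γ J₁ J₂ 0 0) + dHom Γ J₁ J₂ μ + f • dt₂ Γ J₁ J₂} := by
  ext d
  simp only [Set.mem_ofPred_eq]
  rw [xB_zero_zero]
  constructor
  · intro hlf
    obtain ⟨P, Q, μ, f, hd⟩ := exists_isInduced d
    obtain ⟨rfl, q, rfl⟩ := exists_of_isLocallyFinite hΓ hd hlf
    obtain ⟨k, ν, hν, e⟩ := exists_dHom_eq (J₂ := J₂) hH μ
    refine ⟨-q + k, ν, hν, f, ?_⟩
    have h := isInduced_of_const (J₁ := J₁) (J₂ := J₂) (-q) μ f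
    rw [neg_neg] at h
    rw [hd.eq h, e, add_smul]
    abel
  · rintro ⟨a, μ, -, f, rfl⟩
    refine isLocallyFinite_of_isInduced (p := 0) (Q := -a • 1) (μ := μ) (f := f) ?_
      (fun γ => zero_mul _)
      (by rw [Derivation.map_smul, Derivation.map_one_eq_zero, smul_zero]) (fun γ => ⟨(γ : F × F).1 * -a, smul_smul _ _ _⟩)
    rw [zero_smul, zero_smul, sub_zero]
    exact isInduced_of_const a μ f

/-- The generators of the inner locally finite derivations in the case `π₁(Γ) = 0`. -/
def innerGen (Γ : AddSubgroup (F × F)) (J₁ J₂ : ExpMonoid) : Set (Der Γ J₁ J₂) :=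
  {e | ∃ α ∈ Γ, ∃ i : ℕ × ℕ, i.1 ∈ J₁.1 ∧ i.2 ∈ J₂.1 ∧ (i.1 = 0 ∨ (α = 0 ∧ i = (1, 0))) ∧
    e = adB (xB Γ J₁ J₂ α i)}

theorem adB_pB_mem_span_innerGen {u : SemigroupAlg Γ J₁ J₂} (hu : tDeriv₁ _ _ _ u = 0) :
    adB (pB Γ J₁ J₂ u) ∈ Submodule.span F (innerGen Γ J₁ J₂) := by
  refine span_mono_of_tDeriv₁ ((Submodule.span F (innerGen Γ J₁ J₂)).comap
    ((LieDerivation.ad F (B Γ J₁ J₂) : B Γ J₁ J₂ →ₗ[F] Der Γ J₁ J₂) ∘ₗ pB Γ J₁ J₂))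
    (fun α j hj => ?_) hu
  rw [Submodule.mem_comap]
  refine Submodule.subset_span ⟨α, α.2, (0, j), zero_mem _, hj, Or.inl rfl, ?_⟩
  rw [← pB_xA]
  have e : xA Γ J₁ J₂ α (0, j) = ex α * t₂ ^ j := by
    have h := single_eq (J₁ := J₁) (α, 0, (⟨j, hj⟩ : J₂.1)) (1 : F)
    rw [← xA_of_mem] at h
    simpa using h
  rw [e]
  rfl

theorem isInduced_adB_t₁ (hJ : J₁.1 = ⊤) :
    IsInduced (adB (pB Γ J₁ J₂ t₁)) 1 (-t₁) 0 0 := by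
  have h := isInduced_adB (mem_dom_of_top hJ (t₁ : SemigroupAlg Γ J₁ J₂))
  rwa [pd₁_t₁ hJ, sd₂_t₁] at h

/-- The inner derivations in the span of the generators are induced with `P` constant. -/
theorem exists_isInduced_of_mem_span (hJ : J₁.1 = ⊤) (hΓ : ∀ γ : Γ, (γ : F × F).1 = 0)
    {w : Der Γ J₁ J₂} (hw : w ∈ Submodule.span F (innerGen Γ J₁ J₂)) :
    ∃ (p : F) (Q : SemigroupAlg Γ J₁ J₂), tDeriv₁ _ _ _ Q = 0 ∧
      IsInduced w (p • 1) (Q - p • t₁) 0 0 := by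
  induction hw using Submodule.span_induction with
  | mem w hw =>
    obtain ⟨α, hα, ⟨i, j⟩, hi, hj, h, rfl⟩ := hw
    rw [← pB_xA]
    rcases h with h | ⟨rfl, h⟩
    · obtain rfl : i = 0 := h
      have h0 : tDeriv₁ _ _ _ (xA Γ J₁ J₂ α (0, j)) = 0 := by
        unfold xA
        split_ifs
        · simp [tDeriv₁_single]
        · simp
      refine ⟨0, 𝔇 (xA Γ J₁ J₂ α (0, j)), ?_, ?_⟩
      · rw [← pd₁_eq_tDeriv₁ hΓ, pd₁_sd₂, pd₁_eq_tDeriv₁ hΓ, h0, map_zero]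
      · have h1 := isInduced_adB (mem_dom_of_top hJ (xA Γ J₁ J₂ α (0, j)))
        rw [pd₁_eq_tDeriv₁ hΓ, h0] at h1
        rwa [zero_smul, zero_smul, sub_zero]
    · rw [h]
      refine ⟨1, 0, map_zero _, ?_⟩
      rw [one_smul, one_smul, zero_sub]
      exact isInduced_adB_t₁ hJ
  | zero =>
    refine ⟨0, 0, map_zero _, ?_⟩
    rw [zero_smul, zero_smul, sub_zero]
    exact isInduced_zero
  | add v w _ _ hv hw =>
    obtain ⟨p, Q, hQ, h⟩ := hv
    obtain ⟨p', Q', hQ', h'⟩ := hw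
    refine ⟨p + p', Q + Q', by rw [map_add, hQ, hQ', add_zero], ?_⟩
    convert h.add h' using 1
    · rw [add_smul]
    · rw [add_smul]; abel
    · rw [add_zero]
    · rw [add_zero]
  | smul c w _ hw =>
    obtain ⟨p, Q, hQ, h⟩ := hw
    refine ⟨c * p, c • Q, by rw [Derivation.map_smul, hQ, smul_zero], ?_⟩
    convert h.smul c using 1
    · rw [smul_smul]
    · rw [smul_sub, smul_smul]
    · rw [smul_zero]
    · rw [mul_zero]

/-- On the kernel of `∂_{t₁}`, the image of `∂₂ - 1` has the complement `F x^{σ₁,0}` if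
`J₂ = {0}`, and is everything otherwise. -/
theorem exists_eq_sd₂_add (hΓ : ∀ γ : Γ, (γ : F × F).1 = 0) {v : SemigroupAlg Γ J₁ J₂}
    (hv : tDeriv₁ _ _ _ v = 0) : ∃ (u : SemigroupAlg Γ J₁ J₂) (c : F), tDeriv₁ _ _ _ u = 0 ∧
      (J₂.1 ≠ ⊥ → c = 0) ∧ v = 𝔇 u + c • xA Γ J₁ J₂ σ₁ 0 := by
  by_cases hJ₂ : J₂.1 = ⊥
  · have h := span_mono_of_tDeriv₁ ((LinearMap.ker (tDeriv₁ Γ J₁ J₂).toLinearMap).map (sd₂ Γ J₁ J₂) ⊔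
      F ∙ xA Γ J₁ J₂ σ₁ 0) (fun α j hj => ?_) hv
    · obtain ⟨_, ⟨u, hu, rfl⟩, y, hy, rfl⟩ := Submodule.mem_sup.1 h
      obtain ⟨c, rfl⟩ := Submodule.mem_span_singleton.1 hy
      exact ⟨u, c, hu, fun h => absurd hJ₂ h, rfl⟩
    · obtain rfl : j = 0 := by simpa [hJ₂] using hj
      rw [pow_zero, mul_one]
      by_cases hα : (α : F × F) = σ₁
      · refine Submodule.mem_sup_right (Submodule.mem_span_singleton.2 ⟨1, ?_⟩)
        rw [xA_σ₁ (hα ▸ α.2), one_smul]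
        congr 1
        exact Subtype.ext hα.symm
      · obtain ⟨u, -, hu, e⟩ := exists_sd₂_eq (J₁ := J₁) (J₂ := J₂)
          (Or.inl fun h => hα (Prod.ext (hΓ α) h)) (ex_mem_hA α) (tDeriv₁_ex α)
        exact Submodule.mem_sup_left ⟨u, hu, e⟩
  · have h := span_mono_of_tDeriv₁ ((LinearMap.ker (tDeriv₁ Γ J₁ J₂).toLinearMap).map
      (sd₂ Γ J₁ J₂)) (fun α j hj => ?_) hv
    · obtain ⟨u, hu, rfl⟩ := h
      exact ⟨u, 0, hu, fun _ => rfl, by rw [zero_smul, add_zero]⟩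
    · obtain ⟨u, -, hu, e⟩ := exists_sd₂_eq (J₁ := J₁) (J₂ := J₂) (α := α)
        (w := ex α * t₂ ^ j) (Or.inr (ExpMonoid.eq_top_of_ne_bot hJ₂))
        (by simpa using ex_t_mem_hA (J₁ := J₁) α (zero_mem _) hj)
        (by simpa using tDeriv₁_mono (J₁ := J₁) (J₂ := J₂) (γ := α) (l := j) (zero_mem _))
      exact ⟨u, hu, e⟩

theorem isInduced_smul_d₁ {c : F} (hc : J₂.1 ≠ ⊥ → c = 0) :
    IsInduced (c • d₁ Γ J₁ J₂) 0 (c • xA Γ J₁ J₂ σ₁ 0) 0 0 := by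
  by_cases h : J₂.1 = ⊥
  · convert (isInduced_d₁ (Γ := Γ) (J₁ := J₁) h).smul c using 1 <;> simp
  · rw [hc h, zero_smul, zero_smul]
    exact isInduced_zero

theorem tDeriv₁_xA_σ₁ : tDeriv₁ _ _ _ (xA Γ J₁ J₂ σ₁ 0) = 0 := by
  unfold xA
  split_ifs
  · simp [tDeriv₁_single]
  · simp

/-- If `P = p`, compatibility gives `∂₁ Q = -p`, so `Q + p t₁` does not involve `t₁` and equals `D u
+ c x^{σ₁}` with `u` free of `t₁`. The three pieces of `Q` come from `p ad t₁`, `ad_u` and `c d₁`.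
Conversely, every listed derivation has a scalar `P` and such a `Q`, so it is triangular on
monomials. -/
theorem isLocallyFinite_eq_of_proj₁_eq_zero (hΓ : proj₁ Γ = 0) :
    {d : Der Γ J₁ J₂ | IsLocallyFinite d} = {d | ∃ w ∈ Submodule.span F (innerGen Γ J₁ J₂),
      ∃ μ : Γ →+ F, ∃ a f : F, d = w + dHom Γ J₁ J₂ μ + a • d₁ Γ J₁ J₂ + f • dt₂ Γ J₁ J₂} := by
  have hJ : J₁.1 = ⊤ := ExpMonoid.eq_top_of_ne_bot fun h =>
    Nondegenerate.proj₁_ne_zero (Γ := Γ) (J₂ := J₂) h hΓ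
  have hΓ' : ∀ γ : Γ, (γ : F × F).1 = 0 := fun γ => DFunLike.congr_fun hΓ γ
  ext d
  simp only [Set.mem_ofPred_eq]
  constructor
  · intro hlf
    obtain ⟨P, Q, μ, f, hd⟩ := exists_isInduced d
    obtain ⟨p, rfl⟩ := exists_of_isLocallyFinite_of_proj₁_eq_zero hJ hΓ' hd hlf
    have hQ : tDeriv₁ _ _ _ (Q + p • t₁) = 0 := by
      rw [← pd₁_eq_tDeriv₁ hΓ', map_add, ← hd.compat, Derivation.map_smul, pd₁_t₁ hJ, map_smul,
        sd₂_one, smul_neg, neg_add_cancel]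
    obtain ⟨u, c, hu, hc, e⟩ := exists_eq_sd₂_add hΓ' hQ
    refine ⟨p • adB (pB Γ J₁ J₂ t₁) + adB (pB Γ J₁ J₂ u), Submodule.add_mem _
      (Submodule.smul_mem _ _ (Submodule.subset_span ⟨0, zero_mem _, (1, 0), by simp [hJ],
        zero_mem _, Or.inr ⟨rfl, rfl⟩, by rw [← pB_xA]; rfl⟩)) (adB_pB_mem_span_innerGen hu),
      μ, c, f, hd.eq ?_⟩
    convert ((((isInduced_adB_t₁ hJ).smul p).add (isInduced_adB (mem_dom_of_top hJ u))).add
      (isInduced_dHom μ)).add (isInduced_smul_d₁ hc) |>.add (isInduced_dt₂.smul f) using 1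
    · rw [pd₁_eq_tDeriv₁ hΓ', hu]; simp
    · rw [eq_sub_of_add_eq e, smul_neg, smul_zero]; abel
    · simp
    · simp
  · rintro ⟨w, hw, μ, a, f, rfl⟩
    obtain ⟨p, Q, hQ, h⟩ := exists_isInduced_of_mem_span hJ hΓ' hw
    have ha : ∃ c : F, (J₂.1 ≠ ⊥ → c = 0) ∧ a • d₁ Γ J₁ J₂ = c • d₁ Γ J₁ J₂ := by
      by_cases hJ₂ : J₂.1 = ⊥
      · exact ⟨a, fun h => absurd hJ₂ h, rfl⟩
      · exact ⟨0, fun _ => rfl, by rw [d₁_eq_zero hJ₂, smul_zero, smul_zero]⟩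
    obtain ⟨c, hc, e⟩ := ha
    rw [e]
    refine isLocallyFinite_of_isInduced (p := p) (Q := Q + c • xA Γ J₁ J₂ σ₁ 0) (μ := μ) (f := f) ?_
      (fun γ => by rw [hΓ', mul_zero])
      (by rw [map_add, hQ, Derivation.map_smul, tDeriv₁_xA_σ₁, smul_zero, add_zero])
      (fun γ => ⟨0, by rw [hΓ', zero_smul, zero_smul]⟩)
    convert ((h.add (isInduced_dHom μ)).add (isInduced_smul_d₁ hc)).add
      (isInduced_dt₂.smul f) using 1
    · simp
    · rw [smul_zero]; abel
    · simp
    · simp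

end

end BlockLie

theorem theorem2p6 {F : Type*} [Field F] [CharZero F] (Γ : AddSubgroup (F × F)) [DecidableEq Γ]
    (J₁ J₂ : BlockLie.ExpMonoid)
    (h₁ : J₁.1 = ⊥ → BlockLie.proj₁ Γ ≠ 0) (h₂ : J₂.1 = ⊥ → BlockLie.proj₂ Γ ≠ 0)
    (H : Submodule F (Γ →+ F)) (hH : BlockLie.IsHomStar J₁ H) :
    DirectSum.IsInternal (BlockLie.derGr Γ J₁ J₂) ∧
    (∀ α : Γ, (BlockLie.derGr Γ J₁ J₂ α : Set (BlockLie.Der Γ J₁ J₂)) =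
      {d | ∃ u ∈ BlockLie.gr Γ J₁ J₂ α, ∃ μ ∈ H, ∃ f₁ f₂ f₃ f₄ : F,
        (α ≠ 0 → μ = 0 ∧ f₄ = 0) ∧
        ((α : F × F) ≠ BlockLie.σ₁ → f₁ = 0 ∧ f₂ = 0) ∧
        ((α : F × F) ≠ BlockLie.σ₂ → f₃ = 0) ∧
        d = BlockLie.stdDer u μ f₁ f₂ f₃ f₄}) ∧
    (BlockLie.proj₁ Γ ≠ 0 →
      {d : BlockLie.Der Γ J₁ J₂ | BlockLie.IsLocallyFinite d} =
        {d | ∃ a : F, ∃ μ ∈ H, ∃ f : F,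
          d = a • BlockLie.adB (BlockLie.xB Γ J₁ J₂ 0 0) + BlockLie.dHom Γ J₁ J₂ μ
            + f • BlockLie.dt₂ Γ J₁ J₂}) ∧
    (BlockLie.proj₁ Γ = 0 →
      {d : BlockLie.Der Γ J₁ J₂ | BlockLie.IsLocallyFinite d} =
        {d | ∃ w ∈ Submodule.span F
              {e : BlockLie.Der Γ J₁ J₂ | ∃ α ∈ Γ, ∃ i : ℕ × ℕ, i.1 ∈ J₁.1 ∧ i.2 ∈ J₂.1 ∧
                (i.1 = 0 ∨ (α = 0 ∧ i = (1, 0))) ∧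
                e = BlockLie.adB (BlockLie.xB Γ J₁ J₂ α i)},
            ∃ μ : Γ →+ F, ∃ a f : F,
              d = w + BlockLie.dHom Γ J₁ J₂ μ + a • BlockLie.d₁ Γ J₁ J₂
                + f • BlockLie.dt₂ Γ J₁ J₂}) := by
  have : BlockLie.Nondegenerate Γ J₁ J₂ := ⟨h₁⟩
  exact ⟨BlockLie.isInternal_derGr BlockLie.exists_compDer_support, BlockLie.derGr_eq hH,
    BlockLie.isLocallyFinite_eq hH, BlockLie.isLocallyFinite_eq_of_proj₁_eq_zero⟩
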